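/- A fixed-mobile bigraph is a finite bipartite graph $G=(V_f,V_m,E)$ together with pairwise distinct points $\phi(v)\in\mathbb{R}^2$, $v\in V_f$. A planar $0$-bend drawing of $\langle G,\phi\rangle$ assigns to the vertices of $G$ pairwise distinct points of the plane, with each $v\in V_f$ at $\phi(v)$, and draws each edge as the straight-line segment between its endpoints, so that no vertex lies on an edge except as one of its endpoints and any two different edges meet at most in a common endpoint. For input to a machine, $\langle G,\phi\rangle$ is given by the bipartite adjacency matrix of $G$ and by the coordinates of the points $\phi(v)$, which are rational numbers written as fractions of integers in binary. Theorem. The following decision problem belongs to NP: given a fixed-mobile bigraph $\langle G,\phi\rangle$, does it have a planar $0$-bend drawing in which each mobile vertex $u\in V_m$ lies in the convex hull of (the positions of) its neighbours? That is, the set of words that encode a yes-instance is a language in NP (polynomial-length certificates, checked by a Turing machine in polynomial time). Neither planarity of $G$ nor general position of the points $\phi(v)$ is presupposed. -/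

import Mathlib

/-! ### Planar straight-line drawings of graphs -/

/-- A planar straight-line drawing of `G`: the vertices are distinct points of the plane, the edge
`ab` is the segment between the points of `a` and `b`, no vertex lies on an edge other than as an
endpoint of it, and two different edges meet at most in a common endpoint. -/
structure SimpleGraph.IsPlanarStraightLineDrawing {V : Type*} (G : SimpleGraph V)
    (p : V → ℝ × ℝ) : Prop where
  injective : Function.Injective p
  vertex_edge : ∀ a b v, G.Adj a b → p v ∈ segment ℝ (p a) (p b) → v = a ∨ v = b
  edge_edge : ∀ a b c d, G.Adj a b → G.Adj c d → s(a, b) ≠ s(c, d) →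
    ∀ x ∈ segment ℝ (p a) (p b) ∩ segment ℝ (p c) (p d),
      ∃ v, v ∈ s(a, b) ∧ v ∈ s(c, d) ∧ x = p v

/-! ### Fixed-mobile bigraphs -/

/-- A fixed-mobile bigraph: a bipartite graph with vertex classes `Vf` (fixed vertices) and `Vm`
(mobile vertices), together with pairwise distinct positions of the fixed vertices. -/
structure FMBigraph (Vf Vm : Type*) where
  Adj : Vm → Vf → Prop
  pos : Vf → ℝ × ℝ
  pos_injective : Function.Injective pos

namespace FMBigraph

variable {Vf Vm : Type*}

/-- The underlying bipartite graph. -/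
def graph (B : FMBigraph Vf Vm) : SimpleGraph (Vf ⊕ Vm) where
  Adj
    | .inl f, .inr u => B.Adj u f
    | .inr u, .inl f => B.Adj u f
    | _, _ => False
  symm := ⟨by rintro (a | a) (b | b) h <;> exact h⟩
  loopless := ⟨by rintro (a | a) h <;> exact h⟩

/-- A planar 0-bend convex-hull drawing: a planar straight-line drawing in which every fixed vertex
is at its prescribed position and every mobile vertex lies in the convex hull of (the positions of)
its neighbours. -/
structure IsPlanarConvexHullDrawing (B : FMBigraph Vf Vm) (p : Vf ⊕ Vm → ℝ × ℝ) : Prop where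
  fixed : ∀ f, p (.inl f) = B.pos f
  planar : B.graph.IsPlanarStraightLineDrawing p
  hull : ∀ u, p (.inr u) ∈ convexHull ℝ (p '' B.graph.neighborSet (.inr u))

end FMBigraph

/-! ### Finite instances and their encoding as words -/

/-- A rational number written as a fraction (not necessarily in lowest terms). -/
structure Frac where
  num : ℤ
  den : ℕ
  den_pos : 0 < den

/-- The value of a fraction. -/
noncomputable def Frac.toReal (q : Frac) : ℝ := (q.num : ℝ) / (q.den : ℝ)

/-- A finite fixed-mobile bigraph with rational positions: `nf` fixed vertices, `nm` mobile
vertices, the bipartite adjacency matrix, and distinct positions for the fixed vertices. -/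
structure FMInstance where
  nf : ℕ
  nm : ℕ
  adj : Fin nm → Fin nf → Bool
  x : Fin nf → Frac
  y : Fin nf → Frac
  distinct : Function.Injective fun i => ((x i).toReal, (y i).toReal)

/-- The fixed-mobile bigraph described by an instance. -/
noncomputable def FMInstance.toFMBigraph (I : FMInstance) : FMBigraph (Fin I.nf) (Fin I.nm) where
  Adj u f := I.adj u f = true
  pos f := ((I.x f).toReal, (I.y f).toReal)
  pos_injective := I.distinct

/-- The input alphabet. -/
inductive Letter
  | bit (b : Bool)
  | minus
  | slash
  | comma
  | semicolon
  | hash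
  deriving DecidableEq, Fintype

namespace Letter

/-- Binary expansion, least significant bit first (empty for `0`). -/
def encodeNat (n : ℕ) : List Letter := n.bits.map bit

/-- Binary expansion of the absolute value, preceded by a minus sign for a negative number. -/
def encodeInt (z : ℤ) : List Letter :=
  if z < 0 then minus :: encodeNat z.natAbs else encodeNat z.natAbs

/-- `numerator / denominator`. -/
def encodeFrac (q : Frac) : List Letter := encodeInt q.num ++ slash :: encodeNat q.den

/-- `x , y`. -/
def encodePoint (x y : Frac) : List Letter := encodeFrac x ++ comma :: encodeFrac y

/-- A list of words, each one followed by a semicolon. -/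
def encodeBlocks (bs : List (List Letter)) : List Letter := bs.flatMap fun b => b ++ [semicolon]

end Letter

/-- The word that describes an instance: the positions of the fixed vertices, a hash sign, and the
rows of the adjacency matrix, one row for each mobile vertex. -/
def FMInstance.encode (I : FMInstance) : List Letter :=
  Letter.encodeBlocks (List.ofFn fun f => Letter.encodePoint (I.x f) (I.y f)) ++
    Letter.hash :: Letter.encodeBlocks (List.ofFn fun u => List.ofFn fun f => Letter.bit (I.adj u f))

/-! Different instances have different words. -/

namespace Letter

theorem split_at {s : Letter} {a a' b b' : List Letter} (h : a ++ s :: b = a' ++ s :: b')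
    (ha : s ∉ a) (ha' : s ∉ a') : a = a' ∧ b = b' := by
  induction a generalizing a' with
  | nil =>
    cases a' with
    | nil => exact ⟨rfl, (List.cons.inj h).2⟩
    | cons c' a' => exact absurd ((List.cons.inj h).1 ▸ List.mem_cons_self) ha'
  | cons c a ih =>
    cases a' with
    | nil => exact absurd ((List.cons.inj h).1 ▸ List.mem_cons_self) ha
    | cons c' a' =>
      obtain ⟨h1, h2⟩ := List.cons.inj h
      obtain ⟨h3, h4⟩ := ih h2 (fun m => ha (List.mem_cons_of_mem _ m))
        (fun m => ha' (List.mem_cons_of_mem _ m))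
      exact ⟨by rw [h1, h3], h4⟩

theorem notMem_encodeNat {s : Letter} (hs : ∀ b, s ≠ bit b) (n : ℕ) : s ∉ encodeNat n := by
  simp only [encodeNat, List.mem_map, not_exists, not_and]
  exact fun b _ h => hs b h.symm

theorem notMem_encodeInt {s : Letter} (hs : ∀ b, s ≠ bit b) (hm : s ≠ minus) (z : ℤ) :
    s ∉ encodeInt z := by
  unfold encodeInt
  split <;> simp [hm, notMem_encodeNat hs]

theorem notMem_encodeFrac {s : Letter} (hs : ∀ b, s ≠ bit b) (hm : s ≠ minus) (hl : s ≠ slash)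
    (q : Frac) : s ∉ encodeFrac q := by
  simp [encodeFrac, hl, notMem_encodeInt hs hm, notMem_encodeNat hs]

theorem notMem_encodePoint {s : Letter} (hs : ∀ b, s ≠ bit b) (hm : s ≠ minus) (hl : s ≠ slash)
    (hc : s ≠ comma) (x y : Frac) : s ∉ encodePoint x y := by
  simp [encodePoint, hc, notMem_encodeFrac hs hm hl]

theorem encodeNat_injective : Function.Injective encodeNat := by
  intro m n h
  have h' : m.bits = n.bits := List.map_injective_iff.2 (fun a b h => by simpa using h) h
  have key : ∀ k : ℕ, Nat.ofDigits 2 (k.bits.map fun b => cond b 1 0) = k := fun k => by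
    rw [← Nat.digits_two_eq_bits, Nat.ofDigits_digits]
  rw [← key m, ← key n, h']

theorem encodeInt_injective : Function.Injective encodeInt := by
  intro m n h
  have hm : ∀ k, minus ∉ encodeNat k := notMem_encodeNat (by simp)
  unfold encodeInt at h
  split at h <;> split at h
  · have := encodeNat_injective (List.cons.inj h).2
    omega
  · exact absurd (h ▸ List.mem_cons_self : minus ∈ encodeNat n.natAbs) (hm _)
  · exact absurd (h.symm ▸ List.mem_cons_self : minus ∈ encodeNat m.natAbs) (hm _)
  · have := encodeNat_injective h
    omega

theorem encodeFrac_injective : Function.Injective encodeFrac := by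
  rintro ⟨a, b, hb⟩ ⟨c, d, hd⟩ h
  obtain ⟨h1, h2⟩ := split_at h (notMem_encodeInt (by simp) (by simp) _)
    (notMem_encodeInt (by simp) (by simp) _)
  cases encodeInt_injective h1
  cases encodeNat_injective h2
  rfl

theorem encodePoint_inj {x y x' y' : Frac} (h : encodePoint x y = encodePoint x' y') :
    x = x' ∧ y = y' := by
  obtain ⟨h1, h2⟩ := split_at h (notMem_encodeFrac (by simp) (by simp) (by simp) _)
    (notMem_encodeFrac (by simp) (by simp) (by simp) _)
  exact ⟨encodeFrac_injective h1, encodeFrac_injective h2⟩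

theorem encodeBlocks_inj {bs cs : List (List Letter)} (hb : ∀ b ∈ bs, semicolon ∉ b)
    (hc : ∀ c ∈ cs, semicolon ∉ c) (h : encodeBlocks bs = encodeBlocks cs) : bs = cs := by
  induction bs generalizing cs with
  | nil => cases cs <;> simp_all [encodeBlocks]
  | cons b bs ih =>
    cases cs with
    | nil => simp [encodeBlocks] at h
    | cons c cs =>
      simp only [encodeBlocks, List.flatMap_cons, List.append_assoc, List.singleton_append] at h
      obtain ⟨h1, h2⟩ := split_at h (hb b (by simp)) (hc c (by simp))
      rw [h1, ih (fun b h => hb b (by simp [h])) (fun c h => hc c (by simp [h])) h2]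

end Letter

theorem FMInstance.encode_injective : Function.Injective FMInstance.encode := by
  intro I J h
  have hhash : ∀ I : FMInstance,
      Letter.hash ∉ Letter.encodeBlocks (List.ofFn fun f => Letter.encodePoint (I.x f) (I.y f)) := by
    intro I
    simp [Letter.encodeBlocks, List.mem_ofFn, Letter.notMem_encodePoint]
  obtain ⟨h1, h2⟩ := Letter.split_at h (hhash I) (hhash J)
  have h1' := Letter.encodeBlocks_inj (by simp [List.mem_ofFn, Letter.notMem_encodePoint])
    (by simp [List.mem_ofFn, Letter.notMem_encodePoint]) h1
  have h2' := Letter.encodeBlocks_inj (by simp [List.mem_ofFn]) (by simp [List.mem_ofFn]) h2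
  obtain ⟨nf, nm, adj, x, y, hd⟩ := I
  obtain ⟨nf', nm', adj', x', y', hd'⟩ := J
  obtain rfl : nf = nf' := by simpa using congrArg List.length h1'
  obtain rfl : nm = nm' := by simpa using congrArg List.length h2'
  have hp := List.ofFn_injective h1'
  have hr := List.ofFn_injective h2'
  obtain rfl : x = x' := funext fun f => (Letter.encodePoint_inj (congrFun hp f)).1
  obtain rfl : y = y' := funext fun f => (Letter.encodePoint_inj (congrFun hp f)).2
  obtain rfl : adj = adj' := by
    funext u f
    simpa using congrFun (List.ofFn_injective (congrFun hr u)) f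
  rfl

/-- The decision problem: the words that describe a fixed-mobile bigraph that has a planar 0-bend
drawing with every mobile vertex in the convex hull of its neighbours. The graph of such an instance
is planar, since it has a planar drawing. -/
def FMZeroBendConvexHull : Language Letter :=
  {w | ∃ I : FMInstance, I.encode = w ∧ ∃ p, I.toFMBigraph.IsPlanarConvexHullDrawing p}

/-! ### The class NP -/

/-- A word over `Γ` and a word over `{0, 1}` as one word over the disjoint union of the alphabets. -/
def encodeWordPair {Γ : Type} (z : List Γ × List Bool) : List (Γ ⊕ Bool) :=
  z.1.map Sum.inl ++ z.2.map Sum.inr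

/-- `L` is in NP: there are a polynomial `q` and a verifier, computed by a Turing machine in
polynomial time, such that `w` belongs to `L` if and only if the verifier accepts `w` together with
some certificate of length at most `q(|w|)`. -/
def InNP {Γ : Type} (L : Language Γ) : Prop :=
  ∃ (q : Polynomial ℕ) (verify : List Γ × List Bool → Bool),
    Nonempty (Turing.TM2ComputableInPolyTime encodeWordPair Computability.encodeBool verify) ∧
    ∀ w : List Γ, w ∈ L ↔ ∃ c : List Bool, c.length ≤ q.eval w.length ∧ verify (w, c) = true

/-! The difficulty is to find drawings whose mobile vertices have coordinates of polynomial length.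
Consider the arrangement of all lines through two fixed points, together with the horizontal and
vertical lines through fixed points. The key fact is that whether a placement of the mobile vertices
is a drawing depends only on the cells (of any dimension) that contain them
(`FMBigraph.IsGood.of_sameCell`).

For a single mobile vertex and its edges, a star, this holds because all conditions are signs of
orientations and coordinate differences that involve one mobile point (`IsStar.of_sameCell`). For
two stars the signs involve two mobile points and are not constant on cells; here the hull condition
is decisive (`Apart.of_sameCell`). Move the centre of one star straight from `w` to `u` within its
cell and stop at the first contact with the other star, with centre `v`. The triangles swept so far
avoid the edges at `v`. If `v` were inside a moved edge, its neighbours would lie on the far side of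
the line of that edge, and the hull condition would put two of them on the line. The line then
belongs to the arrangement and contains `u`, hence also `w`, which is absurd or reduces to the
collinear case. The same reasoning with the neighbours of `u` excludes that `u` is inside an edge at
`v`; a comparison of cones excludes `u = v`; and a proper crossing would have been met earlier
(`apart_of_not_swept`). So there is no first contact.

Mobile vertices lie in the hull of the fixed points, so the horizontal and vertical lines bound
their cells. The closure of such a cell is the hull of its extreme points (Krein–Milman), which are
intersections of arrangement lines. By Carathéodory the mobile vertex is a positive combination of
three of them, repetitions allowed, and equal weights give the same signs (`exists_vertices`). Hence
every relevant cell contains the centroid of three intersection points, which is determined by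
twelve points among the fixed points and the two points at infinity of the axes
(`HPoint.exists_code`).

A certificate consists of the instance and of such centroids. The verifier encodes the instance,
compares the result with the input word, and tests the drawing by signs of integer determinants in
homogeneous coordinates. Its running time is controlled by a calculus of functions on tree-coded
data (`PolyTime`), closed under composition, pairing, case distinction and folds with bounded
growth. The programs of this calculus act on stacks and are compiled to Turing machines
(`PolyTime.toTuringMachine`). The calculus also bounds the length of certificates, since
polynomial-time functions have values of polynomial size (`exists_size_bound`). -/

open Turing

/-! ### Structured stack programs and their compilation to Turing machines -/

/-- Structured programs that work on a family of stacks. -/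
inductive StackProg {K : Type} (Γ : K → Type) : Type
  | push (k : K) (a : Γ k) : StackProg Γ
  | pop (k : K) : StackProg Γ
  | seq (p q : StackProg Γ) : StackProg Γ
  | ite (k : K) (test : Option (Γ k) → Bool) (p q : StackProg Γ) : StackProg Γ
  | loop (k : K) (test : Option (Γ k) → Bool) (p : StackProg Γ) : StackProg Γ

namespace StackProg

variable {K : Type} [DecidableEq K] {Γ : K → Type}

/-- `Exec p s n s'`: started on the stacks `s`, the program `p` stops after `n` steps with the
stacks `s'`. -/
inductive Exec : StackProg Γ → (∀ k, List (Γ k)) → ℕ → (∀ k, List (Γ k)) → Prop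
  | push (k : K) (a : Γ k) (s) : Exec (push k a) s 1 (Function.update s k (a :: s k))
  | pop (k : K) (s) : Exec (pop k) s 1 (Function.update s k (s k).tail)
  | seq {p q : StackProg Γ} {s s' s'' m n} :
      Exec p s m s' → Exec q s' n s'' → Exec (seq p q) s (m + n) s''
  | ite_true {k : K} {test} {p q : StackProg Γ} {s s' n} :
      test (s k).head? = true → Exec p s n s' → Exec (ite k test p q) s (n + 1) s'
  | ite_false {k : K} {test} {p q : StackProg Γ} {s s' n} :
      test (s k).head? = false → Exec q s n s' → Exec (ite k test p q) s (n + 1) s'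
  | loop_done {k : K} {test} {p : StackProg Γ} {s} :
      test (s k).head? = false → Exec (loop k test p) s 1 s
  | loop_step {k : K} {test} {p : StackProg Γ} {s s' s'' m n} :
      test (s k).head? = true → Exec p s m s' → Exec (loop k test p) s' n s'' →
      Exec (loop k test p) s (m + n + 1) s''

/-- The labels of the machine that runs a program. -/
def Lab : StackProg Γ → Type
  | push _ _ => Unit
  | pop _ => Unit
  | seq p q => Lab p ⊕ Lab q
  | ite _ _ p q => Option (Lab p ⊕ Lab q)
  | loop _ _ p => Option (Lab p)

instance Lab.fintype : ∀ p : StackProg Γ, Fintype (Lab p)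
  | push _ _ => inferInstanceAs (Fintype Unit)
  | pop _ => inferInstanceAs (Fintype Unit)
  | seq p q => @instFintypeSum _ _ (Lab.fintype p) (Lab.fintype q)
  | ite _ _ p q => @instFintypeOption _ (@instFintypeSum _ _ (Lab.fintype p) (Lab.fintype q))
  | loop _ _ p => @instFintypeOption _ (Lab.fintype p)

/-- The label at which a program starts. -/
def entry : ∀ p : StackProg Γ, Lab p
  | push _ _ => ()
  | pop _ => ()
  | seq p _ => Sum.inl (entry p)
  | ite _ _ _ _ => none
  | loop _ _ _ => none

/-- The machine statements for the labels of a program, which ends with a jump to `exit`. -/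
def code {L : Type} : ∀ p : StackProg Γ, (Lab p → L) → L → Lab p → TM2.Stmt Γ L Bool
  | push k a, _, exit => fun _ => .push k (fun _ => a) (.goto fun _ => exit)
  | pop k, _, exit => fun _ => .pop k (fun v _ => v) (.goto fun _ => exit)
  | seq p q, emb, exit => fun l =>
      Sum.rec (code p (fun l => emb (Sum.inl l)) (emb (Sum.inr (entry q))))
        (code q (fun l => emb (Sum.inr l)) exit) l
  | ite k test p q, emb, exit => fun l =>
      Option.rec (.peek k (fun _ o => test o) (.branch id
          (.goto fun _ => emb (some (Sum.inl (entry p))))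
          (.goto fun _ => emb (some (Sum.inr (entry q))))))
        (fun l => Sum.rec (code p (fun l => emb (some (Sum.inl l))) exit)
          (code q (fun l => emb (some (Sum.inr l))) exit) l) l
  | loop k test p, emb, exit => fun l =>
      Option.rec (.peek k (fun _ o => test o) (.branch id
          (.goto fun _ => emb (some (entry p))) (.goto fun _ => exit)))
        (code p (fun l => emb (some l)) (emb none)) l

/-- The machine `M` leads from label `l` and stacks `s` to label `l'` and stacks `s'` in `n`
steps. -/
def Runs {L : Type} (M : L → TM2.Stmt Γ L Bool) (l : L) (s : ∀ k, List (Γ k)) (n : ℕ) (l' : L)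
    (s' : ∀ k, List (Γ k)) : Prop :=
  ∀ v, ∃ v', (flip bind (TM2.step M))^[n] (some ⟨some l, v, s⟩) = some ⟨some l', v', s'⟩

theorem Runs.trans {L : Type} {M : L → TM2.Stmt Γ L Bool} {l l' l'' : L} {s s' s'' m n}
    (h : Runs M l s m l' s') (h' : Runs M l' s' n l'' s'') : Runs M l s (m + n) l'' s'' := by
  intro v
  obtain ⟨v', hv⟩ := h v
  obtain ⟨w, hw⟩ := h' v'
  exact ⟨w, by rw [Nat.add_comm, Function.iterate_add_apply, hv, hw]⟩

theorem Runs.of_step {L : Type} {M : L → TM2.Stmt Γ L Bool} {l l' : L} {s s'}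
    (h : ∀ v, ∃ v', TM2.stepAux (M l) v s = ⟨some l', v', s'⟩) : Runs M l s 1 l' s' := by
  intro v
  obtain ⟨v', hv⟩ := h v
  exact ⟨v', by
    change some (TM2.stepAux (M l) v s) = _
    rw [hv]⟩

/-- A machine that contains the code of a program simulates the program step by step. -/
theorem Exec.runs {L : Type} {M : L → TM2.Stmt Γ L Bool} {p : StackProg Γ} {s n s'}
    (h : Exec p s n s') : ∀ {emb : Lab p → L} {exit : L}, (∀ l, M (emb l) = code p emb exit l) →
      Runs M (emb (entry p)) s n exit s' := by
  induction h with
  | push k a s => exact fun hM => .of_step fun v => ⟨v, by rw [hM]; rfl⟩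
  | pop k s => exact fun hM => .of_step fun v => ⟨v, by rw [hM]; rfl⟩
  | @seq p q _ _ _ _ _ _ _ ih ih' =>
    intro emb exit hM
    exact (ih (emb := fun l => emb (Sum.inl l)) fun l => hM (Sum.inl l)).trans
      (ih' (emb := fun l => emb (Sum.inr l)) fun l => hM (Sum.inr l))
  | @ite_true k test p q _ _ n ht _ ih =>
    intro emb exit hM
    rw [Nat.add_comm]
    refine Runs.trans (l' := emb (some (Sum.inl (entry p)))) (.of_step fun v => ⟨true, ?_⟩)
      (ih (emb := fun l => emb (some (Sum.inl l))) fun l => hM (some (Sum.inl l)))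
    rw [hM]
    simp [code, entry, ht]
  | @ite_false k test p q _ _ n ht _ ih =>
    intro emb exit hM
    rw [Nat.add_comm]
    refine Runs.trans (l' := emb (some (Sum.inr (entry q)))) (.of_step fun v => ⟨false, ?_⟩)
      (ih (emb := fun l => emb (some (Sum.inr l))) fun l => hM (some (Sum.inr l)))
    rw [hM]
    simp [code, entry, ht]
  | @loop_done k test p s ht =>
    intro emb exit hM
    refine .of_step fun v => ⟨false, ?_⟩
    rw [hM]
    simp [code, entry, ht]
  | @loop_step k test p _ _ _ m n ht _ _ ih ih' =>
    intro emb exit hM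
    rw [Nat.add_comm]
    refine Runs.trans (l' := emb (some (entry p))) (.of_step fun v => ⟨true, ?_⟩)
      (.trans (ih (emb := fun l => emb (some l)) fun l => hM (some l)) (ih' hM))
    rw [hM]
    simp [code, entry, ht]

/-- The machine that runs a program and halts. -/
def machine (p : StackProg Γ) : Option (Lab p) → TM2.Stmt Γ (Option (Lab p)) Bool
  | none => .load (fun _ => false) .halt
  | some l => code p some none l

/-- The additional step resets the internal state, which must have its initial value in a halting
configuration. -/
theorem Exec.machine_halts {p : StackProg Γ} {s n s'} (h : Exec p s n s') :
    (flip bind (TM2.step (machine p)))^[n + 1] (some ⟨some (some (entry p)), false, s⟩) =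
      some ⟨none, false, s'⟩ := by
  obtain ⟨v, hv⟩ := h.runs (M := machine p) (emb := some) (exit := none) (fun _ => rfl) false
  rw [Nat.add_comm, Function.iterate_add_apply, hv]
  rfl

end StackProg

/-! ### Data and their representation on stacks -/

/-- Binary trees, the universal data type. -/
inductive BinTree : Type
  | nil : BinTree
  | cons (x y : BinTree) : BinTree

namespace BinTree

/-- Polish notation. -/
def enc : BinTree → List Bool
  | nil => [false]
  | cons x y => true :: (enc x ++ enc y)

/-- The number of nodes. -/
def size : BinTree → ℕ
  | nil => 1
  | cons x y => 1 + (size x + size y)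

theorem length_enc : ∀ x : BinTree, x.enc.length = x.size
  | nil => rfl
  | cons x y => by simp [enc, size, length_enc x, length_enc y]; omega

theorem size_pos : ∀ x : BinTree, 0 < x.size
  | nil => Nat.one_pos
  | cons _ _ => by simp [size]

end BinTree

/-- Types whose elements are represented by binary trees. -/
class Data (α : Type) where
  code : α → BinTree

/-- The size of a datum. -/
def sz {α : Type} [Data α] (x : α) : ℕ := (Data.code x).size

theorem sz_pos {α : Type} [Data α] (x : α) : 0 < sz x := BinTree.size_pos _

instance : Data BinTree := ⟨id⟩

instance : Data Unit := ⟨fun _ => .nil⟩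

instance : Data Bool := ⟨fun b => if b then .cons .nil .nil else .nil⟩

instance {α β : Type} [Data α] [Data β] : Data (α × β) :=
  ⟨fun x => .cons (Data.code x.1) (Data.code x.2)⟩

/-- A nonempty list has the code of the pair of its head and its tail, so list operations reduce to
pair operations. -/
instance {α : Type} [Data α] : Data (List α) :=
  ⟨fun l => l.foldr (fun x t => .cons (Data.code x) t) .nil⟩

section sizes

variable {α β : Type} [Data α] [Data β]

theorem code_cons (x : α) (l : List α) :
    Data.code (x :: l) = .cons (Data.code x) (Data.code l) := rfl

@[simp] theorem sz_prod (x : α) (y : β) : sz (x, y) = 1 + (sz x + sz y) := rfl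

@[simp] theorem sz_nil : sz ([] : List α) = 1 := rfl

@[simp] theorem sz_cons (x : α) (l : List α) : sz (x :: l) = 1 + (sz x + sz l) := rfl

theorem sz_bool_le (b : Bool) : sz b ≤ 3 := by cases b <;> decide

theorem length_le_sz (l : List α) : l.length ≤ sz l := by
  induction l with
  | nil => simp
  | cons x l ih => simp; omega

theorem sz_le_of_mem {x : α} {l : List α} (h : x ∈ l) : sz x ≤ sz l := by
  induction h with
  | head => simp; omega
  | tail _ _ ih => simp; omega

end sizes

/-! ### Basic stack routines -/

namespace StackProg

/-- The stacks: input, output, two stacks for data, and two auxiliary ones. -/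
inductive Stk
  | inp
  | out
  | a
  | b
  | t
  | c
  deriving DecidableEq

instance : Fintype Stk :=
  ⟨{.inp, .out, .a, .b, .t, .c}, fun x => by cases x <;> decide⟩

/-- The alphabets of the stacks. -/
def Alph : Stk → Type
  | .inp => Letter ⊕ Bool
  | .out => Bool
  | .a => Bool
  | .b => Bool
  | .t => Bool
  | .c => Bool

/-- The stacks with the given contents. -/
def stks (i : List (Letter ⊕ Bool)) (o a b t c : List Bool) : ∀ k, List (Alph k)
  | .inp => i
  | .out => o
  | .a => a
  | .b => b
  | .t => t
  | .c => c

section update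

variable (i i' : List (Letter ⊕ Bool)) (o a b t c l : List Bool)

@[simp] theorem update_inp : Function.update (stks i o a b t c) .inp i' = stks i' o a b t c := by
  funext k; cases k <;> rfl

@[simp] theorem update_out : Function.update (stks i o a b t c) .out l = stks i l a b t c := by
  funext k; cases k <;> rfl

@[simp] theorem update_a : Function.update (stks i o a b t c) .a l = stks i o l b t c := by
  funext k; cases k <;> rfl

@[simp] theorem update_b : Function.update (stks i o a b t c) .b l = stks i o a l t c := by
  funext k; cases k <;> rfl

@[simp] theorem update_t : Function.update (stks i o a b t c) .t l = stks i o a b l c := by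
  funext k; cases k <;> rfl

@[simp] theorem update_c : Function.update (stks i o a b t c) .c l = stks i o a b t l := by
  funext k; cases k <;> rfl

end update

/-- Programs over these stacks. -/
abbrev SProg := StackProg Alph

theorem Exec.to {p : SProg} {s n s' s''} (h : Exec p s n s') (e : s' = s'') : Exec p s n s'' :=
  e ▸ h

section steps

variable {i : List (Letter ⊕ Bool)} {o a b t c : List Bool} (x : Bool)

theorem exec_push_a : Exec (push .a x : SProg) (stks i o a b t c) 1 (stks i o (x :: a) b t c) :=
  (Exec.push .a x (stks i o a b t c)).to (update_a ..)

theorem exec_push_b : Exec (push .b x : SProg) (stks i o a b t c) 1 (stks i o a (x :: b) t c) :=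
  (Exec.push .b x (stks i o a b t c)).to (update_b ..)

theorem exec_push_t : Exec (push .t x : SProg) (stks i o a b t c) 1 (stks i o a b (x :: t) c) :=
  (Exec.push .t x (stks i o a b t c)).to (update_t ..)

theorem exec_push_c : Exec (push .c x : SProg) (stks i o a b t c) 1 (stks i o a b t (x :: c)) :=
  (Exec.push .c x (stks i o a b t c)).to (update_c ..)

theorem exec_push_out : Exec (push .out x : SProg) (stks i o a b t c) 1
    (stks i (x :: o) a b t c) :=
  (Exec.push .out x (stks i o a b t c)).to (update_out ..)

theorem exec_pop_inp (y : Letter ⊕ Bool) :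
    Exec (pop .inp : SProg) (stks (y :: i) o a b t c) 1 (stks i o a b t c) :=
  (Exec.pop .inp (stks (y :: i) o a b t c)).to (update_inp ..)

theorem exec_pop_a : Exec (pop .a : SProg) (stks i o (x :: a) b t c) 1 (stks i o a b t c) :=
  (Exec.pop .a (stks i o (x :: a) b t c)).to (update_a ..)

theorem exec_pop_b : Exec (pop .b : SProg) (stks i o a (x :: b) t c) 1 (stks i o a b t c) :=
  (Exec.pop .b (stks i o a (x :: b) t c)).to (update_b ..)

theorem exec_pop_t : Exec (pop .t : SProg) (stks i o a b (x :: t) c) 1 (stks i o a b t c) :=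
  (Exec.pop .t (stks i o a b (x :: t) c)).to (update_t ..)

theorem exec_pop_c : Exec (pop .c : SProg) (stks i o a b t (x :: c)) 1 (stks i o a b t c) :=
  (Exec.pop .c (stks i o a b t (x :: c))).to (update_c ..)

end steps

theorem Exec.cast {p : SProg} {s m s' n} (h : Exec p s m s') (e : m = n) : Exec p s n s' := e ▸ h

/-- Is the top symbol `true`? -/
def isTrue : Option Bool → Bool
  | some true => true
  | _ => false

/-- Move the top tree of stack `a` (reversed) to stack `t`, if `c` has one element. -/
def takeLoopA : SProg :=
  loop .c (fun o => o.isSome) (ite .a isTrue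
    (seq (pop .a) (seq (push .t true) (push .c true)))
    (seq (pop .a) (seq (push .t false) (pop .c))))

/-- Move the top tree of stack `b` (reversed) to stack `t`, if `c` has one element. -/
def takeLoopB : SProg :=
  loop .c (fun o => o.isSome) (ite .b isTrue
    (seq (pop .b) (seq (push .t true) (push .c true)))
    (seq (pop .b) (seq (push .t false) (pop .c))))

/-- The stack `c` counts in unary the trees still to be read: a node asks for one more, a leaf
settles one. A continuation is built into the statement so that the induction hypotheses for the two
branches can be chained. Each symbol costs five steps: loop test, branch and three stack operations.
-/
theorem exec_takeLoopA (x : BinTree) : ∀ {i o a b t c n s'},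
    Exec takeLoopA (stks i o a b (x.enc.reverse ++ t) c) n s' →
      Exec takeLoopA (stks i o (x.enc ++ a) b t (true :: c)) (5 * x.size + n) s' := by
  induction x with
  | nil =>
    intro i o a b t c n s' h
    refine (Exec.loop_step rfl (.ite_false rfl (.seq (exec_pop_a false)
      (.seq (exec_push_t false) (exec_pop_c true)))) h).cast ?_
    simp only [BinTree.size]; omega
  | cons x y ihx ihy =>
    intro i o a b t c n s' h
    rw [show (BinTree.cons x y).enc ++ a = true :: (x.enc ++ (y.enc ++ a)) by simp [BinTree.enc]]
    rw [show (BinTree.cons x y).enc.reverse ++ t = y.enc.reverse ++ (x.enc.reverse ++ (true :: t))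
      by simp [BinTree.enc]] at h
    refine (Exec.loop_step rfl (.ite_true rfl (.seq (exec_pop_a true)
      (.seq (exec_push_t true) (exec_push_c true)))) (s'' := s') (n := 5 * x.size + (5 * y.size + n))
      (ihx (ihy h))).cast (by simp only [BinTree.size]; omega)

theorem exec_takeLoopB (x : BinTree) : ∀ {i o a b t c n s'},
    Exec takeLoopB (stks i o a b (x.enc.reverse ++ t) c) n s' →
      Exec takeLoopB (stks i o a (x.enc ++ b) t (true :: c)) (5 * x.size + n) s' := by
  induction x with
  | nil =>
    intro i o a b t c n s' h
    refine (Exec.loop_step rfl (.ite_false rfl (.seq (exec_pop_b false)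
      (.seq (exec_push_t false) (exec_pop_c true)))) h).cast ?_
    simp only [BinTree.size]; omega
  | cons x y ihx ihy =>
    intro i o a b t c n s' h
    rw [show (BinTree.cons x y).enc ++ b = true :: (x.enc ++ (y.enc ++ b)) by simp [BinTree.enc]]
    rw [show (BinTree.cons x y).enc.reverse ++ t = y.enc.reverse ++ (x.enc.reverse ++ (true :: t))
      by simp [BinTree.enc]] at h
    refine (Exec.loop_step rfl (.ite_true rfl (.seq (exec_pop_b true)
      (.seq (exec_push_t true) (exec_push_c true)))) (s'' := s') (n := 5 * x.size + (5 * y.size + n))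
      (ihx (ihy h))).cast (by simp only [BinTree.size]; omega)

/-- Empty the stack `t`, and run `f x` for each of its elements `x`. -/
def pour (f : Bool → SProg) : SProg :=
  loop .t (fun o => o.isSome) (ite .t isTrue
    (seq (pop .t) (f true)) (seq (pop .t) (f false)))

/-- `A` and `B` are the effects of one symbol on the stacks `a` and `b`. Besides the `n` steps of
`f`, a symbol costs the loop test, the branch and the `pop`. -/
theorem exec_pour {f : Bool → SProg} {n : ℕ} {A B : Bool → List Bool → List Bool}
    (hf : ∀ x i o a b t c, Exec (f x) (stks i o a b t c) n (stks i o (A x a) (B x b) t c))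
    (t : List Bool) : ∀ i o a b c, Exec (pour f) (stks i o a b t c) ((n + 3) * t.length + 1)
      (stks i o (t.foldl (fun s x => A x s) a) (t.foldl (fun s x => B x s) b) [] c) := by
  induction t with
  | nil => exact fun i o a b c => .loop_done rfl
  | cons x t ih =>
    intro i o a b c
    cases x
    · exact (Exec.loop_step rfl (.ite_false rfl (.seq (exec_pop_t false) (hf false _ _ _ _ _ _)))
        (ih _ _ _ _ _)).cast (by simp only [List.length_cons]; ring)
    · exact (Exec.loop_step rfl (.ite_true rfl (.seq (exec_pop_t true) (hf true _ _ _ _ _ _)))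
        (ih _ _ _ _ _)).cast (by simp only [List.length_cons]; ring)

theorem foldl_push (l a : List Bool) : l.foldl (fun s x => x :: s) a = l.reverse ++ a := by
  induction l generalizing a with
  | nil => rfl
  | cons x l ih => simp [ih]

theorem foldl_keep (l a : List Bool) : l.foldl (fun s _ => s) a = a := by
  induction l generalizing a with
  | nil => rfl
  | cons x l ih => simp

/-- The program `p` changes the contents of the data stacks as indicated, in at most `n` steps. -/
def Does (p : SProg) (a b a' b' : List Bool) (n : ℕ) : Prop :=
  ∀ i o, ∃ m ≤ n, Exec p (stks i o a b [] []) m (stks i o a' b' [] [])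

theorem Does.of {p : SProg} {a b a' b' : List Bool} {m n : ℕ}
    (h : ∀ i o, Exec p (stks i o a b [] []) m (stks i o a' b' [] [])) (hmn : m ≤ n) :
    Does p a b a' b' n := fun i o => ⟨m, hmn, h i o⟩

theorem Does.seq {p q : SProg} {a b a' b' a'' b'' : List Bool} {m n : ℕ}
    (h : Does p a b a' b' m) (h' : Does q a' b' a'' b'' n) :
    Does (seq p q) a b a'' b'' (m + n) := fun i o =>
  let ⟨k, hk, e⟩ := h i o
  let ⟨l, hl, e'⟩ := h' i o
  ⟨k + l, add_le_add hk hl, .seq e e'⟩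

theorem Does.mono {p : SProg} {a b a' b' : List Bool} {m n : ℕ} (h : Does p a b a' b' m)
    (hmn : m ≤ n) : Does p a b a' b' n := fun i o =>
  let ⟨k, hk, e⟩ := h i o
  ⟨k, hk.trans hmn, e⟩

theorem does_push_a (x : Bool) (a b : List Bool) : Does (push .a x) a b (x :: a) b 1 :=
  fun _ _ => ⟨1, le_rfl, exec_push_a x⟩

theorem does_pop_a (x : Bool) (a b : List Bool) : Does (pop .a) (x :: a) b a b 1 :=
  fun _ _ => ⟨1, le_rfl, exec_pop_a x⟩

theorem does_pop_b (x : Bool) (a b : List Bool) : Does (pop .b) a (x :: b) a b 1 :=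
  fun _ _ => ⟨1, le_rfl, exec_pop_b x⟩

theorem does_ite_a {p q : SProg} {x : Bool} {a b a' b' : List Bool} {n : ℕ}
    (h : Does (if x then p else q) (x :: a) b a' b' n) :
    Does (ite .a isTrue p q) (x :: a) b a' b' (n + 1) := by
  intro i o
  obtain ⟨k, hk, e⟩ := h i o
  refine ⟨k + 1, by omega, ?_⟩
  cases x
  · exact .ite_false rfl e
  · exact .ite_true rfl e

/-- Move the top tree of `a` to `t`. -/
def takeA : SProg := seq (push .c true) takeLoopA

/-- Move the top tree of `b` to `t`. -/
def takeB : SProg := seq (push .c true) takeLoopB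

theorem exec_takeA (x : BinTree) (i o a b) : Exec takeA (stks i o (x.enc ++ a) b [] [])
    (5 * x.size + 2) (stks i o a b x.enc.reverse []) := by
  have := Exec.seq (exec_push_c true)
    (exec_takeLoopA x (i := i) (o := o) (a := a) (b := b) (t := []) (c := []) (n := 1) (.loop_done rfl))
  rw [List.append_nil] at this
  exact this.cast (by omega)

theorem exec_takeB (x : BinTree) (i o a b) : Exec takeB (stks i o a (x.enc ++ b) [] [])
    (5 * x.size + 2) (stks i o a b x.enc.reverse []) := by
  have := Exec.seq (exec_push_c true)
    (exec_takeLoopB x (i := i) (o := o) (a := a) (b := b) (t := []) (c := []) (n := 1) (.loop_done rfl))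
  rw [List.append_nil] at this
  exact this.cast (by omega)

/-- Remove all elements of `t`. -/
def clearT : SProg := loop .t (fun o => o.isSome) (pop .t)

theorem exec_clearT (t : List Bool) (i o a b c) :
    Exec clearT (stks i o a b t c) (2 * t.length + 1) (stks i o a b [] c) := by
  induction t with
  | nil => exact .loop_done rfl
  | cons x t ih =>
    exact (Exec.loop_step rfl (exec_pop_t x) ih).cast (by simp only [List.length_cons]; ring)

/-- Remove the top tree of `a`. -/
def dropA : SProg := seq takeA clearT

/-- Remove the top tree of `b`. -/
def dropB : SProg := seq takeB clearT

/-- Move the top tree of `a` to `b`. -/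
def moveAB : SProg := seq takeA (pour fun x => push .b x)

/-- Move the top tree of `b` to `a`. -/
def moveBA : SProg := seq takeB (pour fun x => push .a x)

/-- Copy the top tree of `a` to `b`. -/
def copyAB : SProg := seq takeA (pour fun x => seq (push .a x) (push .b x))

variable (x : BinTree) (a b : List Bool)

theorem does_dropA : Does dropA (x.enc ++ a) b a b (20 * x.size) :=
  .of (fun i o => (exec_takeA x i o a b).seq (exec_clearT _ _ _ _ _ _)) (by
    have := x.size_pos; simp only [List.length_reverse, BinTree.length_enc]; omega)

theorem does_dropB : Does dropB a (x.enc ++ b) a b (20 * x.size) :=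
  .of (fun i o => (exec_takeB x i o a b).seq (exec_clearT _ _ _ _ _ _)) (by
    have := x.size_pos; simp only [List.length_reverse, BinTree.length_enc]; omega)

theorem does_moveAB : Does moveAB (x.enc ++ a) b a (x.enc ++ b) (20 * x.size) :=
  .of (fun i o => ((exec_takeA x i o a b).seq (exec_pour (f := fun x => push .b x)
      (A := fun _ s => s) (B := fun x s => x :: s) (n := 1)
      (fun x i o a b t c => exec_push_b x) x.enc.reverse i o a b [])).to (by
        simp only [foldl_push, foldl_keep, List.reverse_reverse])) (by
    have := x.size_pos; simp only [List.length_reverse, BinTree.length_enc]; omega)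

theorem does_moveBA : Does moveBA a (x.enc ++ b) (x.enc ++ a) b (20 * x.size) :=
  .of (fun i o => ((exec_takeB x i o a b).seq (exec_pour (f := fun x => push .a x)
      (A := fun x s => x :: s) (B := fun _ s => s) (n := 1)
      (fun x i o a b t c => exec_push_a x) x.enc.reverse i o a b [])).to (by
        simp only [foldl_push, foldl_keep, List.reverse_reverse])) (by
    have := x.size_pos; simp only [List.length_reverse, BinTree.length_enc]; omega)

theorem does_copyAB : Does copyAB (x.enc ++ a) b (x.enc ++ a) (x.enc ++ b) (20 * x.size + 10) :=
  .of (fun i o => ((exec_takeA x i o a b).seq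
      (exec_pour (f := fun x => seq (push .a x) (push .b x))
      (A := fun x s => x :: s) (B := fun x s => x :: s) (n := 2)
      (fun x i o a b t c => .seq (exec_push_a x) (exec_push_b x)) x.enc.reverse i o a b [])).to (by
        simp only [foldl_push, List.reverse_reverse])) (by
    have := x.size_pos; simp only [List.length_reverse, BinTree.length_enc]; omega)

end StackProg

/-! ### Functions computable in polynomial time -/

open StackProg

theorem sz_def {α : Type} [Data α] (x : α) : sz x = (Data.code x).size := rfl

theorem Polynomial.eval_nat_mono (P : Polynomial ℕ) {m n : ℕ} (h : m ≤ n) :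
    P.eval m ≤ P.eval n := by
  simp only [Polynomial.eval_eq_sum, Polynomial.sum]
  exact Finset.sum_le_sum fun i _ => Nat.mul_le_mul_left _ (Nat.pow_le_pow_left h i)

/-- `f` is computed by a stack program in polynomial time. -/
@[fun_prop]
def PolyTime {α β : Type} [Data α] [Data β] (f : α → β) : Prop :=
  ∃ (p : SProg) (P : Polynomial ℕ), ∀ x,
    (∀ a b, Does p ((Data.code x).enc ++ a) b ((Data.code (f x)).enc ++ a) b (P.eval (sz x))) ∧
      sz (f x) ≤ P.eval (sz x)

namespace PolyTime

variable {α β γ δ ε : Type} [Data α] [Data β] [Data γ] [Data δ] [Data ε]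

theorem comp {g : β → γ} {f : α → β} (hg : PolyTime g) (hf : PolyTime f) : PolyTime (fun x => g (f x)) := by
  obtain ⟨p, P, hp⟩ := hf
  obtain ⟨q, Q, hq⟩ := hg
  refine ⟨seq p q, P + Q.comp P, fun x => ⟨fun a b => (((hp x).1 a b).seq ((hq _).1 a b)).mono ?_, ?_⟩⟩
  · simpa using Q.eval_nat_mono (hp x).2
  · have := Q.eval_nat_mono (hp x).2
    have := (hq (f x)).2
    simp only [Polynomial.eval_add, Polynomial.eval_comp]
    omega

/-- A push followed by a pop stands in for the empty program. -/
theorem recode {f : α → β} (h : ∀ x, Data.code (f x) = Data.code x) : PolyTime f := by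
  refine ⟨seq (push .a true) (pop .a), 2 + .X, fun x => ⟨fun a b => ?_, ?_⟩⟩
  · rw [h]
    exact ((does_push_a true _ _).seq (does_pop_a true _ _)).mono (by simp)
  · rw [sz, h]
    simp [sz]

@[fun_prop]
theorem id : PolyTime (fun x : α => x) := recode fun _ => rfl

@[fun_prop]
theorem const (y : β) : PolyTime (fun _ : α => y) := by
  refine ⟨(Data.code y).enc.foldr (fun s p => seq p (push .a s)) dropA,
    20 * .X + .C (sz y), fun x => ⟨fun a b => ?_, ?_⟩⟩
  · have : ∀ l : List Bool, Does (l.foldr (fun s p => seq p (push .a s)) dropA)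
        ((Data.code x).enc ++ a) b (l ++ a) b (20 * sz x + l.length) := by
      intro l
      induction l with
      | nil => exact does_dropA _ _ _
      | cons s l ih => exact ih.seq (does_push_a s _ _)
    refine (this _).mono ?_
    simp [BinTree.length_enc, sz]
  · simp

/-- While `g` runs, the argument waits on `b`; then `f` runs on top of the value of `g`, and a final
`true` turns the two adjacent codes into the code of a pair. -/
theorem pair_aux {f : α → β} {g : α → γ} (hf : PolyTime f) (hg : PolyTime g) :
    PolyTime (fun x => (f x, g x)) := by
  obtain ⟨p, P, hp⟩ := hf
  obtain ⟨q, Q, hq⟩ := hg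
  refine ⟨seq copyAB (seq q (seq moveBA (seq p (push .a true)))), 40 * .X + 11 + P + Q,
    fun x => ⟨fun a b => ?_, ?_⟩⟩
  · have h1 := does_push_a true ((Data.code (f x)).enc ++ ((Data.code (g x)).enc ++ a)) b
    have h2 := ((hp x).1 ((Data.code (g x)).enc ++ a) b).seq h1
    have h3 := (does_moveBA (Data.code x) ((Data.code (g x)).enc ++ a) b).seq h2
    have h4 := ((hq x).1 a ((Data.code x).enc ++ b)).seq h3
    have h5 := ((does_copyAB (Data.code x) a b).seq h4)
    rw [show (Data.code (f x, g x)).enc ++ a =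
      true :: ((Data.code (f x)).enc ++ ((Data.code (g x)).enc ++ a)) by
        simp [Data.code, BinTree.enc]]
    refine h5.mono ?_
    simp [sz]
    omega
  · have := (hp x).2
    have := (hq x).2
    simp
    omega

@[fun_prop]
theorem pair {f : α → β} {g : α → γ} (hf : PolyTime f) (hg : PolyTime g) :
    PolyTime (fun x => Prod.mk (f x) (g x)) := pair_aux hf hg

theorem fst_aux : PolyTime (fun x : α × β => x.1) := by
  refine ⟨seq (pop .a) (seq moveAB (seq dropA moveBA)), 40 * .X + 1, fun x => ⟨fun a b => ?_, ?_⟩⟩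
  · rw [show (Data.code x).enc ++ a =
      true :: ((Data.code x.1).enc ++ ((Data.code x.2).enc ++ a)) by
        simp [Data.code, BinTree.enc]]
    refine ((does_pop_a true _ _).seq ((does_moveAB _ _ _).seq ((does_dropA _ _ _).seq
      (does_moveBA (Data.code x.1) _ _)))).mono ?_
    obtain ⟨x, y⟩ := x
    simp only [Polynomial.eval_add, Polynomial.eval_mul, Polynomial.eval_ofNat, Polynomial.eval_X,
      Polynomial.eval_one, sz_prod, ← sz_def]
    have := sz_pos x
    omega
  · obtain ⟨x, y⟩ := x
    simp; omega

theorem snd_aux : PolyTime (fun x : α × β => x.2) := by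
  refine ⟨seq (pop .a) dropA, 40 * .X + 1, fun x => ⟨fun a b => ?_, ?_⟩⟩
  · rw [show (Data.code x).enc ++ a =
      true :: ((Data.code x.1).enc ++ ((Data.code x.2).enc ++ a)) by
        simp [Data.code, BinTree.enc]]
    refine ((does_pop_a true _ _).seq (does_dropA _ _ _)).mono ?_
    obtain ⟨x, y⟩ := x
    simp only [Polynomial.eval_add, Polynomial.eval_mul, Polynomial.eval_ofNat, Polynomial.eval_X,
      Polynomial.eval_one, sz_prod, ← sz_def]
    omega
  · obtain ⟨x, y⟩ := x
    simp; omega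

@[fun_prop]
theorem fst {f : α → β × γ} (hf : PolyTime f) : PolyTime (fun x => (f x).1) := fst_aux.comp hf

@[fun_prop]
theorem snd {f : α → β × γ} (hf : PolyTime f) : PolyTime (fun x => (f x).2) := snd_aux.comp hf

/-- Case distinction on the code of `l x`. -/
theorem cases {l : α → δ} {β' : Type} [Data β'] {f : α → γ} {g : α × (β × β') → γ} {h : α → γ}
    (hl : PolyTime l) (hf : PolyTime f) (hg : PolyTime g)
    (H : ∀ x, (Data.code (l x) = .nil ∧ h x = f x) ∨
      ∃ u v, Data.code (l x) = Data.code (u, v) ∧ h x = g (x, (u, v))) : PolyTime h := by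
  obtain ⟨r, R, hr⟩ := hl
  obtain ⟨p, P, hp⟩ := hf
  obtain ⟨q, Q, hq⟩ := hg
  -- The argument is saved on `b` while `l x` is computed. A code that begins with `true` is left in
  -- place: it is the code of `(u, v)`, and with `x` and another `true` on top it becomes the code
  -- of `(x, (u, v))`.
  refine ⟨seq copyAB (seq r (ite .a isTrue (seq moveBA (seq (push .a true) q))
      (seq (pop .a) (seq moveBA p)))), 40 * .X + 20 + R + P + Q.comp (1 + .X + R),
    fun x => ?_⟩
  have hX := (hr x).2
  rcases H x with ⟨h1, h2⟩ | ⟨u, v, h1, h2⟩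
  · constructor
    · intro a b
      rw [h2]
      have k := ((does_pop_a false _ _).seq ((does_moveBA (Data.code x) a b).seq ((hp x).1 a b)))
      have k' := does_ite_a (p := seq moveBA (seq (push .a true) q)) (x := false) k
      have k2 := (hr x).1 a ((Data.code x).enc ++ b)
      rw [h1] at k2
      refine ((does_copyAB _ _ _).seq (k2.seq k')).mono ?_
      simp [sz]
      omega
    · have := (hp x).2
      rw [h2]
      simp
      omega
  · have hs : sz (x, (u, v)) ≤ 1 + sz x + R.eval (sz x) := by
      have : sz (l x) = sz (u, v) := by rw [sz, h1]; rfl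
      rw [sz_prod, ← this]
      omega
    have hQ := Q.eval_nat_mono hs
    constructor
    · intro a b
      rw [h2]
      have k := ((does_moveBA (Data.code x) ((Data.code (u, v)).enc ++ a) b).seq
        ((does_push_a true _ _).seq ((hq (x, (u, v))).1 a b |> fun k => by
          rwa [show (Data.code (x, (u, v))).enc ++ a = true :: ((Data.code x).enc ++
            ((Data.code (u, v)).enc ++ a)) by simp [Data.code, BinTree.enc]] at k)))
      have k' := does_ite_a (q := seq (pop .a) (seq moveBA p)) (x := true) k
      have k2 := (hr x).1 a ((Data.code x).enc ++ b)
      rw [h1] at k2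
      refine ((does_copyAB _ _ _).seq (k2.seq k')).mono ?_
      simp only [Polynomial.eval_add, Polynomial.eval_mul, Polynomial.eval_ofNat, Polynomial.eval_X,
        Polynomial.eval_one, Polynomial.eval_comp, ← sz_def] at hQ ⊢
      omega
    · have := (hq (x, (u, v))).2
      rw [h2]
      simp only [Polynomial.eval_add, Polynomial.eval_mul, Polynomial.eval_ofNat, Polynomial.eval_X,
        Polynomial.eval_one, Polynomial.eval_comp] at hQ ⊢
      omega

@[fun_prop]
theorem bcond {c : α → Bool} {f g : α → γ} (hc : PolyTime c) (hf : PolyTime f) (hg : PolyTime g) :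
    PolyTime (fun x => bif c x then f x else g x) := by
  -- `true` has the same code as `((), ())`.
  refine cases (β := Unit) (β' := Unit) hc hg (hf.comp fst_aux) fun x => ?_
  rcases h : c x with _ | _
  · exact .inl ⟨rfl, by simp⟩
  · exact .inr ⟨(), (), rfl, by simp⟩

theorem list_cases {l : α → List β} {f : α → γ} {g : α → β → List β → γ}
    (hl : PolyTime l) (hf : PolyTime f) (hg : PolyTime (fun x : α × (β × List β) => g x.1 x.2.1 x.2.2)) :
    PolyTime (fun x => List.casesOn (motive := fun _ => γ) (l x) (f x) (g x)) := by
  refine cases (β := β) (β' := List β) hl hf hg fun x => ?_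
  rcases h : l x with _ | ⟨u, v⟩
  · exact .inl ⟨rfl, by simp⟩
  · exact .inr ⟨u, v, rfl, by simp⟩

@[fun_prop]
theorem list_cons {f : α → β} {g : α → List β} (hf : PolyTime f) (hg : PolyTime g) :
    PolyTime (fun x => List.cons (f x) (g x)) :=
  (recode (f := fun x : β × List β => x.1 :: x.2) fun _ => rfl).comp (hf.pair hg)

/-- Iteration. -/
theorem iterate {f : γ → γ} (hf : PolyTime f) {l : α → List β} {s : α → γ} (hl : PolyTime l)
    (hs : PolyTime s) (R : Polynomial ℕ)
    (hR : ∀ x, ∀ i ≤ (l x).length, sz (f^[i] (s x)) ≤ R.eval (sz x)) :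
    PolyTime (fun x => f^[(l x).length] (s x)) := by
  obtain ⟨q, Q, hq⟩ := hl.pair hs
  obtain ⟨p, P, hp⟩ := hf
  -- The list on `b` is the loop counter: its leading tag decides the loop test, and each round
  -- removes the tag and the first element before `p` acts on `a`.
  let body : SProg := seq (pop .b) (seq dropB p)
  have key : ∀ (M : ℕ) (l : List β) (s : γ) (a b : List Bool),
      (∀ i ≤ l.length, sz (f^[i] s) ≤ M) → Does (loop .b isTrue body)
        ((Data.code s).enc ++ a) ((Data.code l).enc ++ b)
        ((Data.code (f^[l.length] s)).enc ++ a) (false :: b) ((P.eval M + 22) * sz l) := by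
    intro M l
    induction l with
    | nil =>
      intro s a b _ i o
      exact ⟨1, by simp, .loop_done rfl⟩
    | cons x l ih =>
      intro s a b hM i o
      have h0 := hM 0 (by simp)
      obtain ⟨n, hn, e⟩ := ih (f s) a b (fun i hi => hM (i + 1) (by simpa using hi)) i o
      obtain ⟨m, hm, e'⟩ := ((does_pop_b true ((Data.code s).enc ++ a) _).seq
        ((does_dropB (Data.code x) _ ((Data.code l).enc ++ b)).seq ((hp s).1 a _))) i o
      refine ⟨m + n + 1, ?_, .loop_step (s' := stks i o ((Data.code (f s)).enc ++ a)
        ((Data.code l).enc ++ b) [] []) rfl ?_ e⟩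
      · have := P.eval_nat_mono h0
        change m ≤ 1 + (20 * sz x + _) at hm
        simp only [Function.iterate_zero, id_eq] at this
        have : P.eval (sz s) ≤ P.eval M := this
        rw [sz_cons]
        nlinarith [Nat.zero_le (P.eval M * sz x)]
      · rw [code_cons, BinTree.enc, List.cons_append, List.append_assoc]
        exact e'
  refine ⟨seq q (seq (pop .a) (seq moveAB (seq (loop .b isTrue body) (pop .b)))),
    Q + 2 + 20 * Q + (P.comp R + 22) * Q + R, fun x => ⟨fun a b => ?_, ?_⟩⟩
  · have h1 := (hq x).1 a b
    have h2 := (hq x).2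
    rw [show (Data.code (l x, s x)).enc ++ a =
      true :: ((Data.code (l x)).enc ++ ((Data.code (s x)).enc ++ a)) by
        simp [Data.code, BinTree.enc]] at h1
    refine (h1.seq ((does_pop_a true _ _).seq ((does_moveAB _ _ _).seq
      ((key (R.eval (sz x)) (l x) (s x) a b (hR x)).seq (does_pop_b false _ _))))).mono ?_
    change _ + (1 + (20 * sz (l x) + _)) ≤ _
    have h3 : sz (l x) ≤ Q.eval (sz x) := by
      rw [sz_prod] at h2
      omega
    have h4 := Nat.mul_le_mul_left ((P.eval (R.eval (sz x)) + 22)) h3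
    simp
    omega
  · have := hR x _ le_rfl
    simp at this ⊢
    omega

/-- A fold takes polynomial time if a measure `μ` of the accumulator, which is polynomially
equivalent to its size, grows by a bounded amount in each step. -/
theorem foldl_measure {l : ε → List β} {init : ε → γ} {step : ε → γ → β → γ} (hl : PolyTime l)
    (hi : PolyTime init) (hs : PolyTime (fun x : ε × (γ × β) => step x.1 x.2.1 x.2.2))
    (μ : γ → ℕ) (S : Polynomial ℕ) (hμ : ∀ c, μ c ≤ sz c) (hS : ∀ c, sz c ≤ S.eval (μ c))
    (Q : Polynomial ℕ) (hQ : ∀ e c b, μ (step e c b) ≤ μ c + Q.eval (sz e + sz b)) :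
    PolyTime (fun e => (l e).foldl (step e) (init e)) := by
  -- The fold is an iteration on triples of environment, accumulator and remaining list.
  let F : ε × (γ × List β) → ε × (γ × List β) := fun x =>
    List.casesOn (motive := fun _ => ε × (γ × List β)) x.2.2 x
      (fun b t => (x.1, (step x.1 x.2.1 b, t)))
  have hF : PolyTime F := by
    refine list_cases (l := fun x : ε × (γ × List β) => x.2.2)
      (g := fun x b t => (x.1, (step x.1 x.2.1 b, t))) (by fun_prop) (by fun_prop) ?_
    have : PolyTime (fun x : (ε × (γ × List β)) × (β × List β) => step x.1.1 x.1.2.1 x.2.1) :=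
      hs.comp (f := fun x : (ε × (γ × List β)) × (β × List β) => (x.1.1, (x.1.2.1, x.2.1)))
        (by fun_prop)
    exact .pair (by fun_prop) (.pair this (by fun_prop))
  have key : ∀ (l : List β) (e : ε) (c : γ), F^[l.length] (e, (c, l)) =
      (e, (l.foldl (step e) c, [])) := by
    intro l
    induction l with
    | nil => exact fun e c => rfl
    | cons b l ih => exact fun e c => ih e (step e c b)
  -- Since `M` bounds the size of every element, the growth per round is at most `Q.eval (sz e +
  -- M)`, the same for all rounds.
  have bound : ∀ (l : List β) (e : ε) (c : γ) (M : ℕ), sz l ≤ M → ∀ i ≤ l.length,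
      ∃ c' l', F^[i] (e, (c, l)) = (e, (c', l')) ∧ μ c' ≤ μ c + i * Q.eval (sz e + M) ∧
        sz l' ≤ sz l := by
    intro l
    induction l with
    | nil =>
      intro e c M _ i hi
      obtain rfl : i = 0 := by simpa using hi
      exact ⟨c, [], rfl, by simp, le_rfl⟩
    | cons b l ih =>
      intro e c M hM i hi
      cases i with
      | zero => exact ⟨c, b :: l, rfl, by simp, le_rfl⟩
      | succ i =>
        rw [sz_cons] at hM
        obtain ⟨c', l', h, h', h''⟩ := ih e (step e c b) M (by omega) i (by simpa using hi)
        refine ⟨c', l', h, ?_, by rw [sz_cons]; omega⟩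
        have h1 := hQ e c b
        have h2 := Q.eval_nat_mono (show sz e + sz b ≤ sz e + M by omega)
        rw [Nat.add_mul]
        omega
  obtain ⟨_, T, hT⟩ := id.pair (hi.pair hl)
  have main := iterate hF (l := l) (s := fun e => (e, (init e, l e))) hl (by fun_prop)
    (2 + T + S.comp (T + T * Q.comp T)) fun e i hi' => by
      have h1 := (hT e).2
      obtain ⟨c', l', h, h', h''⟩ := bound (l e) e (init e) (sz (l e)) le_rfl i hi'
      rw [h]
      simp only [sz_prod] at h1
      have h2 := Q.eval_nat_mono (show sz e + sz (l e) ≤ T.eval (sz e) by omega)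
      have h3 := Nat.mul_le_mul (show i ≤ T.eval (sz e) by
        have := length_le_sz (l e); omega) h2
      have h4 := hμ (init e)
      have h5 := (hS c').trans (S.eval_nat_mono
        (show μ c' ≤ T.eval (sz e) + T.eval (sz e) * Q.eval (T.eval (sz e)) by omega))
      simp
      omega
  have := main.snd.fst
  simp only [key] at this
  exact this

theorem foldl {l : ε → List β} {init : ε → γ} {step : ε → γ → β → γ} (hl : PolyTime l)
    (hi : PolyTime init) (hs : PolyTime (fun x : ε × (γ × β) => step x.1 x.2.1 x.2.2))
    (Q : Polynomial ℕ) (hQ : ∀ e c b, sz (step e c b) ≤ sz c + Q.eval (sz e + sz b)) :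
    PolyTime (fun e => (l e).foldl (step e) (init e)) :=
  foldl_measure hl hi hs sz .X (fun _ => le_rfl) (fun _ => by simp) Q hQ

end PolyTime

/-! ### From polynomial-time functions to Turing machines -/

open StackProg Turing

/-- Code words for the letters. -/
def Letter.bits : Letter → List Bool
  | .bit b => [b]
  | .minus => [false, false]
  | .slash => [false, true]
  | .comma => [true, false]
  | .semicolon => [true, true]
  | .hash => []

theorem Letter.bits_injective : Function.Injective Letter.bits := by
  rintro (_ | _) (_ | _) h <;> simp_all [Letter.bits]

/-- Code words for the input symbols of a verifier. -/
def symBits : Letter ⊕ Bool → List Bool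
  | .inl x => true :: x.bits
  | .inr b => [false, b]

theorem sz_symBits_le (s : Letter ⊕ Bool) : sz (symBits s) ≤ 13 := by
  have h (b : Bool) := sz_bool_le b
  have := h true
  have := h false
  rcases s with (b | _ | _ | _ | _ | _) | b <;> simp only [symBits, Letter.bits, sz_cons, sz_nil]
  · have := h b
    omega
  iterate 5 omega
  · have := h b
    omega

namespace StackProg

/-- Is `s` the top symbol? -/
def symTest (s : Letter ⊕ Bool) : Option (Letter ⊕ Bool) → Bool := fun o => decide (o = some s)

theorem symTest_iff {s : Letter ⊕ Bool} {o} : symTest s o = true ↔ o = some s := by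
  simp [symTest]

/-- Push a symbol code onto the list on stack `a`, if `s` is the top input symbol. -/
def readSym (l : List (Letter ⊕ Bool)) : SProg :=
  l.foldr (fun s q => ite .inp (symTest s)
    ((true :: (Data.code (symBits s)).enc).foldr (fun x p => seq p (push .a x)) (pop .inp)) q)
    (pop .inp)

theorem exec_pushes (l : List Bool) (s : Letter ⊕ Bool) (i o a b t c) :
    Exec (l.foldr (fun x p => seq p (push .a x)) (pop .inp) : SProg) (stks (s :: i) o a b t c)
      (1 + l.length) (stks i o (l ++ a) b t c) := by
  induction l with
  | nil => exact exec_pop_inp s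
  | cons x l ih => exact ih.seq (exec_push_a x)

theorem exec_readSym (s : Letter ⊕ Bool) (l : List (Letter ⊕ Bool)) (hs : s ∈ l) :
    ∃ n, ∀ i o a b t c, Exec (readSym l) (stks (s :: i) o a b t c) n
      (stks i o (true :: (Data.code (symBits s)).enc ++ a) b t c) := by
  induction l with
  | nil => simp at hs
  | cons x l ih =>
    by_cases h : s = x
    · subst h
      exact ⟨_, fun i o a b t c => .ite_true (symTest_iff.2 rfl) (exec_pushes _ s i o a b t c)⟩
    · obtain ⟨n, hn⟩ := ih (by simpa [h] using hs)
      exact ⟨n + 1, fun i o a b t c => .ite_false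
        (Bool.eq_false_iff.2 fun e => h (Option.some.inj (symTest_iff.1 e))) (hn i o a b t c)⟩

/-- Read the input. -/
noncomputable def readAll : SProg :=
  seq (push .a false) (loop .inp (fun o => o.isSome) (readSym Finset.univ.toList))

theorem exec_readAll : ∃ C, ∀ w : List (Letter ⊕ Bool), ∃ n ≤ C * w.length + 2,
    Exec readAll (stks w [] [] [] [] []) n
      (stks [] [] (Data.code (w.map symBits).reverse).enc [] [] []) := by
  choose f hf using fun s : Letter ⊕ Bool => exec_readSym s Finset.univ.toList (by simp)
  refine ⟨∑ s, f s + 1, fun w => ?_⟩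
  have key : ∀ (w : List (Letter ⊕ Bool)) (l : List (List Bool)), ∃ n ≤ (∑ s, f s + 1) * w.length + 1,
      Exec (loop .inp (fun o => o.isSome) (readSym Finset.univ.toList))
        (stks w [] (Data.code l).enc [] [] []) n
        (stks [] [] (Data.code ((w.map symBits).reverse ++ l)).enc [] [] []) := by
    intro w
    induction w with
    | nil => exact fun l => ⟨1, by simp, .loop_done rfl⟩
    | cons s w ih =>
      intro l
      obtain ⟨n, hn, e⟩ := ih (symBits s :: l)
      refine ⟨f s + n + 1, ?_, .loop_step rfl (hf s w [] _ [] [] []) ?_⟩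
      · have : f s ≤ ∑ s, f s := Finset.single_le_sum (fun _ _ => Nat.zero_le _) (Finset.mem_univ s)
        simp only [List.length_cons, Nat.mul_add]
        omega
      · rw [List.map_cons, List.reverse_cons, List.append_assoc]
        exact e
  obtain ⟨n, hn, e⟩ := key w []
  refine ⟨1 + n, by omega, .seq (exec_push_a false) ?_⟩
  rw [List.append_nil] at e
  exact e

/-- Write the result. -/
def writeBool : SProg :=
  ite .a isTrue (seq (pop .a) (seq (pop .a) (seq (pop .a) (push .out true))))
    (seq (pop .a) (push .out false))

theorem exec_writeBool (v : Bool) : ∃ n ≤ 5, Exec writeBool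
    (stks [] [] (Data.code v).enc [] [] []) n (stks [] [v] [] [] [] []) := by
  cases v
  · exact ⟨_, by omega, .ite_false rfl (.seq (exec_pop_a _) (exec_push_out _))⟩
  · exact ⟨_, by omega, .ite_true rfl (.seq (exec_pop_a _) (.seq (exec_pop_a _)
      (.seq (exec_pop_a _) (exec_push_out _))))⟩

end StackProg

/-- The machine reads the input into a list on stack `a`, runs the program for `V` and writes the
Boolean. Reading puts each symbol in front of its predecessors, so `V` receives the input in reverse
order. -/
theorem PolyTime.toTuringMachine {V : List (List Bool) → Bool} (hV : PolyTime V) :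
    Nonempty (TM2ComputableInPolyTime encodeWordPair Computability.encodeBool
      fun z : List Letter × List Bool => V ((encodeWordPair z).map symBits).reverse) := by
  obtain ⟨p, P, hp⟩ := hV
  obtain ⟨C, hC⟩ := exec_readAll
  let q : SProg := seq readAll (seq p writeBool)
  have main : ∀ w : List (Letter ⊕ Bool), ∃ n ≤ C * w.length + 2 + (P.eval (14 * w.length + 1) + 5),
      Exec q (stks w [] [] [] [] []) n
        (stks [] [V (w.map symBits).reverse] [] [] [] []) := by
    intro w
    obtain ⟨n₁, h₁, e₁⟩ := hC w
    obtain ⟨n₂, h₂, e₂⟩ := (hp (w.map symBits).reverse).1 [] [] [] []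
    obtain ⟨n₃, h₃, e₃⟩ := exec_writeBool (V (w.map symBits).reverse)
    rw [List.append_nil, List.append_nil] at e₂
    refine ⟨n₁ + (n₂ + n₃), ?_, .seq e₁ (.seq e₂ e₃)⟩
    -- Thirteen for the code word of a symbol, one for the list node.
    have hs : ∀ (w : List (Letter ⊕ Bool)) (l : List (List Bool)),
        sz ((w.map symBits).reverse ++ l) ≤ 14 * w.length + sz l := by
      intro w
      induction w with
      | nil => simp
      | cons s w ih =>
        intro l
        have := ih (symBits s :: l)
        have := sz_symBits_le s
        simp at *
        omega
    have := P.eval_nat_mono (hs w [])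
    rw [List.append_nil, sz_nil] at this
    omega
  let tm : FinTM2 := {
    K := Stk
    k₀ := .inp
    k₁ := .out
    Γ := Alph
    Λ := Option (Lab q)
    main := some (entry q)
    σ := Bool
    initialState := false
    Γk₀Fin := inferInstanceAs (Fintype (Letter ⊕ Bool))
    m := machine q }
  have hinit : ∀ w : List (Letter ⊕ Bool), initList tm w =
      (⟨some (some (entry q)), false, stks w [] [] [] [] []⟩ : TM2.Cfg Alph (Option (Lab q)) Bool) := by
    intro w
    simp only [initList]
    congr 1
    funext k
    cases k <;> rfl
  have hhalt : ∀ o : List Bool, haltList tm o =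
      (⟨none, false, stks [] o [] [] [] []⟩ : TM2.Cfg Alph (Option (Lab q)) Bool) := by
    intro w
    simp only [haltList]
    congr 1
    funext k
    cases k <;> rfl
  refine ⟨{
    tm := tm
    inputAlphabet := Equiv.refl (Letter ⊕ Bool)
    outputAlphabet := Equiv.refl Bool
    time := .C C * .X + 2 + (P.comp (14 * .X + 1) + 5) + 1
    outputsFun := fun z => ?_ }⟩
  have h := main (encodeWordPair z)
  refine ⟨⟨h.choose + 1, ?_⟩, ?_⟩
  · have e₁ : List.map (Equiv.refl (Letter ⊕ Bool)).invFun (encodeWordPair z) = encodeWordPair z :=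
      List.map_id _
    have e₂ : List.map (Equiv.refl Bool).invFun (Computability.encodeBool
      (V (List.map symBits (encodeWordPair z)).reverse)) = _ := List.map_id _
    exact (congrArg (fun s => (flip bind tm.step)^[h.choose + 1] (some s))
      ((congrArg (initList tm) e₁).trans (hinit _))).trans (h.choose_spec.2.machine_halts.trans
        (congrArg some ((congrArg (haltList tm) e₂).trans (hhalt _)).symm))
  · have := h.choose_spec.1
    simp
    omega

/-! ### Lists in polynomial time -/

namespace PolyTime

variable {α β γ δ ε : Type} [Data α] [Data β] [Data γ] [Data δ] [Data ε]

theorem uncurry {f : ε → α → γ} (hf : PolyTime fun x : ε × α => f x.1 x.2) {u : β → ε} {v : β → α}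
    (hu : PolyTime u) (hv : PolyTime v) : PolyTime (fun x => f (u x) (v x)) :=
  hf.comp (hu.pair hv)

@[fun_prop]
theorem not {f : α → Bool} (hf : PolyTime f) : PolyTime (fun x => !f x) :=
  (bcond hf (const false) (const true)).comp id |> fun h => by
    convert h using 2 with x; cases f x <;> rfl

@[fun_prop]
theorem and {f g : α → Bool} (hf : PolyTime f) (hg : PolyTime g) :
    PolyTime (fun x => f x && g x) :=
  (bcond hf hg (const false)) |> fun h => by convert h using 2 with x; cases f x <;> rfl

@[fun_prop]
theorem or {f g : α → Bool} (hf : PolyTime f) (hg : PolyTime g) :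
    PolyTime (fun x => f x || g x) :=
  (bcond hf (const true) hg) |> fun h => by convert h using 2 with x; cases f x <;> rfl

@[fun_prop]
theorem bne {f g : α → Bool} (hf : PolyTime f) (hg : PolyTime g) :
    PolyTime (fun x => f x ^^ g x) :=
  (bcond hf hg.not hg) |> fun h => by convert h using 2 with x; cases f x <;> simp

@[fun_prop]
theorem isEmpty {f : α → List β} (hf : PolyTime f) : PolyTime (fun x => (f x).isEmpty) := by
  convert list_cases (g := fun _ _ _ => false) hf (const true) (const false) using 2 with x
  cases f x <;> rfl

@[fun_prop]
theorem tail {f : α → List β} (hf : PolyTime f) : PolyTime (fun x => (f x).tail) := by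
  convert list_cases (g := fun _ _ t => t) hf (const []) (by fun_prop) using 2 with x
  cases f x <;> rfl

@[fun_prop]
theorem headD {f : α → List β} {d : α → β} (hf : PolyTime f) (hd : PolyTime d) :
    PolyTime (fun x => (f x).headD (d x)) := by
  convert list_cases (g := fun _ y _ => y) hf hd (by fun_prop) using 2 with x
  cases f x <;> rfl

@[fun_prop]
theorem reverse {f : α → List β} (hf : PolyTime f) : PolyTime (fun x => (f x).reverse) := by
  have h : ∀ l m : List β, l.foldl (fun c b => b :: c) m = l.reverse ++ m := by
    intro l
    induction l with
    | nil => simp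
    | cons x l ih => simp [ih]
  convert foldl (step := fun _ c b => b :: c) hf (const ([] : List β)) (by fun_prop) (1 + .X) ?_
    using 2 with x
  · simp
  · intro e c b
    simp
    omega

@[fun_prop]
theorem append {f g : α → List β} (hf : PolyTime f) (hg : PolyTime g) :
    PolyTime (fun x => f x ++ g x) := by
  convert foldl (l := fun x => (f x).reverse) (step := fun _ c b => b :: c) (by fun_prop) hg
    (by fun_prop) (1 + .X) ?_ using 2 with x
  · simp
  · intro e c b
    simp
    omega

theorem size_bound {f : α → β} (hf : PolyTime f) :
    ∃ Q : Polynomial ℕ, ∀ x, sz (f x) ≤ Q.eval (sz x) :=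
  let ⟨_, Q, h⟩ := hf
  ⟨Q, fun x => (h x).2⟩

@[fun_prop]
theorem map {l : ε → List α} {g : ε → α → β} (hl : PolyTime l)
    (hg : PolyTime fun x : ε × α => g x.1 x.2) : PolyTime (fun e => (l e).map (g e)) := by
  obtain ⟨Q, hQ⟩ := hg.size_bound
  have : PolyTime (fun e => ((l e).reverse.foldl (fun c b => g e b :: c) [])) := by
    refine foldl (l := fun e => (l e).reverse) (step := fun e c b => g e b :: c) (by fun_prop)
      (const _) ?_ (1 + Q.comp (1 + .X)) ?_
    · exact .list_cons (uncurry hg (by fun_prop) (by fun_prop)) (by fun_prop)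
    · intro e c b
      have : sz (g e b) ≤ _ := hQ (e, b)
      rw [sz_prod] at this
      simp
      omega
  convert this using 2 with e
  rw [List.foldl_reverse]
  induction l e <;> simp_all

@[fun_prop]
theorem flatMap {l : ε → List α} {g : ε → α → List β} (hl : PolyTime l)
    (hg : PolyTime fun x : ε × α => g x.1 x.2) : PolyTime (fun e => (l e).flatMap (g e)) := by
  obtain ⟨Q, hQ⟩ := hg.size_bound
  have happ : ∀ a b : List β, sz (a ++ b) ≤ sz a + sz b := by
    intro a b
    induction a <;> simp; omega
  have : PolyTime (fun e => ((l e).reverse.foldl (fun c b => g e b ++ c) [])) := by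
    refine foldl (l := fun e => (l e).reverse) (step := fun e c b => g e b ++ c) (by fun_prop)
      (const _) ?_ (Q.comp (1 + .X)) ?_
    · exact .append (uncurry hg (by fun_prop) (by fun_prop)) (by fun_prop)
    · intro e c b
      have : sz (g e b) ≤ _ := hQ (e, b)
      rw [sz_prod] at this
      have := happ (g e b) c
      simp
      omega
  convert this using 2 with e
  rw [List.foldl_reverse]
  induction l e <;> simp_all

theorem filter {l : ε → List α} {g : ε → α → Bool} (hl : PolyTime l)
    (hg : PolyTime fun x : ε × α => g x.1 x.2) : PolyTime (fun e => (l e).filter (g e)) := by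
  have := flatMap (g := fun e b => bif g e b then [b] else []) hl (by
    exact .bcond hg (by fun_prop) (by fun_prop))
  convert this using 2 with e
  induction l e with
  | nil => rfl
  | cons x l ih => cases h : g e x <;> simp_all

@[fun_prop]
theorem all {l : ε → List α} {g : ε → α → Bool} (hl : PolyTime l)
    (hg : PolyTime fun x : ε × α => g x.1 x.2) : PolyTime (fun e => (l e).all (g e)) := by
  have : PolyTime (fun e => ((l e).reverse.foldl (fun c b => g e b && c) true)) := by
    refine foldl (l := fun e => (l e).reverse) (step := fun e c b => g e b && c) (by fun_prop)
      (const _) ?_ 3 ?_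
    · exact .and (uncurry hg (by fun_prop) (by fun_prop)) (by fun_prop)
    · intro e c b
      have := sz_bool_le (g e b && c)
      simp
      omega
  convert this using 2 with e
  rw [List.foldl_reverse]
  induction l e <;> simp_all

@[fun_prop]
theorem any {l : ε → List α} {g : ε → α → Bool} (hl : PolyTime l)
    (hg : PolyTime fun x : ε × α => g x.1 x.2) : PolyTime (fun e => (l e).any (g e)) := by
  have := (all (g := fun e x => !g e x) hl hg.not).not
  convert this using 2 with e
  rw [List.not_all_eq_any_not]
  simp

end PolyTime

/-! ### Relations between the elements of lists -/

/-- Two lists have the same length and corresponding elements are related. -/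
def listRel {α β : Type} (r : α → β → Bool) : List α → List β → Bool
  | [], l => l.isEmpty
  | x :: l, m => !m.isEmpty && (m.head?.all (r x) && listRel r l m.tail)

/-- All pairs of elements at different positions are related (in the order of the list). -/
def pairRel {α : Type} (r : α → α → Bool) : List α → Bool
  | [] => true
  | x :: l => l.all (r x) && pairRel r l

namespace PolyTime

variable {α β γ δ ε : Type} [Data α] [Data β] [Data γ] [Data δ] [Data ε]

theorem listRel {r : ε → α → β → Bool} {l : ε → List α} {m : ε → List β}
    (hr : PolyTime fun x : ε × (α × β) => r x.1 x.2.1 x.2.2) (hl : PolyTime l) (hm : PolyTime m) :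
    PolyTime (fun e => listRel (r e) (l e) (m e)) := by
  -- The state is the verdict so far and the rest of the second list. If the second list is too
  -- short, the verdict becomes `false`; if it is too long, the final test for emptiness fails.
  let step : ε → Bool × List β → α → Bool × List β := fun e c x =>
    List.casesOn (motive := fun _ => Bool × List β) c.2 (false, []) (fun y t => (c.1 && r e x y, t))
  have hstep : PolyTime (fun x : ε × ((Bool × List β) × α) => step x.1 x.2.1 x.2.2) := by
    refine list_cases (l := fun x : ε × ((Bool × List β) × α) => x.2.1.2)
      (g := fun x y t => (x.2.1.1 && r x.1 x.2.2 y, t)) (by fun_prop) (by fun_prop) ?_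
    refine .pair (.and (by fun_prop) ?_) (by fun_prop)
    exact hr.comp (f := fun x : (ε × ((Bool × List β) × α)) × (β × List β) =>
      (x.1.1, (x.1.2.2, x.2.1))) (by fun_prop)
  have main := foldl hl (init := fun e => (true, m e)) (by fun_prop) hstep 3 (by
    rintro e ⟨c, l⟩ x
    cases l with
    | nil =>
      have := sz_pos c
      simp [step, show sz false = 1 from rfl]
    | cons y t =>
      have := sz_bool_le (c && r e x y)
      simp [step]; omega)
  have key : ∀ e (l : List α) (b : Bool) (m : List β),
      ((l.foldl (step e) (b, m)).1 && (l.foldl (step e) (b, m)).2.isEmpty) =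
        (b && _root_.listRel (r e) l m) := by
    intro e l
    induction l with
    | nil => intro b m; simp [_root_.listRel]
    | cons x l ih =>
      intro b m
      cases m with
      | nil =>
        simp only [List.foldl_cons]
        rw [ih]
        simp [_root_.listRel]
      | cons y t =>
        simp only [List.foldl_cons]
        rw [ih]
        simp [_root_.listRel, Bool.and_assoc]
  have := main.fst.and main.snd.isEmpty
  convert this using 2 with e
  rw [key, Bool.true_and]

theorem pairRel {r : ε → α → α → Bool} {l : ε → List α}
    (hr : PolyTime fun x : ε × (α × α) => r x.1 x.2.1 x.2.2) (hl : PolyTime l) :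
    PolyTime (fun e => pairRel (r e) (l e)) := by
  have hr' : PolyTime (fun x : ((ε × ((Bool × List α) × α)) × α) => r x.1.1 x.1.2.2 x.2) :=
    hr.comp (f := fun x : ((ε × ((Bool × List α) × α)) × α) => (x.1.1, (x.1.2.2, x.2)))
      (by fun_prop)
  -- The list is scanned from its end, and the accumulator keeps the suffix with which the next
  -- element is to be compared.
  have main := foldl (l := fun e => (l e).reverse) (init := fun _ => (true, ([] : List α)))
    (step := fun e c x => (c.2.all (r e x) && c.1, x :: c.2)) (by fun_prop) (by fun_prop)
    (.pair (.and (.all (by fun_prop) hr') (by fun_prop)) (by fun_prop)) (4 + .X) (by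
      rintro e ⟨c, l⟩ x
      have := sz_bool_le (l.all (r e x) && c)
      simp
      omega)
  convert main.fst using 2 with e
  rw [List.foldl_reverse]
  have : ∀ l : List α, l.foldr (fun x c => (c.2.all (r e x) && c.1, x :: c.2)) (true, []) =
      (_root_.pairRel (r e) l, l) := by
    intro l
    induction l with
    | nil => rfl
    | cons x l ih => simp [ih, _root_.pairRel]
  rw [this]

theorem zip {f : ε → List α} {g : ε → List β} (hf : PolyTime f) (hg : PolyTime g) :
    PolyTime (fun e => (f e).zip (g e)) := by
  let step : ε → List (α × β) × List β → α → List (α × β) × List β := fun _ c x =>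
    List.casesOn (motive := fun _ => List (α × β) × List β) c.2 (c.1, [])
      (fun y t => ((x, y) :: c.1, t))
  have hstep : PolyTime (fun x : ε × ((List (α × β) × List β) × α) => step x.1 x.2.1 x.2.2) := by
    exact list_cases (l := fun x : ε × ((List (α × β) × List β) × α) => x.2.1.2)
      (g := fun x y t => ((x.2.2, y) :: x.2.1.1, t)) (by fun_prop) (by fun_prop) (by fun_prop)
  have main := foldl hf (init := fun e => ([], g e)) (by fun_prop) hstep (2 + .X) (by
    rintro e ⟨c, l⟩ x
    cases l with
    | nil => simp [step]
    | cons y t => simp [step]; omega)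
  convert main.fst.reverse using 2 with e
  have : ∀ (l : List α) (c : List (α × β)) (m : List β),
      (l.foldl (step e) (c, m)).1.reverse = c.reverse ++ l.zip m := by
    intro l
    induction l with
    | nil => simp
    | cons x l ih =>
      intro c m
      cases m with
      | nil => simp only [List.foldl_cons]; rw [ih]; simp
      | cons y t => simp only [List.foldl_cons]; rw [ih]; simp
  rw [this]
  simp

end PolyTime

/-! ### Binary arithmetic in polynomial time -/

/-- The value of a list of binary digits, least significant digit first. -/
def bitsVal : List Bool → ℕ
  | [] => 0
  | b :: l => b.toNat + 2 * bitsVal l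

theorem bitsVal_append (l m : List Bool) :
    bitsVal (l ++ m) = bitsVal l + 2 ^ l.length * bitsVal m := by
  induction l with
  | nil => simp [bitsVal]
  | cons b l ih => simp only [List.cons_append, bitsVal, ih, List.length_cons, pow_succ]; ring

theorem bitsVal_eq_headD (l : List Bool) : bitsVal l = (l.headD false).toNat + 2 * bitsVal l.tail := by
  cases l <;> rfl

/-- One step of the addition of two lists of binary digits. -/
def addStep (s : (List Bool × List Bool) × (Bool × List Bool)) (_ : Bool) :
    (List Bool × List Bool) × (Bool × List Bool) :=
  ((s.1.1.tail, s.1.2.tail),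
    ((s.1.1.headD false && s.1.2.headD false) || (s.2.1 && (s.1.1.headD false || s.1.2.headD false)),
      ((s.1.1.headD false ^^ s.1.2.headD false) ^^ s.2.1) :: s.2.2))

/-- Addition of binary numbers. -/
def addBits (a b : List Bool) : List Bool :=
  let s := (a ++ b).foldl addStep ((a, b), (false, []))
  (s.2.1 :: s.2.2).reverse

/-- The invariant of the loop: the digits written so far, plus the shifted sum of the remaining
digits and the carry. The entries of `k` only count the rounds, and an exhausted summand supplies
zeros. -/
theorem bitsVal_addStep (k : List Bool) : ∀ (a b : List Bool) (c : Bool) (o : List Bool),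
    a.length ≤ k.length → b.length ≤ k.length →
    bitsVal (((k.foldl addStep ((a, b), (c, o))).2.1 ::
      (k.foldl addStep ((a, b), (c, o))).2.2).reverse) =
      bitsVal o.reverse + 2 ^ o.length * (bitsVal a + bitsVal b + c.toNat) := by
  induction k with
  | nil =>
    intro a b c o ha hb
    simp only [List.length_nil, Nat.le_zero, List.length_eq_zero_iff] at ha hb
    subst ha hb
    simp [bitsVal_append, bitsVal]
  | cons x k ih =>
    intro a b c o ha hb
    rw [List.foldl_cons, addStep, ih _ _ _ _ (by simp at *; omega) (by simp at *; omega),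
      bitsVal_eq_headD a, bitsVal_eq_headD b, List.reverse_cons, bitsVal_append]
    generalize a.headD false = u
    generalize b.headD false = v
    simp only [List.length_reverse, List.length_cons, pow_succ, bitsVal]
    cases u <;> cases v <;> cases c <;> simp <;> ring

theorem bitsVal_addBits (a b : List Bool) : bitsVal (addBits a b) = bitsVal a + bitsVal b := by
  rw [addBits, bitsVal_addStep _ _ _ _ _ (by simp) (by simp)]
  simp [bitsVal]

/-- Unlike the size, the length of a sum does not depend on the values of the digits; this makes it
a suitable measure in the multiplication loop. -/
theorem length_addBits (a b : List Bool) : (addBits a b).length = a.length + b.length + 1 := by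
  have : ∀ (k : List Bool) s, (k.foldl addStep s).2.2.length = k.length + s.2.2.length := by
    intro k
    induction k with
    | nil => simp
    | cons x k ih => intro s; simp [ih, addStep]; omega
  simp [addBits, this, Nat.add_comm]

/-- Multiplication of binary numbers. -/
def mulBits (a b : List Bool) : List Bool :=
  b.reverse.foldl (fun c x => addBits (false :: c) (bif x then a else [])) []

theorem bitsVal_mulBits (a b : List Bool) : bitsVal (mulBits a b) = bitsVal a * bitsVal b := by
  rw [mulBits, List.foldl_reverse]
  induction b with
  | nil => rfl
  | cons x b ih =>
    rw [List.foldr_cons, bitsVal_addBits, bitsVal, ih, bitsVal]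
    cases x <;> simp [bitsVal] <;> ring

/-- One step of the comparison of two lists of binary digits. -/
def ltStep (s : (List Bool × List Bool) × Bool) (_ : Bool) : (List Bool × List Bool) × Bool :=
  ((s.1.1.tail, s.1.2.tail),
    bif s.1.1.headD false ^^ s.1.2.headD false then s.1.2.headD false else s.2)

/-- Comparison of binary numbers. -/
def ltBits (a b : List Bool) : Bool := ((a ++ b).foldl ltStep ((a, b), false)).2

theorem ltBits_iff (a b : List Bool) : ltBits a b = true ↔ bitsVal a < bitsVal b := by
  -- The scan starts with the least significant digits, so a difference found later overrides the
  -- verdict `r`.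
  have : ∀ (k a b : List Bool) (r : Bool), a.length ≤ k.length → b.length ≤ k.length →
      ((k.foldl ltStep ((a, b), r)).2 = true ↔
        bitsVal a < bitsVal b ∨ (bitsVal a = bitsVal b ∧ r = true)) := by
    intro k
    induction k with
    | nil =>
      intro a b r ha hb
      simp only [List.length_nil, Nat.le_zero, List.length_eq_zero_iff] at ha hb
      subst ha hb
      simp
    | cons x k ih =>
      intro a b r ha hb
      rw [List.foldl_cons, ltStep, ih _ _ _ (by simp at *; omega) (by simp at *; omega),
        bitsVal_eq_headD a, bitsVal_eq_headD b]
      generalize a.headD false = u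
      generalize b.headD false = v
      cases u <;> cases v <;> simp <;> omega
  rw [ltBits, this _ _ _ _ (by simp) (by simp)]
  simp

/-- Integers as differences of binary numbers. -/
def BinInt : Type := List Bool × List Bool

namespace BinInt

instance : Data BinInt := inferInstanceAs (Data (List Bool × List Bool))

/-- The difference of two binary numbers. -/
def mk (a b : List Bool) : BinInt := (a, b)

/-- The value. -/
def toInt (z : BinInt) : ℤ := bitsVal z.1 - bitsVal z.2

theorem toInt_mk (a b : List Bool) : (mk a b).toInt = bitsVal a - bitsVal b := rfl

instance : Add BinInt := ⟨fun x y => (addBits x.1 y.1, addBits x.2 y.2)⟩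

instance : Sub BinInt := ⟨fun x y => (addBits x.1 y.2, addBits x.2 y.1)⟩

instance : Mul BinInt := ⟨fun x y => (addBits (mulBits x.1 y.1) (mulBits x.2 y.2),
  addBits (mulBits x.1 y.2) (mulBits x.2 y.1))⟩

/-- Is the number positive? -/
def pos (z : BinInt) : Bool := ltBits z.2 z.1

@[simp] theorem toInt_add (x y : BinInt) : (x + y).toInt = x.toInt + y.toInt := by
  change ((bitsVal (addBits x.1 y.1) : ℕ) : ℤ) - (bitsVal (addBits x.2 y.2) : ℕ) = _
  simp only [bitsVal_addBits, toInt]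
  push_cast
  ring

@[simp] theorem toInt_sub (x y : BinInt) : (x - y).toInt = x.toInt - y.toInt := by
  change ((bitsVal (addBits x.1 y.2) : ℕ) : ℤ) - (bitsVal (addBits x.2 y.1) : ℕ) = _
  simp only [bitsVal_addBits, toInt]
  push_cast
  ring

@[simp] theorem toInt_mul (x y : BinInt) : (x * y).toInt = x.toInt * y.toInt := by
  change ((bitsVal (addBits (mulBits x.1 y.1) (mulBits x.2 y.2)) : ℕ) : ℤ) -
    (bitsVal (addBits (mulBits x.1 y.2) (mulBits x.2 y.1)) : ℕ) = _
  simp only [bitsVal_addBits, bitsVal_mulBits, toInt]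
  push_cast
  ring

@[simp] theorem pos_iff (x : BinInt) : x.pos = true ↔ 0 < x.toInt := by
  rw [pos, ltBits_iff, toInt]
  omega

end BinInt

namespace PolyTime

variable {α : Type} [Data α]

theorem addBits {f g : α → List Bool} (hf : PolyTime f) (hg : PolyTime g) :
    PolyTime (fun x => addBits (f x) (g x)) := by
  have hs : PolyTime (fun x : α × (((List Bool × List Bool) × (Bool × List Bool)) × Bool) =>
      addStep x.2.1 x.2.2) := by
    unfold addStep
    fun_prop
  have main := foldl (l := fun x => f x ++ g x) (init := fun x => ((f x, g x), (false, [])))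
    (step := fun _ s b => addStep s b) (by fun_prop) (by fun_prop) hs 6 (by
      rintro e ⟨⟨a, b⟩, ⟨c, o⟩⟩ _
      have h : ∀ a : List Bool, sz a.tail ≤ sz a := by
        intro a; cases a <;> simp; omega
      have h1 := h a
      have h2 := h b
      have h3 := sz_bool_le ((a.headD false && b.headD false) || (c && (a.headD false || b.headD false)))
      have h4 := sz_bool_le ((a.headD false ^^ b.headD false) ^^ c)
      have := sz_pos c
      simp only [addStep, sz_prod, sz_cons, Polynomial.eval_ofNat]
      omega)
  unfold _root_.addBits
  exact (PolyTime.list_cons main.snd.fst main.snd.snd).reverse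

theorem mulBits {f g : α → List Bool} (hf : PolyTime f) (hg : PolyTime g) :
    PolyTime (fun x => mulBits (f x) (g x)) := by
  have hsz : ∀ l : List Bool, sz l ≤ 1 + 4 * l.length := by
    intro l
    induction l with
    | nil => simp
    | cons b l ih =>
      have := sz_bool_le b
      simp
      omega
  have hs : PolyTime (fun x : (List Bool × List Bool) × (List Bool × Bool) =>
      _root_.addBits (false :: x.2.1) (bif x.2.2 then x.1.1 else [])) :=
    .addBits (by fun_prop) (by fun_prop)
  -- The measure is the length, because `true` is larger than `false`: an addition may change many
  -- digits of the accumulator and enlarge it by more than the size of the summand accounts for.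
  have main : PolyTime (fun x : List Bool × List Bool => _root_.mulBits x.1 x.2) :=
    foldl_measure (l := fun x : List Bool × List Bool => x.2.reverse) (init := fun _ => [])
      (step := fun x c y => _root_.addBits (false :: c) (bif y then x.1 else [])) (by fun_prop)
      (by fun_prop) hs List.length (1 + 4 * .X) (fun c => length_le_sz c)
      (fun c => by simpa using hsz c) (2 + .X) (by
        rintro ⟨a, b⟩ c y
        have := length_le_sz a
        cases y <;> simp [length_addBits] <;> omega)
  exact uncurry (f := _root_.mulBits) main hf hg

theorem ltBits {f g : α → List Bool} (hf : PolyTime f) (hg : PolyTime g) :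
    PolyTime (fun x => ltBits (f x) (g x)) := by
  have hs : PolyTime (fun x : α × (((List Bool × List Bool) × Bool) × Bool) =>
      ltStep x.2.1 x.2.2) := by
    unfold ltStep
    fun_prop
  have main := foldl (l := fun x => f x ++ g x) (init := fun x => ((f x, g x), false))
    (step := fun _ s b => ltStep s b) (by fun_prop) (by fun_prop) hs 6 (by
      rintro e ⟨⟨a, b⟩, c⟩ _
      have h : ∀ a : List Bool, sz a.tail ≤ sz a := by
        intro a; cases a <;> simp; omega
      have h1 := h a
      have h2 := h b
      have h3 := sz_bool_le (bif a.headD false ^^ b.headD false then b.headD false else c)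
      have := sz_pos c
      simp only [ltStep, sz_prod, Polynomial.eval_ofNat]
      omega)
  unfold _root_.ltBits
  exact main.snd

@[fun_prop]
theorem binInt_mk {f g : α → List Bool} (hf : PolyTime f) (hg : PolyTime g) :
    PolyTime (fun x => BinInt.mk (f x) (g x)) := pair_aux hf hg

theorem binInt_fst {f : α → BinInt} (hf : PolyTime f) : PolyTime (fun x => Prod.fst (f x)) :=
  (fst_aux (α := List Bool) (β := List Bool)).comp hf

theorem binInt_snd {f : α → BinInt} (hf : PolyTime f) : PolyTime (fun x => Prod.snd (f x)) :=
  (snd_aux (α := List Bool) (β := List Bool)).comp hf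

@[fun_prop]
theorem binInt_add {f g : α → BinInt} (hf : PolyTime f) (hg : PolyTime g) :
    PolyTime (fun x => f x + g x) :=
  pair_aux (hf.binInt_fst.addBits hg.binInt_fst) (hf.binInt_snd.addBits hg.binInt_snd)

@[fun_prop]
theorem binInt_sub {f g : α → BinInt} (hf : PolyTime f) (hg : PolyTime g) :
    PolyTime (fun x => f x - g x) :=
  pair_aux (hf.binInt_fst.addBits hg.binInt_snd) (hf.binInt_snd.addBits hg.binInt_fst)

@[fun_prop]
theorem binInt_mul {f g : α → BinInt} (hf : PolyTime f) (hg : PolyTime g) :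
    PolyTime (fun x => f x * g x) :=
  pair_aux ((hf.binInt_fst.mulBits hg.binInt_fst).addBits (hf.binInt_snd.mulBits hg.binInt_snd))
    ((hf.binInt_fst.mulBits hg.binInt_snd).addBits (hf.binInt_snd.mulBits hg.binInt_fst))

@[fun_prop]
theorem binInt_pos {f : α → BinInt} (hf : PolyTime f) : PolyTime (fun x => (f x).pos) :=
  hf.binInt_snd.ltBits hf.binInt_fst

end PolyTime

/-! ### Orientation of triples of points in the plane -/

namespace Plane

/-- Twice the signed area of the triangle `abc`. -/
def orient (a b c : ℝ × ℝ) : ℝ := (b.1 - a.1) * (c.2 - a.2) - (b.2 - a.2) * (c.1 - a.1)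

theorem orient_rotate (a b c : ℝ × ℝ) : orient b c a = orient a b c := by
  unfold orient; ring

theorem orient_swap (a b c : ℝ × ℝ) : orient b a c = -orient a b c := by
  unfold orient; ring

@[simp] theorem orient_left (a b : ℝ × ℝ) : orient a b a = 0 := by unfold orient; ring

@[simp] theorem orient_right (a b : ℝ × ℝ) : orient a b b = 0 := by unfold orient; ring

theorem mem_segment {a b x : ℝ × ℝ} : x ∈ segment ℝ a b ↔
    ∃ t, 0 ≤ t ∧ t ≤ 1 ∧ x.1 = (1 - t) * a.1 + t * b.1 ∧ x.2 = (1 - t) * a.2 + t * b.2 := by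
  rw [segment_eq_image]
  constructor
  · rintro ⟨t, ⟨h0, h1⟩, rfl⟩
    exact ⟨t, h0, h1, by simp, by simp⟩
  · rintro ⟨t, h0, h1, h2, h3⟩
    exact ⟨t, ⟨h0, h1⟩, Prod.ext (by simp [h2]) (by simp [h3])⟩

theorem combo_pos {a b t : ℝ} (h0 : 0 ≤ t) (h1 : t ≤ 1) (ha : 0 < a) (hb : 0 < b) :
    0 < (1 - t) * a + t * b := by
  rcases eq_or_lt_of_le h0 with rfl | h0
  · linarith
  · have := mul_nonneg (sub_nonneg.2 h1) ha.le
    have := mul_pos h0 hb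
    linarith

theorem orient_combo {a b p q x : ℝ × ℝ} {t : ℝ} (h1 : x.1 = (1 - t) * p.1 + t * q.1)
    (h2 : x.2 = (1 - t) * p.2 + t * q.2) :
    orient a b x = (1 - t) * orient a b p + t * orient a b q := by
  unfold orient; rw [h1, h2]; ring

theorem exists_param {a b c : ℝ × ℝ} (hab : a ≠ b) (h : orient a b c = 0) :
    ∃ m, c.1 = (1 - m) * a.1 + m * b.1 ∧ c.2 = (1 - m) * a.2 + m * b.2 := by
  unfold orient at h
  by_cases h1 : b.1 - a.1 = 0
  · have h2 : b.2 - a.2 ≠ 0 := fun h2 => hab (Prod.ext (by linarith) (by linarith))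
    refine ⟨(c.2 - a.2) / (b.2 - a.2), ?_, ?_⟩
    · have : (b.2 - a.2) * (c.1 - a.1) = 0 := by rw [h1] at h; linarith
      have h3 : c.1 - a.1 = 0 := (mul_eq_zero.1 this).resolve_left h2
      field_simp
      linear_combination (b.2 - a.2) * h3 - (c.2 - a.2) * h1
    · field_simp; ring
  · refine ⟨(c.1 - a.1) / (b.1 - a.1), ?_, ?_⟩
    · field_simp; ring
    · field_simp
      linear_combination h

/-- On the line `ab` the products locate `x` between the endpoints; both coordinates are needed, as
the line may be vertical or horizontal. A description by signs alone is constant on cells and can be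
tested with integers. -/
theorem mem_segment_iff {a b x : ℝ × ℝ} : x ∈ segment ℝ a b ↔ orient a b x = 0 ∧
    (x.1 - a.1) * (x.1 - b.1) ≤ 0 ∧ (x.2 - a.2) * (x.2 - b.2) ≤ 0 := by
  constructor
  · rw [mem_segment]
    rintro ⟨t, h0, h1, h2, h3⟩
    refine ⟨by rw [orient_combo h2 h3]; simp, ?_, ?_⟩
    · have : (x.1 - a.1) * (x.1 - b.1) = -(t * (1 - t) * (b.1 - a.1) ^ 2) := by rw [h2]; ring
      rw [this]
      have := mul_nonneg (mul_nonneg h0 (sub_nonneg.2 h1)) (sq_nonneg (b.1 - a.1))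
      linarith
    · have : (x.2 - a.2) * (x.2 - b.2) = -(t * (1 - t) * (b.2 - a.2) ^ 2) := by rw [h3]; ring
      rw [this]
      have := mul_nonneg (mul_nonneg h0 (sub_nonneg.2 h1)) (sq_nonneg (b.2 - a.2))
      linarith
  · rintro ⟨h1, h2, h3⟩
    by_cases hab : a = b
    · subst hab
      have h2' : x.1 - a.1 = 0 := by nlinarith [mul_self_nonneg (x.1 - a.1)]
      have h3' : x.2 - a.2 = 0 := by nlinarith [mul_self_nonneg (x.2 - a.2)]
      rw [segment_same]
      exact Prod.ext (by linarith) (by linarith)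
    · obtain ⟨m, hm1, hm2⟩ := exists_param hab h1
      have e1 : (x.1 - a.1) * (x.1 - b.1) = m * (m - 1) * (b.1 - a.1) ^ 2 := by rw [hm1]; ring
      have e2 : (x.2 - a.2) * (x.2 - b.2) = m * (m - 1) * (b.2 - a.2) ^ 2 := by rw [hm2]; ring
      have hpos : 0 < (b.1 - a.1) ^ 2 + (b.2 - a.2) ^ 2 := by
        by_contra hn
        have k1 : b.1 - a.1 = 0 := by nlinarith [sq_nonneg (b.1 - a.1), sq_nonneg (b.2 - a.2)]
        have k2 : b.2 - a.2 = 0 := by nlinarith [sq_nonneg (b.1 - a.1), sq_nonneg (b.2 - a.2)]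
        exact hab (Prod.ext (by linarith) (by linarith))
      have hm : m * (m - 1) ≤ 0 := by
        by_contra hn
        push Not at hn
        nlinarith [mul_pos hn hpos]
      exact mem_segment.2 ⟨m, by nlinarith, by nlinarith, hm1, hm2⟩

/-- Two segments that meet cross properly, or one of them contains an endpoint of the other. -/
theorem segments_meet {u f v g x : ℝ × ℝ} (hx : x ∈ segment ℝ u f) (hx' : x ∈ segment ℝ v g) :
    u ∈ segment ℝ v g ∨ f ∈ segment ℝ v g ∨ v ∈ segment ℝ u f ∨ g ∈ segment ℝ u f ∨
      (orient u f v * orient u f g < 0 ∧ orient v g u * orient v g f < 0) := by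
  -- As `orient u f` is affine on `vg` and vanishes at `x`, the points `v` and `g` are on opposite
  -- sides of the line, or one of them is `x`, or both are on the line.
  have aux : ∀ {u f v g x : ℝ × ℝ}, x ∈ segment ℝ u f → x ∈ segment ℝ v g →
      orient u f v * orient u f g < 0 ∨ v ∈ segment ℝ u f ∨ g ∈ segment ℝ u f ∨
        (u ≠ f → orient u f v = 0 ∧ orient u f g = 0) := by
    intro u f v g x hx hx'
    obtain ⟨t, h0, h1, h2, h3⟩ := mem_segment.1 hx'
    have e := orient_combo (a := u) (b := f) h2 h3
    rw [(mem_segment_iff.1 hx).1] at e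
    rcases lt_trichotomy (orient u f v * orient u f g) 0 with h | h | h
    · exact .inl h
    · rcases eq_or_lt_of_le h0 with h0 | h0
      · right; left
        rwa [show v = x from Prod.ext (by rw [h2, ← h0]; ring) (by rw [h3, ← h0]; ring)]
      rcases eq_or_lt_of_le h1 with h1 | h1
      · right; right; left
        rwa [show g = x from Prod.ext (by rw [h2, h1]; ring) (by rw [h3, h1]; ring)]
      · right; right; right
        intro _
        rcases mul_eq_zero.1 h with h | h
        · rw [h] at e
          exact ⟨h, by have : t * orient u f g = 0 := by linarith
                       exact (mul_eq_zero.1 this).resolve_left h0.ne'⟩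
        · rw [h] at e
          exact ⟨by have : (1 - t) * orient u f v = 0 := by linarith
                    exact (mul_eq_zero.1 this).resolve_left (by linarith), h⟩
    · exfalso
      rcases mul_pos_iff.1 h with ⟨p, q⟩ | ⟨p, q⟩
      · linarith [combo_pos h0 h1 p q]
      · linarith [combo_pos h0 h1 (neg_pos.2 p) (neg_pos.2 q)]
  by_cases huf : u = f
  · subst huf
    rw [segment_same] at hx
    left
    rwa [← Set.mem_singleton_iff.1 hx]
  rcases aux hx hx' with h | h | h | h
  · rcases aux hx' hx with h' | h' | h' | h'
    · exact .inr (.inr (.inr (.inr ⟨h, h'⟩)))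
    · exact .inl h'
    · exact .inr (.inl h')
    · by_cases hvg : v = g
      · subst hvg
        nlinarith [mul_self_nonneg (orient u f v)]
      · exfalso
        obtain ⟨k1, k2⟩ := h' hvg
        obtain ⟨m, a1, a2⟩ := exists_param hvg k1
        obtain ⟨n, b1, b2⟩ := exists_param hvg k2
        have : orient u f v * orient u f g = 0 := by
          have : orient u f v = 0 := by
            unfold orient; rw [a1, a2, b1, b2]; ring
          rw [this, zero_mul]
        linarith
  · exact .inr (.inr (.inl h))
  · exact .inr (.inr (.inr (.inl h)))
  · obtain ⟨k1, k2⟩ := h huf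
    obtain ⟨m, a1, a2⟩ := exists_param huf k1
    obtain ⟨n, b1, b2⟩ := exists_param huf k2
    obtain ⟨t, t0, t1, x1, x2⟩ := mem_segment.1 hx
    obtain ⟨s, s0, s1, y1, y2⟩ := mem_segment.1 hx'
    -- All points are now on one line. In the coordinate with `u` at 0 and `f` at 1, the points `v`,
    -- `g` and `x` are at `m`, `n` and `t`.
    have ht : t = (1 - s) * m + s * n := by
      by_contra hne
      apply huf
      have c1 : (t - ((1 - s) * m + s * n)) * (f.1 - u.1) = 0 := by
        rw [x1, a1, b1] at y1; linear_combination y1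
      have c2 : (t - ((1 - s) * m + s * n)) * (f.2 - u.2) = 0 := by
        rw [x2, a2, b2] at y2; linear_combination y2
      have d1 := (mul_eq_zero.1 c1).resolve_left (sub_ne_zero.2 hne)
      have d2 := (mul_eq_zero.1 c2).resolve_left (sub_ne_zero.2 hne)
      exact Prod.ext (by linarith) (by linarith)
    by_cases hm : 0 ≤ m ∧ m ≤ 1
    · exact .inr (.inr (.inl (mem_segment.2 ⟨m, hm.1, hm.2, a1, a2⟩)))
    by_cases hn : 0 ≤ n ∧ n ≤ 1
    · exact .inr (.inr (.inr (.inl (mem_segment.2 ⟨n, hn.1, hn.2, b1, b2⟩))))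
    left
    -- Neither `v` nor `g` is on `uf`, but a point between them is. So they lie beyond different
    -- ends, and `u` is between them.
    have hmn : (m < 0 ∧ 1 < n) ∨ (1 < m ∧ n < 0) := by
      by_cases m0 : m < 0
      · left
        refine ⟨m0, ?_⟩
        by_contra n1
        have : n < 0 := by
          by_contra n0
          exact hn ⟨by linarith, by linarith⟩
        linarith [combo_pos s0 s1 (neg_pos.2 m0) (neg_pos.2 this)]
      · have m1 : 1 < m := by
          by_contra m1
          exact hm ⟨by linarith, by linarith⟩
        right
        refine ⟨m1, ?_⟩
        by_contra n0
        have : 1 < n := by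
          by_contra n1
          exact hn ⟨by linarith, by linarith⟩
        linarith [combo_pos s0 s1 (sub_pos.2 m1) (sub_pos.2 this)]
    have hne : n - m ≠ 0 := by
      rcases hmn with h | h
      · exact (by linarith [h.1, h.2] : (0 : ℝ) < n - m).ne'
      · exact (by linarith [h.1, h.2] : n - m < 0).ne
    refine mem_segment.2 ⟨-m / (n - m), ?_, ?_, ?_, ?_⟩
    · rcases hmn with h | h
      · exact div_nonneg (by linarith [h.1]) (by linarith [h.1, h.2])
      · exact div_nonneg_of_nonpos (by linarith [h.1]) (by linarith [h.1, h.2])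
    · rcases hmn with h | h
      · rw [div_le_one (by linarith [h.1, h.2])]; linarith [h.2]
      · rw [div_le_one_of_neg (by linarith [h.1, h.2])]; linarith [h.2]
    · rw [a1, b1]; field_simp; ring
    · rw [a2, b2]; field_simp; ring

/-- A proper crossing is an intersection. -/
theorem segments_cross {u f v g : ℝ × ℝ} (h : orient u f v * orient u f g < 0)
    (h' : orient v g u * orient v g f < 0) : ∃ x, x ∈ segment ℝ u f ∧ x ∈ segment ℝ v g := by
  have key : ∀ {a b : ℝ}, a * b < 0 → ∃ t, 0 ≤ t ∧ t ≤ 1 ∧ (1 - t) * a + t * b = 0 := by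
    intro a b hab
    rcases mul_neg_iff.1 hab with ⟨p, q⟩ | ⟨p, q⟩
    · exact ⟨a / (a - b), div_nonneg p.le (by linarith), (div_le_one (by linarith)).2 (by linarith),
        by have : a - b ≠ 0 := by linarith
           field_simp; ring⟩
    · exact ⟨a / (a - b), div_nonneg_of_nonpos p.le (by linarith),
        (div_le_one_of_neg (by linarith)).2 (by linarith),
        by have : a - b ≠ 0 := by linarith
           field_simp; ring⟩
  obtain ⟨t, t0, t1, ht⟩ := key h
  let x : ℝ × ℝ := ((1 - t) * v.1 + t * g.1, (1 - t) * v.2 + t * g.2)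
  have hx : orient u f x = 0 := by rw [orient_combo (x := x) (p := v) (q := g) rfl rfl, ht]
  have huf : u ≠ f := by
    rintro rfl
    simp [orient] at h
  obtain ⟨m, m1, m2⟩ := exists_param huf hx
  refine ⟨x, mem_segment.2 ⟨m, ?_, ?_, m1, m2⟩, mem_segment.2 ⟨t, t0, t1, rfl, rfl⟩⟩
  -- `orient v g` vanishes at `x` and has opposite signs at `u` and `f`, which forces the parameter
  -- `m` of `x` into the unit interval.
  all_goals
    have e := orient_combo (a := v) (b := g) m1 m2
    rw [orient_combo (x := x) (p := v) (q := g) rfl rfl] at e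
    simp only [orient_left, orient_right, mul_zero, add_zero] at e
    by_contra hm
    push Not at hm
    rcases mul_neg_iff.1 h' with ⟨p, q⟩ | ⟨p, q⟩ <;> nlinarith

end Plane

/-! ### Convex hulls in the plane -/

namespace Plane

theorem orient_swap_right (a b c : ℝ × ℝ) : orient a c b = -orient a b c := by
  unfold orient; ring

/-- If the determinant vanishes, the coordinate differences are themselves coefficients of affine
dependences. So they are zero, and `z 2 = z 0`. -/
theorem orient_ne_zero_of_affineIndependent {z : Fin 3 → ℝ × ℝ} (hz : AffineIndependent ℝ z) :
    orient (z 0) (z 1) (z 2) ≠ 0 := by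
  intro h
  have key : ∀ a b : ℝ, a * ((z 1).1 - (z 0).1) + b * ((z 2).1 - (z 0).1) = 0 →
      a * ((z 1).2 - (z 0).2) + b * ((z 2).2 - (z 0).2) = 0 → a = 0 ∧ b = 0 := by
    intro a b h1 h2
    rw [affineIndependent_iff] at hz
    have := hz Finset.univ ![-(a + b), a, b] (by simp [Fin.sum_univ_three]) (by
      simp only [Fin.sum_univ_three]
      apply Prod.ext
      · simp; linarith
      · simp; linarith)
    exact ⟨this 1 (by simp), this 2 (by simp)⟩
  unfold orient at h
  obtain ⟨h1, h2⟩ := key ((z 2).1 - (z 0).1) (-((z 1).1 - (z 0).1)) (by ring) (by linarith)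
  obtain ⟨h3, h4⟩ := key ((z 2).2 - (z 0).2) (-((z 1).2 - (z 0).2)) (by linarith) (by ring)
  have := hz.injective (Prod.ext (by linarith) (by linarith) : z 2 = z 0)
  exact absurd this (by decide)

/-- Carathéodory: `u` is a positive combination of affinely independent points of `S`, at most three
in the plane. One or two points give a segment. For three points the weights are proportional to the
orientations in which `u` replaces a vertex. Thus membership becomes a matter of signs. -/
theorem mem_convexHull_iff {S : Set (ℝ × ℝ)} {u : ℝ × ℝ} : u ∈ convexHull ℝ S ↔
    (∃ f ∈ S, ∃ g ∈ S, u ∈ segment ℝ f g) ∨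
      ∃ f ∈ S, ∃ g ∈ S, ∃ h ∈ S, 0 < orient u g h ∧ 0 < orient f u h ∧ 0 < orient f g u := by
  constructor
  · intro hu
    obtain ⟨ι, _, z, w, hzS, hz, hw, hw1, rfl⟩ := eq_pos_convex_span_of_mem_convexHull hu
    have hcard : Fintype.card ι ≤ 3 := by
      have := hz.card_le_finrank_succ
      have h2 := Submodule.finrank_le (vectorSpan ℝ (Set.range z))
      rw [show Module.finrank ℝ (ℝ × ℝ) = 2 by simp] at h2
      omega
    have hmem : ∀ i, z i ∈ S := fun i => hzS ⟨i, rfl⟩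
    obtain ⟨n, hn⟩ : ∃ n, Fintype.card ι = n := ⟨_, rfl⟩
    let e := Fintype.equivFinOfCardEq hn
    rw [← e.symm.sum_comp] at hw1
    have hsum : ∑ i, w i • z i = ∑ i, w (e.symm i) • z (e.symm i) :=
      (e.symm.sum_comp fun i => w i • z i).symm
    rw [hsum]
    have hn3 : n ≤ 3 := hn ▸ hcard
    clear_value e
    interval_cases n
    · simp at hw1
    · left
      simp only [Fin.sum_univ_one] at hw1 ⊢
      refine ⟨_, hmem (e.symm 0), _, hmem (e.symm 0), ?_⟩
      rw [hw1, one_smul, segment_same]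
      rfl
    · left
      simp only [Fin.sum_univ_two] at hw1 ⊢
      exact ⟨_, hmem (e.symm 0), _, hmem (e.symm 1), _, _, (hw _).le, (hw _).le, hw1, rfl⟩
    · right
      have ho := orient_ne_zero_of_affineIndependent (z := z ∘ e.symm)
        (hz.comp_embedding e.symm.toEmbedding)
      simp only [Fin.sum_univ_three, Function.comp] at hw1 ho ⊢
      have h0 := hw (e.symm 0)
      have h1 := hw (e.symm 1)
      have h2 := hw (e.symm 2)
      have m0 := hmem (e.symm 0)
      have m1 := hmem (e.symm 1)
      have m2 := hmem (e.symm 2)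
      generalize z (e.symm 0) = a at *
      generalize z (e.symm 1) = b at *
      generalize z (e.symm 2) = c at *
      generalize w (e.symm 0) = p at *
      generalize w (e.symm 1) = q at *
      generalize w (e.symm 2) = r at *
      obtain rfl : p = 1 - q - r := by linarith
      have e1 : orient ((1 - q - r) • a + q • b + r • c) b c = (1 - q - r) * orient a b c := by
        simp [orient]; ring
      have e2 : orient a ((1 - q - r) • a + q • b + r • c) c = q * orient a b c := by
        simp [orient]; ring
      have e3 : orient a b ((1 - q - r) • a + q • b + r • c) = r * orient a b c := by
        simp [orient]; ring
      rcases lt_or_gt_of_ne ho with ho | ho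
      -- A clockwise triangle is listed in the opposite order.
      · refine ⟨a, m0, c, m2, b, m1, ?_, ?_, ?_⟩
        · rw [orient_swap_right, e1]
          exact neg_pos.2 (mul_neg_of_pos_of_neg h0 ho)
        · rw [orient_swap_right, e3]
          exact neg_pos.2 (mul_neg_of_pos_of_neg h2 ho)
        · rw [orient_swap_right, e2]
          exact neg_pos.2 (mul_neg_of_pos_of_neg h1 ho)
      · exact ⟨a, m0, b, m1, c, m2, by rw [e1]; positivity, by rw [e2]; positivity,
          by rw [e3]; positivity⟩
  · rintro (⟨f, hf, g, hg, h⟩ | ⟨f, hf, g, hg, k, hk, h1, h2, h3⟩)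
    · exact segment_subset_convexHull hf hg h
    · have hs : orient u g k + orient f u k + orient f g u = orient f g k := by
        unfold orient; ring
      have hD : 0 < orient f g k := by linarith
      have : u = (orient u g k / orient f g k) • f + (orient f u k / orient f g k) • g +
          (orient f g u / orient f g k) • k := by
        apply Prod.ext
        · simp
          field_simp
          unfold orient
          ring
        · simp
          field_simp
          unfold orient
          ring
      rw [this]
      have := (convex_convexHull ℝ S).sum_mem (t := Finset.univ)
        (w := ![orient u g k / orient f g k, orient f u k / orient f g k,
          orient f g u / orient f g k]) (z := ![f, g, k])
        (fun i _ => by fin_cases i <;> simp <;> positivity)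
        (by simp [Fin.sum_univ_three]; field_simp; linarith)
        (fun i _ => subset_convexHull ℝ S (by fin_cases i <;> simpa))
      simpa [Fin.sum_univ_three] using this

/-- A supporting line of a convex hull at a point that is not a vertex contains two vertices. -/
theorem exists_pair_of_support {S : Set (ℝ × ℝ)} {u a b : ℝ × ℝ} {D : ℝ} (hD : D ≠ 0)
    (hab : a ≠ b)
    (hu : u ∈ convexHull ℝ S) (huS : u ∉ S) (h0 : orient a b u = 0)
    (hS : ∀ f ∈ S, D * orient a b f ≤ 0) :
    ∃ f ∈ S, ∃ g ∈ S, f ≠ g ∧ orient a b f = 0 ∧ orient a b g = 0 ∧ orient f g u = 0 := by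
  rcases mem_convexHull_iff.1 hu with ⟨f, hf, g, hg, h⟩ | ⟨f, hf, g, hg, k, hk, h1, h2, h3⟩
  · refine ⟨f, hf, g, hg, ?_, ?_⟩
    · rintro rfl
      rw [segment_same] at h
      exact huS (Set.mem_singleton_iff.1 h ▸ hf)
    · have hl := (mem_segment_iff.1 h).1
      obtain ⟨t, t0, t1, x1, x2⟩ := mem_segment.1 h
      have t0' : 0 < t := lt_of_le_of_ne t0 (by
        rintro rfl
        exact huS ((Prod.ext (by linarith) (by linarith) : u = f) ▸ hf))
      have t1' : t < 1 := lt_of_le_of_ne t1 (by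
        rintro rfl
        exact huS ((Prod.ext (by linarith) (by linarith) : u = g) ▸ hg))
      have e := orient_combo (a := a) (b := b) x1 x2
      rw [h0] at e
      have k1 := hS f hf
      have k2 := hS g hg
      have e' : 0 = (1 - t) * (D * orient a b f) + t * (D * orient a b g) := by
        linear_combination D * e
      have m1 := mul_nonneg (sub_nonneg.2 t1) (neg_nonneg.2 k1)
      have m2 := mul_nonneg t0 (neg_nonneg.2 k2)
      have n1 : (1 - t) * (D * orient a b f) = 0 := by linarith
      have n2 : t * (D * orient a b g) = 0 := by linarith
      have n1' := (mul_eq_zero.1 n1).resolve_left (by linarith)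
      have n2' := (mul_eq_zero.1 n2).resolve_left (by linarith)
      exact ⟨(mul_eq_zero.1 n1').resolve_left hD, (mul_eq_zero.1 n2').resolve_left hD, hl⟩
  -- If `u` is strictly inside a triangle, all three vertices must be on the supporting line, so the
  -- triangle is degenerate.
  · exfalso
    have hs : orient u g k + orient f u k + orient f g u = orient f g k := by
      unfold orient; ring
    have e : orient u g k * orient a b f + orient f u k * orient a b g +
        orient f g u * orient a b k = orient f g k * orient a b u := by
      unfold orient; ring
    rw [h0, mul_zero] at e
    have k1 := hS f hf
    have k2 := hS g hg
    have k3 := hS k hk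
    have e' : orient u g k * (D * orient a b f) + orient f u k * (D * orient a b g) +
        orient f g u * (D * orient a b k) = 0 := by linear_combination D * e
    have m1 := mul_nonneg h1.le (neg_nonneg.2 k1)
    have m2 := mul_nonneg h2.le (neg_nonneg.2 k2)
    have m3 := mul_nonneg h3.le (neg_nonneg.2 k3)
    have n1 : orient u g k * (D * orient a b f) = 0 := by linarith
    have n2 : orient f u k * (D * orient a b g) = 0 := by linarith
    have n3 : orient f g u * (D * orient a b k) = 0 := by linarith
    have o1 := (mul_eq_zero.1 ((mul_eq_zero.1 n1).resolve_left h1.ne')).resolve_left hD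
    have o2 := (mul_eq_zero.1 ((mul_eq_zero.1 n2).resolve_left h2.ne')).resolve_left hD
    have o3 := (mul_eq_zero.1 ((mul_eq_zero.1 n3).resolve_left h3.ne')).resolve_left hD
    obtain ⟨m, a1, a2⟩ := exists_param hab o1
    obtain ⟨n, b1, b2⟩ := exists_param hab o2
    obtain ⟨l, c1, c2⟩ := exists_param hab o3
    have : orient f g k = 0 := by unfold orient; rw [a1, a2, b1, b2, c1, c2]; ring
    linarith

end Plane

/-! ### Cells of the arrangement of lines through given points -/

namespace Plane

/-- Two reals have the same sign. -/
def SameSign (x y : ℝ) : Prop := (0 < x ↔ 0 < y) ∧ (x < 0 ↔ y < 0)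

theorem SameSign.eq_zero_iff {x y : ℝ} (h : SameSign x y) : x = 0 ↔ y = 0 := by
  constructor <;> intro e <;> apply le_antisymm <;> rw [← not_lt]
  · rw [← h.1]; exact e.not_gt
  · rw [← h.2]; exact e.not_lt
  · rw [h.1]; exact e.not_gt
  · rw [h.2]; exact e.not_lt

theorem SameSign.symm {x y : ℝ} (h : SameSign x y) : SameSign y x := ⟨h.1.symm, h.2.symm⟩

theorem SameSign.combo {x y t : ℝ} (h : SameSign x y) (h0 : 0 ≤ t) (h1 : t ≤ 1) :
    SameSign x ((1 - t) * x + t * y) := by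
  rcases lt_trichotomy x 0 with hx | hx | hx
  · have := combo_pos h0 h1 (neg_pos.2 hx) (neg_pos.2 (h.2.1 hx))
    exact ⟨iff_of_false (by linarith) (by linarith), iff_of_true hx (by linarith)⟩
  · have hy := h.eq_zero_iff.1 hx
    rw [hx, hy]
    simp [SameSign]
  · have := combo_pos h0 h1 hx (h.1.1 hx)
    exact ⟨iff_of_true hx (by linarith), iff_of_false (by linarith) (by linarith)⟩

theorem SameSign.mul_right {x y : ℝ} (h : SameSign x y) (a : ℝ) : SameSign (x * a) (y * a) := by
  simp only [SameSign, mul_pos_iff, mul_neg_iff, h.1, h.2, and_self]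

/-- `u` and `v` lie in the same cell of the arrangement of all lines through two points of `P`
and all horizontal and vertical lines through points of `P`. -/
structure SameCell (P : Set (ℝ × ℝ)) (u v : ℝ × ℝ) : Prop where
  orient : ∀ p ∈ P, ∀ q ∈ P, SameSign (orient p q u) (orient p q v)
  fst : ∀ p ∈ P, SameSign (u.1 - p.1) (v.1 - p.1)
  snd : ∀ p ∈ P, SameSign (u.2 - p.2) (v.2 - p.2)

namespace SameCell

variable {P : Set (ℝ × ℝ)} {u v : ℝ × ℝ}

theorem symm (h : SameCell P u v) : SameCell P v u :=
  ⟨fun p hp q hq => (h.orient p hp q hq).symm, fun p hp => (h.fst p hp).symm,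
    fun p hp => (h.snd p hp).symm⟩

/-- Cells are convex, so a straight motion between two points of a cell never leaves it. -/
theorem combo (h : SameCell P u v) {x : ℝ × ℝ} (hx : x ∈ segment ℝ u v) : SameCell P u x := by
  obtain ⟨t, h0, h1, x1, x2⟩ := mem_segment.1 hx
  refine ⟨fun p hp q hq => ?_, fun p hp => ?_, fun p hp => ?_⟩
  · rw [orient_combo x1 x2]
    exact (h.orient p hp q hq).combo h0 h1
  · rw [x1, show (1 - t) * u.1 + t * v.1 - p.1 = (1 - t) * (u.1 - p.1) + t * (v.1 - p.1) by ring]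
    exact (h.fst p hp).combo h0 h1
  · rw [x2, show (1 - t) * u.2 + t * v.2 - p.2 = (1 - t) * (u.2 - p.2) + t * (v.2 - p.2) by ring]
    exact (h.snd p hp).combo h0 h1

/-- A point of `P` is alone in its cell, because its horizontal and its vertical line meet only
there. -/
theorem notMem (h : SameCell P u v) (hu : u ∉ P) : v ∉ P := by
  intro hv
  apply hu
  have h1 := (h.fst v hv).eq_zero_iff.2 (sub_self _)
  have h2 := (h.snd v hv).eq_zero_iff.2 (sub_self _)
  rwa [show u = v from Prod.ext (by linarith) (by linarith)]

theorem mem_segment (h : SameCell P u v) {f g : ℝ × ℝ} (hf : f ∈ P) (hg : g ∈ P)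
    (hm : g ∈ segment ℝ u f) : g ∈ segment ℝ v f := by
  rw [mem_segment_iff] at hm ⊢
  refine ⟨?_, ?_, ?_⟩
  · rw [← orient_rotate]
    exact (h.orient f hf g hg).eq_zero_iff.1 (by rw [orient_rotate]; exact hm.1)
  · have := ((h.fst g hg).mul_right (g.1 - f.1)).2
    by_contra hn
    push Not at hn
    have := this.2 (by linarith)
    linarith [hm.2.1]
  · have := ((h.snd g hg).mul_right (g.2 - f.2)).2
    by_contra hn
    push Not at hn
    have := this.2 (by linarith)
    linarith [hm.2.2]

theorem mem_segment' (h : SameCell P u v) {f g : ℝ × ℝ} (hf : f ∈ P) (hg : g ∈ P)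
    (hm : u ∈ segment ℝ f g) : v ∈ segment ℝ f g := by
  rw [mem_segment_iff] at hm ⊢
  refine ⟨(h.orient f hf g hg).eq_zero_iff.1 hm.1, ?_, ?_⟩
  · have h1 := h.fst f hf
    have h2 := h.fst g hg
    by_contra hn
    push Not at hn
    rw [mul_pos_iff, ← h1.1, ← h2.1, ← h1.2, ← h2.2, ← mul_pos_iff] at hn
    linarith [hm.2.1]
  · have h1 := h.snd f hf
    have h2 := h.snd g hg
    by_contra hn
    push Not at hn
    rw [mul_pos_iff, ← h1.1, ← h2.1, ← h1.2, ← h2.2, ← mul_pos_iff] at hn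
    linarith [hm.2.2]

theorem mem_convexHull (h : SameCell P u v) {S : Set (ℝ × ℝ)} (hS : S ⊆ P)
    (hu : u ∈ convexHull ℝ S) : v ∈ convexHull ℝ S := by
  rw [mem_convexHull_iff] at hu ⊢
  rcases hu with ⟨f, hf, g, hg, hu⟩ | ⟨f, hf, g, hg, k, hk, h1, h2, h3⟩
  · exact .inl ⟨f, hf, g, hg, h.mem_segment' (hS hf) (hS hg) hu⟩
  · refine .inr ⟨f, hf, g, hg, k, hk, ?_, ?_, ?_⟩
    · rw [← orient_rotate] at h1 ⊢
      exact (h.orient g (hS hg) k (hS hk)).1.1 h1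
    · rw [← orient_rotate, ← orient_rotate] at h2 ⊢
      exact (h.orient k (hS hk) f (hS hf)).1.1 h2
    · exact (h.orient f (hS hf) g (hS hg)).1.1 h3

theorem notMem_segment (h : SameCell P u v) (hu : u ∉ P) {f : ℝ × ℝ} (hf : f ∈ P) :
    f ∉ segment ℝ u v := fun hm => (h.combo hm).notMem hu hf

end SameCell

/-- The conditions on a single mobile vertex at `u` with neighbours at `N`, if the fixed vertices
are at `P`. -/
structure IsStar (P N : Set (ℝ × ℝ)) (u : ℝ × ℝ) : Prop where
  notMem : u ∉ P
  edge : ∀ f ∈ N, ∀ h ∈ P, h ∈ segment ℝ u f → h = f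
  hull : u ∈ convexHull ℝ N

theorem IsStar.of_sameCell {P N : Set (ℝ × ℝ)} {u v : ℝ × ℝ} (hu : IsStar P N u) (hN : N ⊆ P)
    (h : SameCell P u v) : IsStar P N v :=
  ⟨h.notMem hu.notMem, fun f hf g hg hm => hu.edge f hf g hg (h.symm.mem_segment (hN hf) hg hm),
    h.mem_convexHull hN hu.hull⟩

theorem IsStar.nonempty {P N : Set (ℝ × ℝ)} {u : ℝ × ℝ} (hu : IsStar P N u) : N.Nonempty :=
  convexHull_nonempty_iff.1 ⟨u, hu.hull⟩

/-- The edges from `u` to `N` and the edges from `v` to `N'` meet only in common endpoints. -/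
def Apart (N N' : Set (ℝ × ℝ)) (u v : ℝ × ℝ) : Prop :=
  ∀ f ∈ N, ∀ g ∈ N', ∀ x, x ∈ segment ℝ u f → x ∈ segment ℝ v g → x = f ∧ x = g

theorem Apart.symm {N N' : Set (ℝ × ℝ)} {u v : ℝ × ℝ} (h : Apart N N' u v) : Apart N' N v u :=
  fun g hg f hf x hx hx' => (h f hf g hg x hx' hx).symm

/-- The point `x` puts `u` and `v` on one ray from `f`, and the one nearer to `f` is on the segment
of the other. -/
theorem mem_or_mem_of_ray {u v f x : ℝ × ℝ} (hx : x ∈ segment ℝ u f) (hx' : x ∈ segment ℝ v f)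
    (hne : x ≠ f) : v ∈ segment ℝ u f ∨ u ∈ segment ℝ v f := by
  obtain ⟨s, s0, s1, x1, x2⟩ := mem_segment.1 hx
  obtain ⟨r, r0, r1, y1, y2⟩ := mem_segment.1 hx'
  have hs : s < 1 := lt_of_le_of_ne s1 (by
    rintro rfl; exact hne (Prod.ext (by linarith) (by linarith)))
  have hr : r < 1 := lt_of_le_of_ne r1 (by
    rintro rfl; exact hne (Prod.ext (by linarith) (by linarith)))
  have e1 := x1.symm.trans y1
  have e2 := x2.symm.trans y2
  rcases le_total r s with h | h
  · left
    have : 1 - r ≠ 0 := by linarith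
    refine mem_segment.2 ⟨1 - (1 - s) / (1 - r), ?_, ?_, ?_, ?_⟩
    · rw [sub_nonneg, div_le_one (by linarith)]; linarith
    · have : 0 ≤ (1 - s) / (1 - r) := div_nonneg (by linarith) (by linarith)
      linarith
    · field_simp; linarith
    · field_simp; linarith
  · right
    have : 1 - s ≠ 0 := by linarith
    refine mem_segment.2 ⟨1 - (1 - r) / (1 - s), ?_, ?_, ?_, ?_⟩
    · rw [sub_nonneg, div_le_one (by linarith)]; linarith
    · have : 0 ≤ (1 - r) / (1 - s) := div_nonneg (by linarith) (by linarith)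
      linarith
    · field_simp; linarith
    · field_simp; linarith

/-- Positive numbers stay nonnegative after a small step towards arbitrary values. This is how a
point is moved slightly without violating two constraints on its weights. -/
theorem exists_small {a b p q : ℝ} (ha : 0 < a) (hb : 0 < b) :
    ∃ ε, 0 < ε ∧ ε ≤ 1 ∧ 0 ≤ (1 - ε) * a + ε * p ∧ 0 ≤ (1 - ε) * b + ε * q := by
  have hm : 0 < min a b := lt_min ha hb
  have hd : 0 < min a b + |p| + |q| := by positivity
  refine ⟨min a b / (min a b + |p| + |q|), by positivity, ?_, ?_, ?_⟩
  · rw [div_le_one hd]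
    linarith [abs_nonneg p, abs_nonneg q]
  · have : (1 - min a b / (min a b + |p| + |q|)) * a + min a b / (min a b + |p| + |q|) * p =
        ((|p| + |q|) * a + min a b * p) / (min a b + |p| + |q|) := by field_simp; ring
    rw [this]
    refine div_nonneg ?_ hd.le
    nlinarith [neg_abs_le p, abs_nonneg p, abs_nonneg q, min_le_left a b,
      mul_nonneg (abs_nonneg q) ha.le, mul_nonneg (abs_nonneg p) (sub_nonneg.2 (min_le_left a b)),
      mul_nonneg hm.le (by linarith [neg_abs_le p] : 0 ≤ p + |p|)]
  · have : (1 - min a b / (min a b + |p| + |q|)) * b + min a b / (min a b + |p| + |q|) * q =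
        ((|p| + |q|) * b + min a b * q) / (min a b + |p| + |q|) := by field_simp; ring
    rw [this]
    refine div_nonneg ?_ hd.le
    nlinarith [neg_abs_le q, abs_nonneg p, abs_nonneg q, min_le_right a b,
      mul_nonneg (abs_nonneg p) hb.le, mul_nonneg (abs_nonneg q) (sub_nonneg.2 (min_le_right a b)),
      mul_nonneg hm.le (by linarith [neg_abs_le q] : 0 ≤ q + |q|)]

/-- The points of the form `α u + β w + γ f` with `β > 0`, in the triangle `uwf`. -/
def Swept (w u f z : ℝ × ℝ) : Prop :=
  ∃ α β γ : ℝ, 0 ≤ α ∧ 0 < β ∧ 0 ≤ γ ∧ α + β + γ = 1 ∧ z.1 = α * u.1 + β * w.1 + γ * f.1 ∧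
    z.2 = α * u.2 + β * w.2 + γ * f.2

/-- The triangle is flat. In the coordinate with `f` at 0 and `u` at 1, the point `w` is at some `k
> 0`, since `f` is not between `w` and `u`. So `x` is between `f` and `w` or between `w` and `u`,
and `w` has positive weight in both cases. -/
theorem swept_of_collinear {w u f x : ℝ × ℝ} (h : orient u f w = 0) (huf : u ≠ f)
    (hf : f ∉ segment ℝ w u) (hx : x ∈ segment ℝ u f) (hxu : x ≠ u) (hxf : x ≠ f) :
    Swept w u f x := by
  obtain ⟨k, k1, k2⟩ := exists_param huf.symm (by rw [orient_swap, h, neg_zero] : orient f u w = 0)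
  obtain ⟨r, r0, r1, x1, x2⟩ := mem_segment.1 hx
  have hr0 : 0 < r := lt_of_le_of_ne r0 (by
    rintro rfl; exact hxu (Prod.ext (by linarith) (by linarith)))
  have hr1 : r < 1 := lt_of_le_of_ne r1 (by
    rintro rfl; exact hxf (Prod.ext (by linarith) (by linarith)))
  have hk : 0 < k := by
    by_contra hk
    push Not at hk
    have : 1 - k ≠ 0 := by linarith
    refine hf (mem_segment.2 ⟨-k / (1 - k), div_nonneg (by linarith) (by linarith),
      (div_le_one (by linarith)).2 (by linarith), ?_, ?_⟩)
    · rw [k1]; field_simp; ring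
    · rw [k2]; field_simp; ring
  by_cases hrk : 1 - r ≤ k
  · refine ⟨0, (1 - r) / k, 1 - (1 - r) / k, le_rfl, div_pos (by linarith) hk, ?_, by ring, ?_, ?_⟩
    · rw [sub_nonneg, div_le_one hk]; exact hrk
    · rw [x1, k1]; field_simp; ring
    · rw [x2, k2]; field_simp; ring
  · push Not at hrk
    have : 1 - k ≠ 0 := by linarith
    refine ⟨1 - r / (1 - k), r / (1 - k), 0, ?_, div_pos hr0 (by linarith), le_rfl, by ring, ?_, ?_⟩
    · rw [sub_nonneg, div_le_one (by linarith)]; linarith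
    · rw [x1, k1]; field_simp; ring
    · rw [x2, k2]; field_simp; ring

/-- Near an interior point of the side `uf` of the triangle `uwf`, the segments to the side of `w`
run inside the triangle. -/
theorem exists_swept_near {w u f x y : ℝ × ℝ} (hx : x ∈ segment ℝ u f) (hxu : x ≠ u) (hxf : x ≠ f)
    (hy : 0 < orient u f w * orient u f y) : ∃ z ∈ segment ℝ x y, Swept w u f z := by
  obtain ⟨r, r0, r1, x1, x2⟩ := mem_segment.1 hx
  have hr0 : 0 < r := lt_of_le_of_ne r0 (by
    rintro rfl; exact hxu (Prod.ext (by linarith) (by linarith)))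
  have hr1 : r < 1 := lt_of_le_of_ne r1 (by
    rintro rfl; exact hxf (Prod.ext (by linarith) (by linarith)))
  have hD : orient u f w ≠ 0 := fun h => by rw [h, zero_mul] at hy; exact hy.false
  -- `b` and `c` are the barycentric coordinates of `y` at `w` and `f`. The first is positive since
  -- `y` is on the side of `w`.
  let b := orient u f y / orient u f w
  have hb : 0 < b := by
    have : b = orient u f w * orient u f y / (orient u f w) ^ 2 := by
      simp only [b]; field_simp
    rw [this]; positivity
  let c := orient u y w / orient u f w
  have hy1 : y.1 = (1 - b - c) * u.1 + b * w.1 + c * f.1 := by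
    simp only [b, c]
    field_simp
    unfold orient
    ring
  have hy2 : y.2 = (1 - b - c) * u.2 + b * w.2 + c * f.2 := by
    simp only [b, c]
    field_simp
    unfold orient
    ring
  -- The weights of `x` at `u` and `f` are positive and survive a small step towards `y`, which
  -- gives `w` the positive weight `ε * b`.
  obtain ⟨ε, e0, e1, h1, h2⟩ := exists_small (p := 1 - b - c) (q := c) (sub_pos.2 hr1) hr0
  refine ⟨((1 - ε) * x.1 + ε * y.1, (1 - ε) * x.2 + ε * y.2),
    mem_segment.2 ⟨ε, e0.le, e1, rfl, rfl⟩, _, ε * b, _, h1, mul_pos e0 hb, h2, by ring, ?_, ?_⟩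
  · simp only; rw [hy1, x1]; ring
  · simp only; rw [hy2, x2]; ring

end Plane

/-! ### Moving a mobile vertex inside its cell -/

namespace Plane

variable {P N N' : Set (ℝ × ℝ)} {w u v : ℝ × ℝ}

theorem segment_subset_of_mem {x y v g : ℝ × ℝ} (hx : x ∈ segment ℝ v g) (hy : y ∈ segment ℝ v g) :
    segment ℝ x y ⊆ segment ℝ v g := (convex_segment v g).segment_subset hx hy

theorem collinear_of_pair {f g a b : ℝ × ℝ} (hfg : f ≠ g) (ha : orient f g a = 0)
    (hb : orient f g b = 0) : orient a f b = 0 := by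
  obtain ⟨m, m1, m2⟩ := exists_param hfg ha
  obtain ⟨n, n1, n2⟩ := exists_param hfg hb
  unfold orient
  rw [m1, m2, n1, n2]
  ring

theorem collinear_trans {a b f g x : ℝ × ℝ} (hab : a ≠ b) (hfg : f ≠ g) (hf : orient a b f = 0)
    (hg : orient a b g = 0) (hx : orient f g x = 0) : orient a b x = 0 := by
  obtain ⟨m, m1, m2⟩ := exists_param hab hf
  obtain ⟨n, n1, n2⟩ := exists_param hab hg
  obtain ⟨k, k1, k2⟩ := exists_param hfg hx
  unfold orient
  rw [k1, k2, m1, m2, n1, n2]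
  ring

/-- No edge of a moved star passes over the center of the other star. -/
theorem center_notMem_edge (hN : N ⊆ P) (hN' : N' ⊆ P) (hw : IsStar P N w) (hv : IsStar P N' v)
    (hc : SameCell P w u) (H : ∀ f ∈ N, ∀ g ∈ N', ∀ z, Swept w u f z → z ∉ segment ℝ v g)
    {f : ℝ × ℝ} (hf : f ∈ N) (hvu : v ≠ u) : v ∉ segment ℝ u f := by
  intro hm
  obtain ⟨g, hg⟩ := hv.nonempty
  have huf : u ≠ f := fun h => hc.notMem hw.notMem (h ▸ hN hf)
  have hvf : v ≠ f := fun h => hv.notMem (h ▸ hN hf)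
  by_cases h0 : orient u f w = 0
  · refine H f hf g hg v (swept_of_collinear h0 huf ?_ hm hvu hvf) (left_mem_segment _ _ _)
    exact hc.notMem_segment hw.notMem (hN hf)
  -- An edge from `v` to the side of `w` would enter the swept triangle near `v`. So no neighbour of
  -- `v` is on that side, and the hull condition puts two of them on the line `uf`.
  · have hside : ∀ g ∈ N', orient u f w * orient u f g ≤ 0 := by
      intro g hg
      by_contra hn
      push Not at hn
      obtain ⟨z, hz, hs⟩ := exists_swept_near hm hvu hvf hn
      exact H f hf g hg z hs hz
    obtain ⟨g₁, hg₁, g₂, hg₂, hne, e₁, e₂, -⟩ := exists_pair_of_support h0 huf hv.hull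
      (fun h => hv.notMem (hN' h)) (mem_segment_iff.1 hm).1 hside
    obtain ⟨g, hg, hgf, e⟩ : ∃ g ∈ N', g ≠ f ∧ orient u f g = 0 := by
      by_cases h : g₁ = f
      · exact ⟨g₂, hg₂, fun h' => hne (h.trans h'.symm), e₂⟩
      · exact ⟨g₁, hg₁, h, e₁⟩
    -- The line `fg` belongs to the arrangement and contains `u`, hence also `w`.
    have k : orient f g u = 0 := by rw [orient_rotate]; exact e
    exact h0 (collinear_of_pair hgf.symm k ((hc.orient f (hN hf) g (hN' hg)).eq_zero_iff.2 k))

/-- The center of a moved star does not pass over the edges of the other star. -/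
theorem moved_notMem_edge (hN : N ⊆ P) (hN' : N' ⊆ P) (hw : IsStar P N w) (hv : IsStar P N' v)
    (hc : SameCell P w u) (H : ∀ f ∈ N, ∀ g ∈ N', ∀ z, Swept w u f z → z ∉ segment ℝ v g)
    {g : ℝ × ℝ} (hg : g ∈ N') (hvu : v ≠ u) : u ∉ segment ℝ v g := by
  intro hm
  obtain ⟨f, hf⟩ := hw.nonempty
  have hug : u ≠ g := fun h => hc.notMem hw.notMem (h ▸ hN' hg)
  have hvg : v ≠ g := fun h => hv.notMem (h ▸ hN' hg)
  obtain ⟨r, r0, r1, x1, x2⟩ := mem_segment.1 hm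
  have hr0 : 0 < r := lt_of_le_of_ne r0 (by
    rintro rfl; exact hvu (Prod.ext (by linarith) (by linarith)))
  have hr1 : r < 1 := lt_of_le_of_ne r1 (by
    rintro rfl; exact hug (Prod.ext (by linarith) (by linarith)))
  by_cases h0 : orient v g w = 0
  -- All on one line, with `v` at 0 and `g` at 1. If `w` at `k` is on the edge, it is itself a swept
  -- point; if `k > 1`, then `g` is on the path from `w` to `u`; if `k < 0`, then `v` is on that
  -- path and is swept.
  · obtain ⟨k, k1, k2⟩ := exists_param hvg h0
    have hk : k < 0 := by
      by_contra hk
      push Not at hk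
      by_cases hk1 : k ≤ 1
      · have hwg : w ≠ g := fun h => hw.notMem (h ▸ hN' hg)
        refine H f hf g hg w ⟨0, 1, 0, le_rfl, one_pos, le_rfl, by ring, by ring, by ring⟩ ?_
        exact mem_segment.2 ⟨k, hk, hk1, k1, k2⟩
      · push Not at hk1
        refine hc.notMem_segment hw.notMem (hN' hg) ?_
        have : k - r ≠ 0 := by linarith
        refine mem_segment.2 ⟨(k - 1) / (k - r), div_nonneg (by linarith) (by linarith),
          (div_le_one (by linarith)).2 (by linarith), ?_, ?_⟩
        · rw [x1, k1]; field_simp; ring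
        · rw [x2, k2]; field_simp; ring
    have : r - k ≠ 0 := by linarith
    refine H f hf g hg v ⟨1 - r / (r - k), r / (r - k), 0, ?_, div_pos hr0 (by linarith), le_rfl,
      by ring, ?_, ?_⟩ (left_mem_segment _ _ _)
    · rw [sub_nonneg, div_le_one (by linarith)]; linarith
    · rw [x1, k1]; field_simp; ring
    · rw [x2, k2]; field_simp; ring
  -- The neighbours of the moved star cannot be on the side opposite to `w`: otherwise `wf` meets
  -- the line `vg` in a point `y`, and a small step from `u` towards `y` gives a swept point on the
  -- edge `vg`.
  · have hside : ∀ f ∈ N, -orient v g w * orient v g f ≤ 0 := by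
      intro f hf
      by_contra hn
      push Not at hn
      have hd : orient v g w - orient v g f ≠ 0 := by
        intro h
        have : orient v g w = orient v g f := by linarith
        rw [this] at hn
        nlinarith [mul_self_nonneg (orient v g f)]
      let t := orient v g w / (orient v g w - orient v g f)
      have ht1 : 1 - t = -orient v g f / (orient v g w - orient v g f) := by
        simp only [t]; field_simp; ring
      have hsq : 0 < (orient v g w - orient v g f) ^ 2 := by positivity
      have ht : 0 ≤ t := by
        have : t = (orient v g w ^ 2 + -orient v g w * orient v g f) /
            (orient v g w - orient v g f) ^ 2 := by
          simp only [t]; field_simp; ring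
        rw [this]
        exact div_nonneg (by positivity) hsq.le
      have ht' : 0 < 1 - t := by
        have hf0 : orient v g f ≠ 0 := fun h => by rw [h, mul_zero] at hn; exact hn.false
        have : 1 - t = (orient v g f ^ 2 + -orient v g w * orient v g f) /
            (orient v g w - orient v g f) ^ 2 := by
          rw [ht1]; field_simp; ring
        rw [this]
        exact div_pos (by positivity) hsq
      let y : ℝ × ℝ := ((1 - t) * w.1 + t * f.1, (1 - t) * w.2 + t * f.2)
      have hy : orient v g y = 0 := by
        rw [orient_combo (x := y) (p := w) (q := f) rfl rfl, ht1]
        simp only [t]; field_simp; ring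
      obtain ⟨m, m1, m2⟩ := exists_param hvg hy
      obtain ⟨ε, e0, e1, h1, h2⟩ := exists_small (p := m) (q := 1 - m) hr0 (sub_pos.2 hr1)
      refine H f hf g hg ((1 - ε) * u.1 + ε * y.1, (1 - ε) * u.2 + ε * y.2)
        ⟨1 - ε, ε * (1 - t), ε * t, by linarith, by positivity, by positivity, by ring, ?_, ?_⟩ ?_
      · simp only [y]; ring
      · simp only [y]; ring
      · refine mem_segment.2 ⟨(1 - ε) * r + ε * m, h1, by linarith, ?_, ?_⟩
        · simp only; rw [m1, x1]; ring
        · simp only; rw [m2, x2]; ring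
    -- By the hull condition at `u`, two neighbours are on the line `vg`. So it is a line of the
    -- arrangement through `u`, and it contains `w`.
    obtain ⟨f₁, hf₁, f₂, hf₂, hne, e₁, e₂, e₃⟩ := exists_pair_of_support (neg_ne_zero.2 h0) hvg
      (hc.mem_convexHull hN hw.hull) (fun h => hc.notMem hw.notMem (hN h)) (mem_segment_iff.1 hm).1
      hside
    exact h0 (collinear_trans hvg hne e₁ e₂
      ((hc.orient f₁ (hN hf₁) f₂ (hN hf₂)).eq_zero_iff.2 e₃))

/-- The centers of two stars do not collide. -/
theorem moved_ne_center (hN : N ⊆ P) (hN' : N' ⊆ P) (hw : IsStar P N w) (hv : IsStar P N' v)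
    (hc : SameCell P w u) (H : ∀ f ∈ N, ∀ g ∈ N', ∀ z, Swept w u f z → z ∉ segment ℝ v g) :
    v ≠ u := by
  rintro rfl
  obtain ⟨g₀, hg₀⟩ := hv.nonempty
  -- An edge at `v` whose direction is in the cone of `w` and `f`, with a positive share of `w`,
  -- starts inside the swept triangle.
  have hcone : ∀ f ∈ N, ∀ g ∈ N', ∀ l m : ℝ, 0 < l → 0 ≤ m →
      g.1 - v.1 = l * (w.1 - v.1) + m * (f.1 - v.1) →
      g.2 - v.2 = l * (w.2 - v.2) + m * (f.2 - v.2) → False := by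
    intro f hf g hg l m hl hm h1 h2
    have hs : 0 < 1 + l + m := by linarith
    refine H f hf g hg (v.1 + (1 / (1 + l + m)) * (g.1 - v.1), v.2 + (1 / (1 + l + m)) * (g.2 - v.2))
      ⟨1 / (1 + l + m), l / (1 + l + m), m / (1 + l + m), by positivity, by positivity,
        by positivity, by field_simp, ?_, ?_⟩ (mem_segment.2 ⟨1 / (1 + l + m), by positivity,
        (div_le_one hs).2 (by linarith), by simp only; ring, by simp only; ring⟩)
    · simp only; rw [h1]; field_simp; ring
    · simp only; rw [h2]; field_simp; ring
  -- If `f` were exactly opposite to `w`, then `v` would be on the edge `wf` of the unmoved star.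
  have hray : ∀ f ∈ N, ∀ k : ℝ, 0 < k → v.1 - w.1 = k * (f.1 - v.1) → v.2 - w.2 = k * (f.2 - v.2) →
      False := by
    intro f hf k hk h1 h2
    refine H f hf g₀ hg₀ v ⟨0, 1 / (1 + k), k / (1 + k), le_rfl, by positivity, by positivity,
      by field_simp; ring, ?_, ?_⟩ (left_mem_segment _ _ _)
    · field_simp; linarith
    · field_simp; linarith
  have hvN : v ∈ convexHull ℝ N := hc.mem_convexHull hN hw.hull
  have hne : w ≠ v := by
    rintro rfl
    obtain ⟨f, hf⟩ := hw.nonempty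
    exact H f hf g₀ hg₀ w ⟨0, 1, 0, le_rfl, one_pos, le_rfl, by ring, by ring, by ring⟩
      (left_mem_segment _ _ _)
  -- Suppose the direction opposite to `w` is in the cone of two neighbours `a`, `b`. The cones of
  -- `w` and `a` and of `w` and `b` cover the rest of the plane, so by `hcone` all neighbours of `v`
  -- are in the cone of `a` and `b`. There a linear form is positive, which contradicts the hull
  -- condition at `v`.
  have key : ∀ a ∈ N, ∀ b ∈ N, 0 < orient v a b → 0 ≤ orient v w a → orient v w b ≤ 0 → False := by
    intro a ha b hb hab hwa hwb
    have hx1 : v.1 - w.1 = (-orient v w b / orient v a b) * (a.1 - v.1) +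
        (orient v w a / orient v a b) * (b.1 - v.1) := by
      field_simp; unfold orient; ring
    have hx2 : v.2 - w.2 = (-orient v w b / orient v a b) * (a.2 - v.2) +
        (orient v w a / orient v a b) * (b.2 - v.2) := by
      field_simp; unfold orient; ring
    have hx : 0 ≤ -orient v w b / orient v a b := div_nonneg (by linarith) hab.le
    have hy : 0 ≤ orient v w a / orient v a b := div_nonneg hwa hab.le
    generalize -orient v w b / orient v a b = x at *
    generalize orient v w a / orient v a b = y at *
    rcases eq_or_lt_of_le hx with rfl | hx
    · rcases eq_or_lt_of_le hy with rfl | hy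
      · exact hne (Prod.ext (by linarith) (by linarith))
      · exact hray b hb y hy (by linarith) (by linarith)
    rcases eq_or_lt_of_le hy with rfl | hy
    · exact hray a ha x hx (by linarith) (by linarith)
    have hpos : ∀ g ∈ N', 0 < orient v g b + orient v a g := by
      intro g hg
      have hg1 : g.1 - v.1 = (orient v g b / orient v a b) * (a.1 - v.1) +
          (orient v a g / orient v a b) * (b.1 - v.1) := by
        field_simp; unfold orient; ring
      have hg2 : g.2 - v.2 = (orient v g b / orient v a b) * (a.2 - v.2) +
          (orient v a g / orient v a b) * (b.2 - v.2) := by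
        field_simp; unfold orient; ring
      have hsum : orient v g b + orient v a g = orient v a b *
          (orient v g b / orient v a b + orient v a g / orient v a b) := by
        field_simp
      rw [hsum]
      refine mul_pos hab ?_
      generalize orient v g b / orient v a b = p at *
      generalize orient v a g / orient v a b = q at *
      -- In the basis `a - v`, `b - v`, the vector to `g` has coordinates `(p, q)` and the vector to
      -- `w` has `(-x, -y)`.
      have hp : ¬(p < 0 ∧ p * y ≤ q * x) := by
        rintro ⟨hp, hpq⟩
        refine hcone b hb g hg (-p / x) (q - p * y / x) (div_pos (by linarith) hx) ?_ ?_ ?_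
        · rw [sub_nonneg, div_le_iff₀ hx]; exact hpq
        · have : w.1 - v.1 = -(x * (a.1 - v.1) + y * (b.1 - v.1)) := by linarith
          rw [hg1, this]; field_simp; ring
        · have : w.2 - v.2 = -(x * (a.2 - v.2) + y * (b.2 - v.2)) := by linarith
          rw [hg2, this]; field_simp; ring
      have hq : ¬(q < 0 ∧ q * x ≤ p * y) := by
        rintro ⟨hq, hpq⟩
        refine hcone a ha g hg (-q / y) (p - q * x / y) (div_pos (by linarith) hy) ?_ ?_ ?_
        · rw [sub_nonneg, div_le_iff₀ hy]; exact hpq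
        · have : w.1 - v.1 = -(x * (a.1 - v.1) + y * (b.1 - v.1)) := by linarith
          rw [hg1, this]; field_simp; ring
        · have : w.2 - v.2 = -(x * (a.2 - v.2) + y * (b.2 - v.2)) := by linarith
          rw [hg2, this]; field_simp; ring
      have hp0 : 0 ≤ p := by
        by_contra hp0
        push Not at hp0
        rcases le_total (p * y) (q * x) with h | h
        · exact hp ⟨hp0, h⟩
        · refine hq ⟨?_, h⟩
          by_contra hq0
          push Not at hq0
          nlinarith [mul_pos (neg_pos.2 hp0) hy, mul_nonneg hq0 hx.le]
      have hq0 : 0 ≤ q := by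
        by_contra hq0
        push Not at hq0
        rcases le_total (q * x) (p * y) with h | h
        · exact hq ⟨hq0, h⟩
        · nlinarith [mul_pos (neg_pos.2 hq0) hx, mul_nonneg hp0 hy.le]
      rcases eq_or_lt_of_le hp0 with rfl | hp0
      · rcases eq_or_lt_of_le hq0 with rfl | hq0
        · exfalso
          exact hv.notMem (hN' ((Prod.ext (by linarith) (by linarith) : g = v) ▸ hg))
        · linarith
      · linarith
    have hconv : Convex ℝ {g : ℝ × ℝ | 0 < orient v g b + orient v a g} := by
      intro g hg g' hg' s t hs ht hst
      have e : orient v (s • g + t • g') b + orient v a (s • g + t • g') =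
          (1 - t) * (orient v g b + orient v a g) + t * (orient v g' b + orient v a g') := by
        obtain rfl : s = 1 - t := by linarith
        simp [orient]; ring
      have h : 0 < orient v (s • g + t • g') b + orient v a (s • g + t • g') := by
        rw [e]
        exact combo_pos ht (by linarith) hg hg'
      exact h
    have h : 0 < orient v v b + orient v a v :=
      convexHull_min (fun g hg => hpos g hg) hconv hv.hull
    simp [orient] at h
  rcases mem_convexHull_iff.1 hvN with ⟨f, hf, g, hg, h⟩ | ⟨f, hf, g, hg, k, hk, h1, h2, h3⟩
  · have hfg : f ≠ g := by
      rintro rfl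
      rw [segment_same] at h
      exact hv.notMem (hN (Set.mem_singleton_iff.1 h ▸ hf))
    have hl := (mem_segment_iff.1 h).1
    -- The line `fg` contains `v`, hence also `w`. As `v` is strictly between `f` and `g`, one of
    -- them is opposite to `w`.
    obtain ⟨m, m1, m2⟩ := exists_param hfg ((hc.orient f (hN hf) g (hN hg)).eq_zero_iff.2 hl)
    obtain ⟨t, t0, t1, x1, x2⟩ := mem_segment.1 h
    have t0' : 0 < t := lt_of_le_of_ne t0 (by
      rintro rfl
      exact hv.notMem (hN ((Prod.ext (by linarith) (by linarith) : v = f) ▸ hf)))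
    have t1' : t < 1 := lt_of_le_of_ne t1 (by
      rintro rfl
      exact hv.notMem (hN ((Prod.ext (by linarith) (by linarith) : v = g) ▸ hg)))
    rcases lt_trichotomy m t with hm | hm | hm
    · have : 1 - t ≠ 0 := by linarith
      refine hray g hg ((t - m) / (1 - t)) (div_pos (by linarith) (by linarith)) ?_ ?_
      · rw [x1, m1]; field_simp; ring
      · rw [x2, m2]; field_simp; ring
    · exact hne (Prod.ext (by rw [x1, m1, hm]) (by rw [x2, m2, hm]))
    · refine hray f hf ((m - t) / t) (div_pos (by linarith) t0') ?_ ?_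
      · rw [x1, m1]; field_simp; ring
      · rw [x2, m2]; field_simp; ring
  · have e : orient v g k * orient v w f + orient f v k * orient v w g +
        orient f g v * orient v w k = 0 := by
      unfold orient; ring
    have h2' : 0 < orient v k f := by rwa [orient_rotate]
    have h3' : 0 < orient v f g := by rwa [orient_rotate, orient_rotate]
    have kfg := key f hf g hg h3'
    have kgk := key g hg k hk h1
    have kkf := key k hk f hf h2'
    -- By `key`, in the cyclic order `f`, `g`, `k` a nonnegative sign of `orient v w` is followed by
    -- a positive one. So all three signs agree and are nonzero, which contradicts `e`.
    have pos_or : (0 < orient v w f ∧ 0 < orient v w g ∧ 0 < orient v w k) ∨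
        (orient v w f < 0 ∧ orient v w g < 0 ∧ orient v w k < 0) := by
      grind
    rcases pos_or with ⟨a, b, c⟩ | ⟨a, b, c⟩
    · linarith [mul_pos h1 a, mul_pos h2 b, mul_pos h3 c]
    · linarith [mul_neg_of_pos_of_neg h1 a, mul_neg_of_pos_of_neg h2 b,
        mul_neg_of_pos_of_neg h3 c]

/-- Apart from centres on edges and fixed vertices inside edges, only a proper crossing remains.
There one end of `vg` is on the side of `w`, unless `w` is on the line `uf`, so `vg` runs inside the
swept triangle near the crossing. -/
theorem apart_of_not_swept (hN : N ⊆ P) (hN' : N' ⊆ P) (hw : IsStar P N w) (hv : IsStar P N' v)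
    (hc : SameCell P w u) (H : ∀ f ∈ N, ∀ g ∈ N', ∀ z, Swept w u f z → z ∉ segment ℝ v g) :
    Apart N N' u v := by
  have hvu := moved_ne_center hN hN' hw hv hc H
  have hu := hw.of_sameCell hN hc
  intro f hf g hg x hx hx'
  by_contra hne
  by_cases hfg : f = g
  · subst hfg
    rcases mem_or_mem_of_ray hx hx' (fun h => hne ⟨h, h⟩) with h | h
    · exact center_notMem_edge hN hN' hw hv hc H hf hvu h
    · exact moved_notMem_edge hN hN' hw hv hc H hg hvu h
  · rcases segments_meet hx hx' with h | h | h | h | ⟨h, h'⟩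
    · exact moved_notMem_edge hN hN' hw hv hc H hg hvu h
    · exact hfg (hv.edge g hg f (hN hf) h)
    · exact center_notMem_edge hN hN' hw hv hc H hf hvu h
    · exact hfg (hu.edge f hf g (hN' hg) h).symm
    · have hxu : x ≠ u := by
        rintro rfl
        exact moved_notMem_edge hN hN' hw hv hc H hg hvu hx'
      have hxf : x ≠ f := by
        rintro rfl
        exact hfg (hv.edge g hg _ (hN hf) hx')
      have huf : u ≠ f := fun h => hu.notMem (h ▸ hN hf)
      by_cases h0 : orient u f w = 0
      · exact H f hf g hg x (swept_of_collinear h0 huf (hc.notMem_segment hw.notMem (hN hf)) hx hxu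
          hxf) hx'
      · obtain ⟨y, hy, hyp⟩ : ∃ y ∈ segment ℝ v g, 0 < orient u f w * orient u f y := by
          rcases mul_neg_iff.1 h with ⟨p, q⟩ | ⟨p, q⟩ <;> rcases lt_or_gt_of_ne h0 with k | k
          · exact ⟨g, right_mem_segment _ _ _, mul_pos_of_neg_of_neg k q⟩
          · exact ⟨v, left_mem_segment _ _ _, mul_pos k p⟩
          · exact ⟨v, left_mem_segment _ _ _, mul_pos_of_neg_of_neg k p⟩
          · exact ⟨g, right_mem_segment _ _ _, mul_pos k q⟩
        obtain ⟨z, hz, hs⟩ := exists_swept_near hx hxu hxf hyp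
        exact H f hf g hg z hs (segment_subset_of_mem hx' hy hz)

end Plane

/-! ### The first contact during a straight motion -/

namespace Plane

variable {P N N' : Set (ℝ × ℝ)} {w u v : ℝ × ℝ}

theorem isCompact_segment' (a b : ℝ × ℝ) : IsCompact (segment ℝ a b) := by
  rw [segment_eq_image]
  exact isCompact_Icc.image (by fun_prop)

/-- The point at time `t` of the motion from `u` to `v`. -/
def move (u v : ℝ × ℝ) (t : ℝ) : ℝ × ℝ := ((1 - t) * u.1 + t * v.1, (1 - t) * u.2 + t * v.2)

theorem move_mem {u v : ℝ × ℝ} {t : ℝ} (h0 : 0 ≤ t) (h1 : t ≤ 1) : move u v t ∈ segment ℝ u v :=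
  mem_segment.2 ⟨t, h0, h1, rfl, rfl⟩

@[simp] theorem move_zero (u v : ℝ × ℝ) : move u v 0 = u := by simp [move]

@[simp] theorem move_one (u v : ℝ × ℝ) : move u v 1 = v := by simp [move]

@[fun_prop] theorem continuous_move (u v : ℝ × ℝ) : Continuous (move u v) := by
  unfold move; fun_prop

theorem isClosed_mem_segment {X : Type*} [TopologicalSpace X] {a b x : X → ℝ × ℝ}
    (ha : Continuous a) (hb : Continuous b) (hx : Continuous x) :
    IsClosed {t | x t ∈ segment ℝ (a t) (b t)} := by
  simp only [mem_segment_iff]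
  refine IsClosed.and ?_ (IsClosed.and ?_ ?_)
  · exact isClosed_eq (by unfold orient; fun_prop) continuous_const
  · exact isClosed_le (by fun_prop) continuous_const
  · exact isClosed_le (by fun_prop) continuous_const

/-- The exception for common endpoints hides that contact is a closed condition. For `f = g`, a
further common point puts one centre on the edge of the other; in the remaining cases the exception
is vacuous. -/
theorem not_apart_iff (hN : N ⊆ P) (hu : u ∉ P) (hv : v ∉ P) :
    ¬Apart N N' u v ↔ ∃ f ∈ N, ∃ g ∈ N', (f ≠ g ∧ ∃ x ∈ segment ℝ v g, x ∈ segment ℝ u f) ∨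
      v ∈ segment ℝ u f ∨ u ∈ segment ℝ v g := by
  unfold Apart
  push Not
  constructor
  · rintro ⟨f, hf, g, hg, x, hx, hx', h⟩
    refine ⟨f, hf, g, hg, ?_⟩
    by_cases hfg : f = g
    · subst hfg
      exact .inr (mem_or_mem_of_ray hx hx' (fun e => h e e))
    · exact .inl ⟨hfg, x, hx', hx⟩
  · rintro ⟨f, hf, g, hg, ⟨hfg, x, hx, hx'⟩ | h | h⟩
    · exact ⟨f, hf, g, hg, x, hx', hx, fun h1 h2 => hfg (h1.symm.trans h2)⟩
    · exact ⟨f, hf, g, hg, v, h, left_mem_segment _ _ _, fun h1 => absurd (h1 ▸ hN hf) hv⟩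
    · exact ⟨f, hf, g, hg, u, left_mem_segment _ _ _, h, fun h1 => absurd (h1 ▸ hN hf) hu⟩

/-- Moving the center of a star inside its cell does not create intersections. -/
theorem Apart.of_sameCell (hfin : N.Finite) (hfin' : N'.Finite) (hN : N ⊆ P) (hN' : N' ⊆ P)
    (hw : IsStar P N w) (hv : IsStar P N' v) (hc : SameCell P w u) (h : Apart N N' w v) :
    Apart N N' u v := by
  by_contra hbad
  -- The times of contact form a compact set, so there is a first one, `t₀`.
  let T : Set ℝ := {t | t ∈ Set.Icc 0 1 ∧ ¬Apart N N' (move w u t) v}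
  have hcell : ∀ t ∈ Set.Icc (0 : ℝ) 1, SameCell P w (move w u t) := fun t ht =>
    hc.combo (move_mem ht.1 ht.2)
  have hT : IsCompact T := by
    have : T = ⋃ f ∈ N, ⋃ g ∈ N', ({t | t ∈ Set.Icc 0 1 ∧ f ≠ g ∧
        ∃ x ∈ segment ℝ v g, x ∈ segment ℝ (move w u t) f} ∪
        (Set.Icc 0 1 ∩ {t | v ∈ segment ℝ (move w u t) f} ∪
          Set.Icc 0 1 ∩ {t | move w u t ∈ segment ℝ v g})) := by
      ext t
      simp only [T, Set.mem_ofPred_eq, Set.mem_iUnion, Set.mem_union, Set.mem_inter_iff,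
        exists_prop]
      constructor
      · rintro ⟨ht, h⟩
        rw [not_apart_iff hN ((hcell t ht).notMem hw.notMem) hv.notMem] at h
        obtain ⟨f, hf, g, hg, h⟩ := h
        exact ⟨f, hf, g, hg, by simpa only [ht, true_and] using h⟩
      · rintro ⟨f, hf, g, hg, h⟩
        have ht : t ∈ Set.Icc (0 : ℝ) 1 := by tauto
        refine ⟨ht, ?_⟩
        rw [not_apart_iff hN ((hcell t ht).notMem hw.notMem) hv.notMem]
        exact ⟨f, hf, g, hg, by simpa only [ht, true_and] using h⟩
    rw [this]
    refine hfin.isCompact_biUnion fun f hf => hfin'.isCompact_biUnion fun g hg => ?_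
    refine IsCompact.union ?_ (IsCompact.union ?_ ?_)
    · by_cases hfg : f = g
      · simp [hfg]
      -- The common point `x` ranges over a compact segment, so it can be projected away.
      · have : {t : ℝ | t ∈ Set.Icc 0 1 ∧ f ≠ g ∧
            ∃ x ∈ segment ℝ v g, x ∈ segment ℝ (move w u t) f} =
            Prod.fst '' ((Set.Icc (0 : ℝ) 1 ×ˢ segment ℝ v g) ∩
              {y : ℝ × (ℝ × ℝ) | y.2 ∈ segment ℝ (move w u y.1) f}) := by
          ext t
          constructor
          · rintro ⟨ht, -, x, hx, hx'⟩
            exact ⟨(t, x), ⟨⟨ht, hx⟩, hx'⟩, rfl⟩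
          · rintro ⟨⟨t, x⟩, ⟨⟨ht, hx⟩, hx'⟩, rfl⟩
            exact ⟨ht, hfg, x, hx, hx'⟩
        rw [this]
        refine IsCompact.image (IsCompact.inter_right (isCompact_Icc.prod (isCompact_segment' v g))
          (isClosed_mem_segment (by fun_prop) (by fun_prop) (by fun_prop))) continuous_fst
    · exact isCompact_Icc.inter_right
        (isClosed_mem_segment (by fun_prop) (by fun_prop) (by fun_prop))
    · exact isCompact_Icc.inter_right
        (isClosed_mem_segment (by fun_prop) (by fun_prop) (by fun_prop))
  obtain ⟨t₀, ⟨ht₀, hbad₀⟩, hmin⟩ := hT.exists_isLeast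
    ⟨1, ⟨zero_le_one, le_rfl⟩, by rwa [move_one]⟩
  have hpos : 0 < t₀ := lt_of_le_of_ne ht₀.1 (by
    rintro rfl
    rw [move_zero] at hbad₀
    exact hbad₀ h)
  refine hbad₀ (apart_of_not_swept hN hN' hw hv (hcell t₀ ht₀) ?_)
  rintro f hf g hg z ⟨α, β, γ, hα, hβ, hγ, hsum, z1, z2⟩ hz
  have hab : 0 < α + β := by linarith
  -- A swept point is on the edge to `f` at an earlier time: the weights `α` at the position of time
  -- `t₀` and `β > 0` at `w` combine to the position at time `τ < t₀`.
  let τ := t₀ * (α / (α + β))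
  have hτ0 : 0 ≤ τ := by positivity
  have hlt : α / (α + β) < 1 := (div_lt_one hab).2 (by linarith)
  have hτ : τ < t₀ := by
    have := mul_lt_mul_of_pos_left hlt hpos
    simpa [τ] using this
  have hgood : Apart N N' (move w u τ) v := by
    by_contra hn
    exact absurd (hmin ⟨⟨hτ0, by linarith [ht₀.2]⟩, hn⟩) (not_le.2 hτ)
  have hzm : z ∈ segment ℝ (move w u τ) f := by
    refine mem_segment.2 ⟨γ, hγ, by linarith, ?_, ?_⟩
    · rw [z1, show 1 - γ = α + β by linarith]
      simp only [move, τ]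
      field_simp
      ring
    · rw [z2, show 1 - γ = α + β by linarith]
      simp only [move, τ]
      field_simp
      ring
  -- Before `t₀` the stars meet only in fixed vertices, so `z = f`. As `α + β > 0`, this puts `f` on
  -- the path of the centre, which stays in a cell without fixed points.
  have hzf := (hgood f hf g hg z hzm hz).1
  refine hc.notMem_segment hw.notMem (hN hf) (mem_segment.2 ⟨τ, hτ0, by linarith [ht₀.2], ?_, ?_⟩)
  · rw [hzf] at z1
    have : (α + β) * ((1 - τ) * w.1 + τ * u.1 - f.1) = 0 := by
      have e : γ = 1 - (α + β) := by linarith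
      rw [e] at z1
      simp only [move] at z1
      simp only [τ]
      field_simp
      linear_combination -z1
    linarith [(mul_eq_zero.1 this).resolve_left hab.ne']
  · rw [hzf] at z2
    have : (α + β) * ((1 - τ) * w.2 + τ * u.2 - f.2) = 0 := by
      have e : γ = 1 - (α + β) := by linarith
      rw [e] at z2
      simp only [move] at z2
      simp only [τ]
      field_simp
      linear_combination -z2
    linarith [(mul_eq_zero.1 this).resolve_left hab.ne']

end Plane

/-! ### Drawings as systems of stars -/

namespace FMBigraph

open Plane

variable {Vf Vm : Type*} (B : FMBigraph Vf Vm)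

/-- The positions of the neighbours of a mobile vertex. -/
def nbrs (u : Vm) : Set (ℝ × ℝ) := B.pos '' {f | B.Adj u f}

/-- The positions of the fixed vertices. -/
def fixedPoints : Set (ℝ × ℝ) := Set.range B.pos

theorem nbrs_subset (u : Vm) : B.nbrs u ⊆ B.fixedPoints := Set.image_subset_range _ _

/-- Positions of the mobile vertices that make up a planar convex-hull drawing. -/
structure IsGood (m : Vm → ℝ × ℝ) : Prop where
  star : ∀ u, IsStar B.fixedPoints (B.nbrs u) (m u)
  apart : ∀ u v, u ≠ v → Apart (B.nbrs u) (B.nbrs v) (m u) (m v)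

variable {B}

theorem IsPlanarConvexHullDrawing.isGood {p : Vf ⊕ Vm → ℝ × ℝ}
    (h : B.IsPlanarConvexHullDrawing p) : B.IsGood fun u => p (.inr u) where
  star u := by
    refine ⟨?_, ?_, ?_⟩
    · rintro ⟨f, hf⟩
      rw [← h.fixed] at hf
      exact Sum.inl_ne_inr (h.planar.injective hf)
    · rintro _ ⟨f, hf, rfl⟩ _ ⟨k, rfl⟩ hm
      rw [← h.fixed, ← h.fixed] at hm
      rcases h.planar.vertex_edge (.inr u) (.inl f) (.inl k) hf hm with e | e
      · exact absurd e Sum.inl_ne_inr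
      · rw [Sum.inl.inj e]
    · have := h.hull u
      convert this using 2
      ext x
      constructor
      · rintro ⟨f, hf, rfl⟩
        exact ⟨.inl f, hf, h.fixed f⟩
      · rintro ⟨f | v, hf, rfl⟩
        · exact ⟨f, hf, (h.fixed f).symm⟩
        · exact hf.elim
  apart u v huv := by
    rintro _ ⟨f, hf, rfl⟩ _ ⟨g, hg, rfl⟩ x hx hx'
    rw [← h.fixed] at hx hx'
    obtain ⟨w, hw, hw', rfl⟩ := h.planar.edge_edge (.inr u) (.inl f) (.inr v) (.inl g) hf hg
      (by simp [huv]) x ⟨hx, hx'⟩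
    simp only [Sym2.mem_iff] at hw hw'
    rw [← h.fixed, ← h.fixed]
    rcases hw with rfl | rfl <;> rcases hw' with e | e
    · exact absurd (Sum.inr.inj e) huv
    · exact absurd e.symm Sum.inl_ne_inr
    · exact absurd e Sum.inl_ne_inr
    · exact ⟨rfl, congrArg p e⟩

theorem IsGood.isPlanarConvexHullDrawing {m : Vm → ℝ × ℝ} (h : B.IsGood m) :
    B.IsPlanarConvexHullDrawing (Sum.elim B.pos m) where
  fixed _ := rfl
  hull u := by
    have := (h.star u).hull
    rw [Sum.elim_inr]
    convert this using 2
    ext x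
    constructor
    · rintro ⟨f | v, hf, rfl⟩
      · exact ⟨f, hf, rfl⟩
      · exact hf.elim
    · rintro ⟨f, hf, rfl⟩
      exact ⟨.inl f, hf, rfl⟩
  planar := by
    have vertex : ∀ u f v, B.Adj u f → Sum.elim B.pos m v ∈ segment ℝ (m u) (B.pos f) →
        v = .inr u ∨ v = .inl f := by
      rintro u f (k | v) hf hm
      · exact .inr (congrArg _ (B.pos_injective ((h.star u).edge _ ⟨f, hf, rfl⟩ _ ⟨k, rfl⟩ hm)))
      · left
        by_contra hne
        obtain ⟨_, g, hg, rfl⟩ := (h.star v).nonempty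
        have := (h.apart u v (fun e => hne (congrArg _ e.symm)) _ ⟨f, hf, rfl⟩ _ ⟨g, hg, rfl⟩ _ hm
          (left_mem_segment _ _ _)).1
        exact (h.star v).notMem ⟨f, this.symm⟩
    have edge : ∀ u f v g, B.Adj u f → B.Adj v g → (u = v → f ≠ g) → ∀ x,
        x ∈ segment ℝ (m u) (B.pos f) → x ∈ segment ℝ (m v) (B.pos g) →
        (u = v ∧ x = m u) ∨ (f = g ∧ x = B.pos f) := by
      intro u f v g hf hg hne x hx hx'
      by_cases huv : u = v
      · subst huv
        left
        refine ⟨rfl, ?_⟩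
        -- A second common point of two edges at `u` would put them on one ray, with one neighbour
        -- on the edge to the other.
        by_contra hxu
        have hfg := hne rfl
        rw [segment_symm] at hx hx'
        rcases mem_or_mem_of_ray hx hx' hxu with k | k <;> rw [segment_symm] at k
        · exact hfg (B.pos_injective ((h.star u).edge _ ⟨f, hf, rfl⟩ _ ⟨g, rfl⟩ k)).symm
        · exact hfg (B.pos_injective ((h.star u).edge _ ⟨g, hg, rfl⟩ _ ⟨f, rfl⟩ k))
      · right
        obtain ⟨h1, h2⟩ := h.apart u v huv _ ⟨f, hf, rfl⟩ _ ⟨g, hg, rfl⟩ x hx hx'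
        exact ⟨B.pos_injective (h1.symm.trans h2), h1⟩
    refine ⟨?_, ?_, ?_⟩
    · rintro (f | u) (g | v) e
      · exact congrArg _ (B.pos_injective e)
      · exact absurd ⟨f, e⟩ (h.star v).notMem
      · exact absurd ⟨g, e.symm⟩ (h.star u).notMem
      -- The hull condition provides `u` with an edge, and a mobile vertex at the same place would
      -- be a vertex on it.
      · obtain ⟨_, f, hf, rfl⟩ := (h.star u).nonempty
        rcases vertex u f (.inr v) hf (by rw [← e]; exact left_mem_segment _ _ _) with k | k
        · exact k.symm
        · exact absurd k.symm Sum.inl_ne_inr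
    · rintro (f | u) (g | w) v hadj hm
      · exact hadj.elim
      · rw [segment_symm] at hm
        exact (vertex w f v hadj hm).symm
      · exact vertex u g v hadj hm
      · exact hadj.elim
    · have key : ∀ u f v g, B.Adj u f → B.Adj v g →
          s((.inr u : Vf ⊕ Vm), .inl f) ≠ s(.inr v, .inl g) → ∀ x,
          x ∈ segment ℝ (m u) (B.pos f) → x ∈ segment ℝ (m v) (B.pos g) →
          ∃ w, w ∈ s((.inr u : Vf ⊕ Vm), .inl f) ∧ w ∈ s((.inr v : Vf ⊕ Vm), .inl g) ∧
            x = Sum.elim B.pos m w := by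
        intro u f v g hf hg hne x hx hx'
        rcases edge u f v g hf hg (fun e e' => hne (by rw [e, e'])) x hx hx' with
          ⟨rfl, e⟩ | ⟨rfl, e⟩
        · exact ⟨.inr u, by simp, by simp, e⟩
        · exact ⟨.inl f, by simp, by simp, e⟩
      rintro (f | u) (g | w) (k | v) (l | y) h1 h2 hne x ⟨hx, hx'⟩ <;>
        first
        | exact h1.elim
        | exact h2.elim
        | skip
      · rw [segment_symm] at hx hx'
        rw [Sym2.eq_swap, Sym2.eq_swap (a := Sum.inl k)] at hne ⊢
        exact key w f y k h1 h2 hne x hx hx'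
      · rw [segment_symm] at hx
        rw [Sym2.eq_swap] at hne ⊢
        exact key w f v l h1 h2 hne x hx hx'
      · rw [segment_symm ℝ (Sum.elim B.pos m (Sum.inl k))] at hx'
        rw [Sym2.eq_swap (a := Sum.inl k)] at hne ⊢
        exact key u g y k h1 h2 hne x hx hx'
      · exact key u g v l h1 h2 hne x hx hx'

/-- A drawing may be replaced by one that uses other points of the same cells. -/
theorem IsGood.of_sameCell [Finite Vf] [Finite Vm] {m m' : Vm → ℝ × ℝ} (h : B.IsGood m)
    (hc : ∀ u, SameCell B.fixedPoints (m u) (m' u)) : B.IsGood m' where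
  star u := (h.star u).of_sameCell (B.nbrs_subset u) (hc u)
  apart u v huv := by
    have hfin : ∀ u, (B.nbrs u).Finite := fun u => (Set.toFinite _).image _
    have s : ∀ u, IsStar B.fixedPoints (B.nbrs u) (m' u) := fun u =>
      (h.star u).of_sameCell (B.nbrs_subset u) (hc u)
    have h1 := (h.apart u v huv).of_sameCell (hfin u) (hfin v) (B.nbrs_subset u) (B.nbrs_subset v)
      (h.star u) (h.star v) (hc u)
    -- The second star moves while the first one is already in its new position.
    exact (h1.symm.of_sameCell (hfin v) (hfin u) (B.nbrs_subset v) (B.nbrs_subset u)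
      (h.star v) (s u) (hc v)).symm

end FMBigraph

/-! ### Vertices of line arrangements -/

namespace Homog

variable {α : Type*} [Add α] [Sub α] [Mul α]

/-- The cross product: the line through two points, or the intersection of two lines, in homogeneous
coordinates. -/
def cross (p q : α × α × α) : α × α × α :=
  (p.2.1 * q.2.2 - p.2.2 * q.2.1, p.2.2 * q.1 - p.1 * q.2.2, p.1 * q.2.1 - p.2.1 * q.1)

/-- The dot product. -/
def dot (p q : α × α × α) : α := p.1 * q.1 + (p.2.1 * q.2.1 + p.2.2 * q.2.2)

/-- The point with the given homogeneous coordinates. -/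
noncomputable def point (r : ℝ × ℝ × ℝ) : ℝ × ℝ := (r.1 / r.2.2, r.2.1 / r.2.2)

end Homog

namespace Plane

open Homog

/-- The value of the affine function with the given coefficients. -/
def lineVal (l : ℝ × ℝ × ℝ) (x : ℝ × ℝ) : ℝ := dot l (x.1, x.2, 1)

theorem lineVal_eq (l : ℝ × ℝ × ℝ) (x : ℝ × ℝ) :
    lineVal l x = l.1 * x.1 + (l.2.1 * x.2 + l.2.2) := by simp [lineVal, dot]

/-- The points where two of the given lines intersect. -/
def IsVertex (L : Set (ℝ × ℝ × ℝ)) (x : ℝ × ℝ) : Prop :=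
  ∃ l ∈ L, ∃ l' ∈ L, (cross l l').2.2 ≠ 0 ∧ x = point (cross l l')

/-- The closure of the cell of `u` in an arrangement of lines. -/
def closedCell (L : Set (ℝ × ℝ × ℝ)) (u : ℝ × ℝ) : Set (ℝ × ℝ) :=
  {x | ∀ l ∈ L, (0 ≤ lineVal l u → 0 ≤ lineVal l x) ∧ (lineVal l u ≤ 0 → lineVal l x ≤ 0)}

variable {L : Set (ℝ × ℝ × ℝ)} {u : ℝ × ℝ}

theorem lineVal_combo (l : ℝ × ℝ × ℝ) (x y : ℝ × ℝ) {s t : ℝ} (h : s + t = 1) :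
    lineVal l (s • x + t • y) = s * lineVal l x + t * lineVal l y := by
  simp only [lineVal_eq, Prod.fst_add, Prod.snd_add, Prod.smul_fst, Prod.smul_snd, smul_eq_mul]
  linear_combination (-l.2.2) * h

@[fun_prop] theorem continuous_lineVal (l : ℝ × ℝ × ℝ) : Continuous (lineVal l) := by
  unfold lineVal dot; fun_prop

theorem convex_closedCell (L : Set (ℝ × ℝ × ℝ)) (u : ℝ × ℝ) : Convex ℝ (closedCell L u) := by
  intro x hx y hy s t hs ht hst l hl
  rw [lineVal_combo _ _ _ hst]
  refine ⟨fun h => ?_, fun h => ?_⟩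
  · exact add_nonneg (mul_nonneg hs ((hx l hl).1 h)) (mul_nonneg ht ((hy l hl).1 h))
  · exact add_nonpos (mul_nonpos_of_nonneg_of_nonpos hs ((hx l hl).2 h))
      (mul_nonpos_of_nonneg_of_nonpos ht ((hy l hl).2 h))

theorem isClosed_closedCell (L : Set (ℝ × ℝ × ℝ)) (u : ℝ × ℝ) : IsClosed (closedCell L u) := by
  have : closedCell L u = ⋂ l ∈ L, ({x | 0 ≤ lineVal l u → 0 ≤ lineVal l x} ∩
      {x | lineVal l u ≤ 0 → lineVal l x ≤ 0}) := by
    ext x; simp [closedCell]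
  rw [this]
  refine isClosed_biInter fun l _ => IsClosed.inter ?_ ?_
  · by_cases h : 0 ≤ lineVal l u
    · simpa [h] using isClosed_le continuous_const (continuous_lineVal l)
    · simp [h]
  · by_cases h : lineVal l u ≤ 0
    · simpa [h] using isClosed_le (continuous_lineVal l) continuous_const
    · simp [h]

/-- If the lines through `x` do not intersect transversally, they have a common direction `d`. For
small `ε` the points `x ± ε d` remain on these lines and on the same sides of the finitely many
others, so `x` is the midpoint of two points of the closed cell. -/
theorem isVertex_of_mem_extremePoints (hfin : L.Finite) {x : ℝ × ℝ}
    (hx : x ∈ (closedCell L u).extremePoints ℝ) : IsVertex L x := by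
  by_contra hv
  have hpar : ∀ l ∈ L, ∀ l' ∈ L, lineVal l x = 0 → lineVal l' x = 0 → (cross l l').2.2 = 0 := by
    intro l hl l' hl' h h'
    by_contra hD
    refine hv ⟨l, hl, l', hl', hD, ?_⟩
    rw [lineVal_eq] at h h'
    refine Prod.ext ?_ ?_
    · rw [point, eq_div_iff hD]
      simp only [cross]
      linear_combination l'.2.1 * h - l.2.1 * h'
    · rw [point, eq_div_iff hD]
      simp only [cross]
      linear_combination l.1 * h' - l'.1 * h
  obtain ⟨d, hd, hT⟩ : ∃ d : ℝ × ℝ, d ≠ 0 ∧ ∀ l ∈ L, lineVal l x = 0 →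
      l.1 * d.1 + l.2.1 * d.2 = 0 := by
    -- Triples with zero linear part are admitted in `L`. If no others vanish at `x`, any direction
    -- serves.
    by_cases h : ∃ l ∈ L, lineVal l x = 0 ∧ (l.1 ≠ 0 ∨ l.2.1 ≠ 0)
    · obtain ⟨l, hl, h0, hne⟩ := h
      refine ⟨(-l.2.1, l.1), ?_, fun l' hl' h' => ?_⟩
      · intro h
        rw [Prod.ext_iff] at h
        simp at h
        tauto
      · have := hpar l hl l' hl' h0 h'
        simp only [cross] at this ⊢
        linarith
    · push Not at h
      refine ⟨(1, 0), by simp, fun l hl h' => ?_⟩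
      simp [h l hl h']
  have hev : ∀ᶠ ε in nhds (0 : ℝ), ∀ l ∈ L, SameSign (lineVal l x) (lineVal l (x + ε • d)) := by
    rw [Filter.eventually_all_finite hfin]
    intro l hl
    have hcont : Filter.Tendsto (fun ε : ℝ => lineVal l (x + ε • d)) (nhds 0)
        (nhds (lineVal l x)) := by
      have : Continuous fun ε : ℝ => lineVal l (x + ε • d) := by fun_prop
      simpa using this.tendsto 0
    rcases lt_trichotomy (lineVal l x) 0 with h | h | h
    · filter_upwards [hcont.eventually_lt_const h] with ε hε
      exact ⟨iff_of_false h.not_gt hε.not_gt, iff_of_true h hε⟩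
    · refine Filter.Eventually.of_forall fun ε => ?_
      have : lineVal l (x + ε • d) = 0 := by
        have e := hT l hl h
        rw [lineVal_eq] at h ⊢
        simp only [Prod.fst_add, Prod.snd_add, Prod.smul_fst, Prod.smul_snd, smul_eq_mul]
        linear_combination h + ε * e
      rw [this, h]
      exact ⟨Iff.rfl, Iff.rfl⟩
    · filter_upwards [hcont.eventually_const_lt h] with ε hε
      exact ⟨iff_of_true h hε, iff_of_false h.not_gt hε.not_gt⟩
  obtain ⟨r, hr, hball⟩ := Metric.eventually_nhds_iff.1 hev
  have hmem : ∀ ε : ℝ, |ε| < r → x + ε • d ∈ closedCell L u := by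
    intro ε hε l hl
    have hs := hball (y := ε) (by simpa using hε) l hl
    have hxl := hx.1 l hl
    refine ⟨fun h => ?_, fun h => ?_⟩
    · rw [← not_lt, ← hs.2, not_lt]; exact hxl.1 h
    · rw [← not_lt, ← hs.1, not_lt]; exact hxl.2 h
  have hr2 : |r / 2| < r := by rw [abs_of_pos (by positivity)]; linarith
  have h1 := hmem (r / 2) hr2
  have h2 := hmem (-(r / 2)) (by rwa [abs_neg])
  have := (mem_extremePoints.1 hx).2 _ h1 _ h2 ⟨1 / 2, 1 / 2, by norm_num, by norm_num, by norm_num, by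
    module⟩
  have h3 : (r / 2) • d = 0 := by simpa using this.1
  rcases smul_eq_zero.1 h3 with h | h
  · linarith
  · exact hd h

/-- Repetition of points turns combinations of one or two points into combinations of three with
positive weights. -/
theorem exists_weights {S : Set (ℝ × ℝ)} (hu : u ∈ convexHull ℝ S) :
    ∃ a ∈ S, ∃ b ∈ S, ∃ c ∈ S, ∃ α β γ : ℝ, 0 < α ∧ 0 < β ∧ 0 < γ ∧
      ∀ l, lineVal l u = α * lineVal l a + β * lineVal l b + γ * lineVal l c := by
  rcases mem_convexHull_iff.1 hu with ⟨f, hf, g, hg, h⟩ | ⟨f, hf, g, hg, k, hk, h1, h2, h3⟩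
  · obtain ⟨s, t, hs, ht, hst, rfl⟩ := h
    rcases eq_or_lt_of_le hs with rfl | hs
    · refine ⟨g, hg, g, hg, g, hg, 1 / 3, 1 / 3, 1 / 3, by norm_num, by norm_num, by norm_num,
        fun l => ?_⟩
      rw [lineVal_combo _ _ _ hst, show t = 1 by linarith]
      ring
    rcases eq_or_lt_of_le ht with rfl | ht
    · refine ⟨f, hf, f, hf, f, hf, 1 / 3, 1 / 3, 1 / 3, by norm_num, by norm_num, by norm_num,
        fun l => ?_⟩
      rw [lineVal_combo _ _ _ hst, show s = 1 by linarith]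
      ring
    refine ⟨f, hf, f, hf, g, hg, s / 2, s / 2, t, by positivity, by positivity, ht, fun l => ?_⟩
    rw [lineVal_combo _ _ _ hst]
    ring
  · have hs : orient u g k + orient f u k + orient f g u = orient f g k := by
      unfold orient; ring
    have hD : 0 < orient f g k := by linarith
    refine ⟨f, hf, g, hg, k, hk, _, _, _, div_pos h1 hD, div_pos h2 hD, div_pos h3 hD, fun l => ?_⟩
    simp only [lineVal_eq]
    field_simp
    unfold orient
    ring

/-- In each bounded cell of an arrangement there is the average of three vertices. -/
theorem exists_vertices (hfin : L.Finite) (hb : Bornology.IsBounded (closedCell L u)) :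
    ∃ a b c, IsVertex L a ∧ IsVertex L b ∧ IsVertex L c ∧
      ∀ l ∈ L, SameSign (lineVal l u) (lineVal l a + lineVal l b + lineVal l c) := by
  have hK : IsCompact (closedCell L u) :=
    Metric.isCompact_of_isClosed_isBounded (isClosed_closedCell L u) hb
  have hext : ((closedCell L u).extremePoints ℝ).Finite := by
    refine (hfin.image2 (fun l l' => point (cross l l')) hfin).subset fun x hx => ?_
    obtain ⟨l, hl, l', hl', -, rfl⟩ := isVertex_of_mem_extremePoints hfin hx
    exact ⟨l, hl, l', hl', rfl⟩
  -- Krein–Milman; the hull of finitely many extreme points is already closed.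
  have hu : u ∈ convexHull ℝ ((closedCell L u).extremePoints ℝ) := by
    rw [← (hext.isClosed_convexHull (𝕜 := ℝ)).closure_eq,
      closure_convexHull_extremePoints hK (convex_closedCell L u)]
    exact fun l _ => ⟨id, id⟩
  obtain ⟨a, ha, b, hb, c, hc, α, β, γ, hα, hβ, hγ, h⟩ := exists_weights hu
  refine ⟨a, b, c, isVertex_of_mem_extremePoints hfin ha, isVertex_of_mem_extremePoints hfin hb,
    isVertex_of_mem_extremePoints hfin hc, fun l hl => ?_⟩
  -- On the closed cell a line has values of one weak sign. A positive combination of such values is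
  -- zero only if all of them are, so the weights do not affect its sign.
  have key : ∀ x y z : ℝ, 0 ≤ x → 0 ≤ y → 0 ≤ z → (0 < α * x + β * y + γ * z ↔ 0 < x + y + z) := by
    intro x y z hx hy hz
    have := mul_nonneg hα.le hx
    have := mul_nonneg hβ.le hy
    have := mul_nonneg hγ.le hz
    constructor <;> intro h <;> by_contra hn
    · obtain rfl : x = 0 := by linarith
      obtain rfl : y = 0 := by linarith
      obtain rfl : z = 0 := by linarith
      simp at h
    · have e1 : α * x = 0 := by linarith
      have e2 : β * y = 0 := by linarith
      have e3 : γ * z = 0 := by linarith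
      rw [(mul_eq_zero.1 e1).resolve_left hα.ne', (mul_eq_zero.1 e2).resolve_left hβ.ne',
        (mul_eq_zero.1 e3).resolve_left hγ.ne'] at h
      simp at h
  have ka := ha.1 l hl
  have kb := hb.1 l hl
  have kc := hc.1 l hl
  have pos : ∀ h0 : 0 ≤ lineVal l u, 0 < lineVal l u ↔
      0 < lineVal l a + lineVal l b + lineVal l c := fun h0 => by
    rw [h l]; exact key _ _ _ (ka.1 h0) (kb.1 h0) (kc.1 h0)
  have neg : ∀ h0 : lineVal l u ≤ 0, lineVal l u < 0 ↔
      lineVal l a + lineVal l b + lineVal l c < 0 := fun h0 => by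
    have := key _ _ _ (neg_nonneg.2 (ka.2 h0)) (neg_nonneg.2 (kb.2 h0)) (neg_nonneg.2 (kc.2 h0))
    rw [h l]
    constructor
    · intro h
      linarith [this.1 (by linarith)]
    · intro h
      linarith [this.2 (by linarith)]
  constructor
  · constructor
    · exact fun h0 => (pos h0.le).1 h0
    · intro h0
      rcases lt_or_ge (lineVal l u) 0 with h1 | h1
      · linarith [(neg h1.le).1 h1]
      · exact (pos h1).2 h0
  · constructor
    · exact fun h0 => (neg h0.le).1 h0
    · intro h0
      rcases lt_or_ge 0 (lineVal l u) with h1 | h1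
      · linarith [(pos h1.le).1 h1]
      · exact (neg h1).2 h0

end Plane

/-! ### Points with binary homogeneous coordinates -/

/-- Homogeneous coordinates of a point or a line. -/
abbrev HPoint : Type := BinInt × BinInt × BinInt

namespace BinInt

/-- Zero. -/
def zero : BinInt := mk [] []

/-- One. -/
def one : BinInt := mk [true] []

/-- The value as a real number. -/
def toReal (z : BinInt) : ℝ := z.toInt

@[simp] theorem toReal_add (x y : BinInt) : (x + y).toReal = x.toReal + y.toReal := by
  simp [toReal]

@[simp] theorem toReal_sub (x y : BinInt) : (x - y).toReal = x.toReal - y.toReal := by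
  simp [toReal]

@[simp] theorem toReal_mul (x y : BinInt) : (x * y).toReal = x.toReal * y.toReal := by
  simp [toReal]

@[simp] theorem toReal_zero : zero.toReal = 0 := by simp [toReal, zero, toInt_mk, bitsVal]

@[simp] theorem toReal_one : one.toReal = 1 := by simp [toReal, one, toInt_mk, bitsVal]

theorem pos_iff_toReal (x : BinInt) : x.pos = true ↔ 0 < x.toReal := by
  rw [pos_iff, toReal, Int.cast_pos]

end BinInt

namespace HPoint

open Homog BinInt

/-- The coordinates as real numbers. -/
def coords (r : HPoint) : ℝ × ℝ × ℝ := (r.1.toReal, r.2.1.toReal, r.2.2.toReal)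

/-- The point with the given homogeneous coordinates. -/
noncomputable def pt (r : HPoint) : ℝ × ℝ := point (coords r)

/-- Is the last coordinate positive? -/
def proper (r : HPoint) : Bool := r.2.2.pos

theorem coords_cross (p q : HPoint) : coords (cross p q) = cross (coords p) (coords q) := by
  simp [coords, cross]

theorem toReal_dot (p q : HPoint) : (dot p q).toReal = dot (coords p) (coords q) := by
  simp [coords, dot]

theorem proper_iff (r : HPoint) : proper r = true ↔ 0 < r.2.2.toReal := pos_iff_toReal _

/-- Change the signs of the coordinates, if necessary. -/
def norm (r : HPoint) : HPoint :=
  bif proper r then r else (zero - r.1, zero - r.2.1, zero - r.2.2)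

theorem norm_spec (r : HPoint) (h : (coords r).2.2 ≠ 0) :
    proper (norm r) = true ∧ pt (norm r) = pt r := by
  unfold norm
  cases hp : proper r
  · have : ¬ 0 < r.2.2.toReal := by rw [← proper_iff, hp]; simp
    have h' : r.2.2.toReal ≠ 0 := h
    rw [proper_iff]
    refine ⟨?_, ?_⟩
    · simp only [cond_false, toReal_sub, toReal_zero]
      exact sub_pos.2 (lt_of_le_of_ne (not_lt.1 this) h')
    · simp [pt, point, coords]
  · exact ⟨hp, rfl⟩

/-- The centroid of three points. -/
def centroid (a b c : HPoint) : HPoint :=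
  (a.1 * (b.2.2 * c.2.2) + b.1 * (a.2.2 * c.2.2) + c.1 * (a.2.2 * b.2.2),
    a.2.1 * (b.2.2 * c.2.2) + b.2.1 * (a.2.2 * c.2.2) + c.2.1 * (a.2.2 * b.2.2),
    -- Three times the common denominator.
    a.2.2 * (b.2.2 * c.2.2) + a.2.2 * (b.2.2 * c.2.2) + a.2.2 * (b.2.2 * c.2.2))

theorem lineVal_pt (l : ℝ × ℝ × ℝ) {r : HPoint} (h : proper r = true) :
    Plane.lineVal l (pt r) * r.2.2.toReal = dot l (coords r) := by
  rw [proper_iff] at h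
  simp only [Plane.lineVal, dot, pt, point, coords]
  field_simp

theorem centroid_spec {a b c : HPoint} (ha : proper a = true) (hb : proper b = true)
    (hc : proper c = true) : proper (centroid a b c) = true ∧ ∀ l,
      3 * Plane.lineVal l (pt (centroid a b c)) =
        Plane.lineVal l (pt a) + Plane.lineVal l (pt b) + Plane.lineVal l (pt c) := by
  have ka := (proper_iff _).1 ha
  have kb := (proper_iff _).1 hb
  have kc := (proper_iff _).1 hc
  have h : proper (centroid a b c) = true := by
    rw [proper_iff]
    simp only [centroid, toReal_add, toReal_mul]
    positivity
  refine ⟨h, fun l => ?_⟩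
  simp only [Plane.lineVal, dot, pt, point, coords, centroid, toReal_add, toReal_mul]
  field_simp
  ring

/-- The intersection of the lines `pq` and `rs`. -/
def vertex (p q r s : HPoint) : HPoint := norm (cross (cross p q) (cross r s))

end HPoint

/-- Twelve points that give three vertices of a line arrangement. -/
abbrev VertexCode : Type := (HPoint × HPoint × HPoint × HPoint) × (HPoint × HPoint × HPoint × HPoint) ×
  (HPoint × HPoint × HPoint × HPoint)

namespace HPoint

open Homog BinInt Plane

/-- The centroid of three vertices of a line arrangement. -/
def ofVertexCode (c : VertexCode) : HPoint :=
  centroid (vertex c.1.1 c.1.2.1 c.1.2.2.1 c.1.2.2.2)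
    (vertex c.2.1.1 c.2.1.2.1 c.2.1.2.2.1 c.2.1.2.2.2)
    (vertex c.2.2.1 c.2.2.2.1 c.2.2.2.2.1 c.2.2.2.2.2)

/-- The given points and the points at infinity of the axes. -/
def withAxes (F : List HPoint) : List HPoint := (one, zero, zero) :: (zero, one, zero) :: F

/-- The positions of the given points. -/
def pts (F : List HPoint) : Set (ℝ × ℝ) := {x | ∃ f ∈ F, pt f = x}

/-- The lines through two of the given points. -/
def lines (Q : List HPoint) : Set (ℝ × ℝ × ℝ) := {l | ∃ p ∈ Q, ∃ q ∈ Q, coords (cross p q) = l}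

theorem finite_lines (Q : List HPoint) : (lines Q).Finite := by
  refine ((List.finite_toSet Q).image2 (fun p q => coords (cross p q))
    (List.finite_toSet Q)).subset ?_
  rintro _ ⟨p, hp, q, hq, rfl⟩
  exact ⟨p, hp, q, hq, rfl⟩

theorem isVertex_lines {Q : List HPoint} {x : ℝ × ℝ} (h : IsVertex (lines Q) x) :
    ∃ p ∈ Q, ∃ q ∈ Q, ∃ r ∈ Q, ∃ s ∈ Q, proper (vertex p q r s) = true ∧
      pt (vertex p q r s) = x := by
  obtain ⟨_, ⟨p, hp, q, hq, rfl⟩, _, ⟨r, hr, s, hs, rfl⟩, hne, rfl⟩ := h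
  rw [← coords_cross] at hne ⊢
  exact ⟨p, hp, q, hq, r, hr, s, hs, norm_spec _ hne⟩

theorem lineVal_cross {p q : HPoint} (hp : proper p = true) (hq : proper q = true) (u : ℝ × ℝ) :
    lineVal (coords (cross p q)) u =
      p.2.2.toReal * q.2.2.toReal * orient (pt p) (pt q) u := by
  rw [proper_iff] at hp hq
  simp only [lineVal, dot, toReal_sub, toReal_mul, coords, cross, orient, pt, point]
  field_simp
  ring

/-- Through the infinite point of the second axis passes the vertical line of `p`; the order in the
cross product makes the factor positive. -/
theorem lineVal_fst {p : HPoint} (hp : proper p = true) (u : ℝ × ℝ) :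
    lineVal (coords (cross (zero, one, zero) p)) u = p.2.2.toReal * (u.1 - (pt p).1) := by
  rw [proper_iff] at hp
  simp only [lineVal, dot, toReal_sub, toReal_mul, coords, cross, pt, point, toReal_zero, toReal_one]
  field_simp
  ring

theorem lineVal_snd {p : HPoint} (hp : proper p = true) (u : ℝ × ℝ) :
    lineVal (coords (cross p (one, zero, zero))) u = p.2.2.toReal * (u.2 - (pt p).2) := by
  rw [proper_iff] at hp
  simp only [lineVal, dot, toReal_sub, toReal_mul, coords, cross, pt, point, toReal_zero, toReal_one]
  field_simp
  ring

theorem pos_mul_neg_iff {a b : ℝ} (h : 0 < a) : a * b < 0 ↔ b < 0 := by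
  rw [← not_le, mul_nonneg_iff_of_pos_left h, not_le]

theorem pos_mul_nonpos_iff {a b : ℝ} (h : 0 < a) : a * b ≤ 0 ↔ b ≤ 0 := by
  rw [← not_lt, mul_pos_iff_of_pos_left h, not_lt]

/-- A point of the hull is between given points in each coordinate, and the vertical and horizontal
lines through these confine its cell to a box. This is one reason to include the axes. -/
theorem isBounded_closedCell {F : List HPoint} (hF : ∀ f ∈ F, proper f = true) {u : ℝ × ℝ}
    (hu : u ∈ convexHull ℝ (pts F)) :
    Bornology.IsBounded (closedCell (lines (withAxes F)) u) := by
  obtain ⟨_, ⟨a, ha, rfl⟩, ha'⟩ :=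
    ((LinearMap.fst ℝ ℝ ℝ).concaveOn convex_univ).exists_le_of_mem_convexHull (Set.subset_univ _) hu
  obtain ⟨_, ⟨b, hb, rfl⟩, hb'⟩ :=
    ((LinearMap.snd ℝ ℝ ℝ).concaveOn convex_univ).exists_le_of_mem_convexHull (Set.subset_univ _) hu
  obtain ⟨_, ⟨c, hc, rfl⟩, hc'⟩ :=
    ((LinearMap.fst ℝ ℝ ℝ).convexOn convex_univ).exists_ge_of_mem_convexHull (Set.subset_univ _) hu
  obtain ⟨_, ⟨d, hd, rfl⟩, hd'⟩ :=
    ((LinearMap.snd ℝ ℝ ℝ).convexOn convex_univ).exists_ge_of_mem_convexHull (Set.subset_univ _) hu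
  simp only [LinearMap.fst_apply, LinearMap.snd_apply] at ha' hb' hc' hd'
  have hW : ∀ f ∈ F, 0 < f.2.2.toReal := fun f hf => (proper_iff _).1 (hF f hf)
  have h1 : ∀ f ∈ F, ∀ x ∈ closedCell (lines (withAxes F)) u,
      (0 ≤ u.1 - (pt f).1 → 0 ≤ x.1 - (pt f).1) ∧ (u.1 - (pt f).1 ≤ 0 → x.1 - (pt f).1 ≤ 0) := by
    intro f hf x hx
    have := hx _ ⟨(zero, one, zero), by simp [withAxes], f, by simp [withAxes, hf], rfl⟩
    simpa only [lineVal_fst (hF f hf), mul_nonneg_iff_of_pos_left (hW f hf),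
      pos_mul_nonpos_iff (hW f hf)] using this
  have h2 : ∀ f ∈ F, ∀ x ∈ closedCell (lines (withAxes F)) u,
      (0 ≤ u.2 - (pt f).2 → 0 ≤ x.2 - (pt f).2) ∧ (u.2 - (pt f).2 ≤ 0 → x.2 - (pt f).2 ≤ 0) := by
    intro f hf x hx
    have := hx _ ⟨f, by simp [withAxes, hf], (one, zero, zero), by simp [withAxes], rfl⟩
    simpa only [lineVal_snd (hF f hf), mul_nonneg_iff_of_pos_left (hW f hf),
      pos_mul_nonpos_iff (hW f hf)] using this
  refine (Metric.isBounded_Icc ((pt a).1, (pt b).2) ((pt c).1, (pt d).2)).subset fun x hx => ?_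
  refine ⟨⟨?_, ?_⟩, ⟨?_, ?_⟩⟩
  · linarith [(h1 a ha x hx).1 (by linarith)]
  · linarith [(h2 b hb x hx).1 (by linarith)]
  · linarith [(h1 c hc x hx).2 (by linarith)]
  · linarith [(h2 d hd x hx).2 (by linarith)]

theorem sameSign_of_mul {a b c : ℝ} (hc : 0 < c) (h : SameSign (c * a) (c * b)) : SameSign a b := by
  simpa only [SameSign, mul_pos_iff_of_pos_left hc, pos_mul_neg_iff hc] using h

/-- The code is made up of given points. -/
def UsesOnly (Q : List HPoint) (c : VertexCode) : Prop :=
  ((c.1.1 ∈ Q ∧ c.1.2.1 ∈ Q) ∧ (c.1.2.2.1 ∈ Q ∧ c.1.2.2.2 ∈ Q)) ∧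
  ((c.2.1.1 ∈ Q ∧ c.2.1.2.1 ∈ Q) ∧ (c.2.1.2.2.1 ∈ Q ∧ c.2.1.2.2.2 ∈ Q)) ∧
  ((c.2.2.1 ∈ Q ∧ c.2.2.2.1 ∈ Q) ∧ (c.2.2.2.2.1 ∈ Q ∧ c.2.2.2.2.2 ∈ Q))

/-- Each bounded cell contains a point with small homogeneous coordinates. -/
theorem exists_code {F : List HPoint} (hF : ∀ f ∈ F, proper f = true) {u : ℝ × ℝ}
    (hu : u ∈ convexHull ℝ (pts F)) : ∃ c, UsesOnly (withAxes F) c ∧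
      proper (ofVertexCode c) = true ∧ SameCell (pts F) u (pt (ofVertexCode c)) := by
  obtain ⟨x, y, z, hx, hy, hz, h⟩ := exists_vertices (finite_lines _) (isBounded_closedCell hF hu)
  obtain ⟨a₁, m1, a₂, m2, a₃, m3, a₄, m4, pa, rfl⟩ := isVertex_lines hx
  obtain ⟨b₁, n1, b₂, n2, b₃, n3, b₄, n4, pb, rfl⟩ := isVertex_lines hy
  obtain ⟨c₁, o1, c₂, o2, c₃, o3, c₄, o4, pc, rfl⟩ := isVertex_lines hz
  obtain ⟨hp, hc⟩ := centroid_spec pa pb pc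
  refine ⟨((a₁, a₂, a₃, a₄), (b₁, b₂, b₃, b₄), (c₁, c₂, c₃, c₄)),
    ⟨⟨⟨m1, m2⟩, m3, m4⟩, ⟨⟨n1, n2⟩, n3, n4⟩, ⟨⟨o1, o2⟩, o3, o4⟩⟩, hp, ?_⟩
  simp only [← hc] at h
  have h' : ∀ l ∈ lines (withAxes F), SameSign (lineVal l u) (lineVal l (pt (centroid
      (vertex a₁ a₂ a₃ a₄) (vertex b₁ b₂ b₃ b₄) (vertex c₁ c₂ c₃ c₄)))) := by
    intro l hl
    simpa only [SameSign, mul_pos_iff_of_pos_left (three_pos (α := ℝ)),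
      pos_mul_neg_iff (three_pos (α := ℝ))] using h l hl
  have hW : ∀ f ∈ F, 0 < f.2.2.toReal := fun f hf => (proper_iff _).1 (hF f hf)
  constructor
  · rintro _ ⟨p, hp, rfl⟩ _ ⟨q, hq, rfl⟩
    have := h' _ ⟨p, by simp [withAxes, hp], q, by simp [withAxes, hq], rfl⟩
    rw [lineVal_cross (hF p hp) (hF q hq), lineVal_cross (hF p hp) (hF q hq)] at this
    exact sameSign_of_mul (mul_pos (hW p hp) (hW q hq)) this
  · rintro _ ⟨p, hp, rfl⟩
    have := h' _ ⟨(zero, one, zero), by simp [withAxes], p, by simp [withAxes, hp], rfl⟩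
    rw [lineVal_fst (hF p hp), lineVal_fst (hF p hp)] at this
    exact sameSign_of_mul (hW p hp) this
  · rintro _ ⟨p, hp, rfl⟩
    have := h' _ ⟨p, by simp [withAxes, hp], (one, zero, zero), by simp [withAxes], rfl⟩
    rw [lineVal_snd (hF p hp), lineVal_snd (hF p hp)] at this
    exact sameSign_of_mul (hW p hp) this

end HPoint

/-! ### Reading data from words -/

/-- Data types whose elements can be recovered from their codes in polynomial time. -/
class Decode (α : Type) [Data α] where
  dec : BinTree → α
  dec_code : ∀ x, dec (Data.code x) = x
  polyTime : PolyTime dec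

namespace Decode

/-- Is the tree not a leaf? -/
def toBool : BinTree → Bool
  | .nil => false
  | .cons _ _ => true

/-- The branches of a tree. -/
def toPair : BinTree → BinTree × BinTree
  | .nil => (.nil, .nil)
  | .cons x y => (x, y)

/-- The trees that hang off the right spine. -/
def toList : BinTree → List BinTree
  | .nil => []
  | .cons x y => x :: toList y

/-- Every tree is the code of a list of trees, so the conversion needs no computation. -/
theorem code_toList : ∀ x, Data.code (toList x) = x
  | .nil => rfl
  | .cons x y => by rw [toList, code_cons, code_toList y]; rfl

theorem polyTime_toBool : PolyTime toBool := by
  refine PolyTime.cases (β := BinTree) (β' := BinTree) .id (.const false) (.const true) fun x => ?_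
  cases x with
  | nil => exact .inl ⟨rfl, rfl⟩
  | cons u v => exact .inr ⟨u, v, rfl, rfl⟩

theorem polyTime_toPair : PolyTime toPair := by
  refine PolyTime.cases (β := BinTree) (β' := BinTree) .id (.const (BinTree.nil, BinTree.nil))
    (g := fun x => x.2) (by fun_prop) fun x => ?_
  cases x with
  | nil => exact .inl ⟨rfl, rfl⟩
  | cons u v => exact .inr ⟨u, v, rfl, rfl⟩

theorem polyTime_toList : PolyTime toList := .recode code_toList

instance : Decode Bool where
  dec := toBool
  dec_code := by rintro (_ | _) <;> rfl
  polyTime := polyTime_toBool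

instance {α β : Type} [Data α] [Data β] [Decode α] [Decode β] : Decode (α × β) where
  dec x := (dec (toPair x).1, dec (toPair x).2)
  dec_code x := Prod.ext (dec_code x.1) (dec_code x.2)
  polyTime := (polyTime.comp polyTime_toPair.fst).pair (polyTime.comp polyTime_toPair.snd)

instance {α : Type} [Data α] [Decode α] : Decode (List α) where
  dec x := (toList x).map dec
  dec_code l := by
    induction l with
    | nil => rfl
    | cons x l ih => rw [code_cons, toList, List.map_cons, ih, dec_code]
  polyTime := polyTime_toList.map (polyTime.comp (.snd .id))

instance : Decode BinInt := inferInstanceAs (Decode (List Bool × List Bool))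

end Decode

namespace BinTree

/-- One step of the evaluation of a reversed Polish expression. -/
def parseStep (s : List BinTree) (b : Bool) : List BinTree :=
  bif b then .cons (s.headD .nil) (s.tail.headD .nil) :: s.tail.tail else .nil :: s

/-- In reversed Polish notation the operands precede their node, the second one first, so the first
operand is on top of the stack. -/
theorem foldl_parseStep (x : BinTree) : ∀ s, x.enc.reverse.foldl parseStep s = x :: s := by
  induction x with
  | nil => intro s; rfl
  | cons x y hx hy => intro s; simp [enc, hx, hy, parseStep]

/-- Evaluation of reversed Polish expressions. -/
def parse (l : List Bool) : BinTree := (l.foldl parseStep []).headD .nil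

theorem parse_enc (x : BinTree) : parse x.enc.reverse = x := by
  rw [parse, foldl_parseStep]; rfl

end BinTree

namespace PolyTime

variable {α β : Type} [Data α] [Data β]

@[fun_prop]
theorem tree_cons {f g : α → BinTree} (hf : PolyTime f) (hg : PolyTime g) :
    PolyTime (fun x => BinTree.cons (f x) (g x)) :=
  (recode (f := fun x : BinTree × BinTree => BinTree.cons x.1 x.2) fun _ => rfl).comp (hf.pair hg)

theorem parse {f : α → List Bool} (hf : PolyTime f) : PolyTime (fun x => BinTree.parse (f x)) := by
  have hs : PolyTime (fun x : α × (List BinTree × Bool) => BinTree.parseStep x.2.1 x.2.2) := by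
    unfold BinTree.parseStep; fun_prop
  -- Missing operands count as `nil`, so the stack grows by a bounded amount on malformed input too.
  refine .headD (foldl (step := fun _ s b => BinTree.parseStep s b) hf (const ([] : List BinTree)) hs
    7 ?_) (const _)
  rintro _ s (_ | _)
  · simp only [BinTree.parseStep, cond_false, sz_cons, Polynomial.eval_ofNat]
    have : sz BinTree.nil = 1 := rfl
    omega
  · have h : ∀ x y : BinTree, sz (BinTree.cons x y) = 1 + (sz x + sz y) := fun _ _ => rfl
    have h0 : sz BinTree.nil = 1 := rfl
    rcases s with _ | ⟨x, _ | ⟨y, s⟩⟩ <;>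
      simp only [BinTree.parseStep, cond_true, sz_cons, Polynomial.eval_ofNat, h, h0, List.headD_nil,
        List.tail_nil, sz_nil, List.headD_cons, List.tail_cons] <;> omega

end PolyTime

theorem listRel_iff {α β : Type} {r : α → β → Bool} {l : List α} {m : List β} :
    listRel r l m = true ↔ List.Forall₂ (fun x y => r x y = true) l m := by
  induction l generalizing m with
  | nil => cases m <;> simp [listRel]
  | cons x l ih => cases m <;> simp [listRel, ih]

theorem pairRel_iff {α : Type} {r : α → α → Bool} {l : List α} :
    pairRel r l = true ↔ l.Pairwise fun x y => r x y = true := by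
  induction l with
  | nil => simp [pairRel]
  | cons x l ih => simp [pairRel, ih]

/-- Equality of words of bit strings. -/
def sameWord (l m : List (List Bool)) : Bool := listRel (listRel fun b c => !(b ^^ c)) l m

theorem listRel_eq {α : Type} {r : α → α → Bool} (hr : ∀ x y, r x y = true ↔ x = y) (l m : List α) :
    listRel r l m = true ↔ l = m := by
  simp only [listRel_iff, hr, List.forall₂_eq_eq_eq]

theorem sameWord_iff (l m : List (List Bool)) : sameWord l m = true ↔ l = m :=
  listRel_eq (listRel_eq fun b c => by cases b <;> cases c <;> decide) l m

theorem PolyTime.sameWord {α : Type} [Data α] {f g : α → List (List Bool)} (hf : PolyTime f)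
    (hg : PolyTime g) : PolyTime (fun x => sameWord (f x) (g x)) := by
  refine listRel (r := fun _ => _root_.listRel fun b c => !(b ^^ c)) ?_ hf hg
  exact listRel (r := fun _ b c => !(b ^^ c)) (by fun_prop) (by fun_prop) (by fun_prop)

/-- The word in the input of a verifier. -/
def wordPart (s : List (List Bool)) : List (List Bool) :=
  -- The first digit of a symbol code tells letters from certificate digits. The reversal undoes
  -- that of the input; the certificate is left reversed for `BinTree.parse`.
  ((s.filter fun x => x.headD false).map fun x => x.tail).reverse

/-- The reversed certificate in the input of a verifier. -/
def certPart (s : List (List Bool)) : List Bool :=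
  (s.filter fun x => !x.headD false).map fun x => x.tail.headD false

theorem wordPart_input (w : List Letter) (c : List Bool) :
    wordPart ((encodeWordPair (w, c)).map symBits).reverse = w.map Letter.bits := by
  have h1 : (w.map (symBits ∘ Sum.inl)).filter (fun x => x.headD false) =
      w.map fun x => true :: x.bits := by
    induction w with
    | nil => rfl
    | cons x w ih => rw [List.map_cons, List.map_cons, ← ih]; rfl
  have h2 : (c.map (symBits ∘ Sum.inr)).filter (fun x => x.headD false) = [] := by
    induction c with
    | nil => rfl
    | cons x c ih => rw [List.map_cons]; exact ih
  rw [wordPart, encodeWordPair, List.filter_reverse, List.map_reverse, List.reverse_reverse,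
    List.map_append, List.filter_append, List.map_map, List.map_map, h1, h2, List.append_nil,
    List.map_map]
  rfl

theorem certPart_input (w : List Letter) (c : List Bool) :
    certPart ((encodeWordPair (w, c)).map symBits).reverse = c.reverse := by
  have h1 : (w.map (symBits ∘ Sum.inl)).filter (fun x => !x.headD false) = [] := by
    induction w with
    | nil => rfl
    | cons x w ih => rw [List.map_cons]; exact ih
  have h2 : (c.map (symBits ∘ Sum.inr)).filter (fun x => !x.headD false) =
      c.map fun b => [false, b] := by
    induction c with
    | nil => rfl
    | cons x c ih => rw [List.map_cons, List.map_cons, ← ih]; rfl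
  rw [certPart, encodeWordPair, List.filter_reverse, List.map_reverse, List.map_append,
    List.filter_append, List.map_map, List.map_map, h1, h2, List.nil_append, List.map_map]
  congr 1
  exact List.map_id _

theorem PolyTime.wordPart : PolyTime wordPart := by
  unfold _root_.wordPart
  exact .reverse (.map (.filter .id (by fun_prop)) (by fun_prop))

theorem PolyTime.certPart : PolyTime certPart := by
  unfold _root_.certPart
  exact .map (.filter .id (by fun_prop)) (by fun_prop)

/-! ### Geometric tests -/

namespace Plane

/-- The star conditions exclude fixed vertices inside edges, so centres on edges and proper
crossings are the only contacts left, and both can be tested by signs. -/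
theorem apart_iff {P N N' : Set (ℝ × ℝ)} {u v : ℝ × ℝ} (hN : N ⊆ P) (hN' : N' ⊆ P)
    (hu : IsStar P N u) (hv : IsStar P N' v) : Apart N N' u v ↔ ∀ f ∈ N, ∀ g ∈ N',
      (v ∉ segment ℝ u f ∧ u ∉ segment ℝ v g) ∧
        (f = g ∨ ¬(orient u f v * orient u f g < 0 ∧ orient v g u * orient v g f < 0)) := by
  constructor
  · intro h f hf g hg
    refine ⟨⟨fun hm => ?_, fun hm => ?_⟩, ?_⟩
    · exact hv.notMem ((h f hf g hg v hm (left_mem_segment _ _ _)).1 ▸ hN hf)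
    · exact hu.notMem ((h f hf g hg u (left_mem_segment _ _ _) hm).1 ▸ hN hf)
    · by_contra hn
      push Not at hn
      obtain ⟨x, hx, hx'⟩ := segments_cross hn.2.1 hn.2.2
      obtain ⟨h1, h2⟩ := h f hf g hg x hx hx'
      exact hn.1 (h1.symm.trans h2)
  · intro h f hf g hg x hx hx'
    obtain ⟨⟨h1, h2⟩, h3⟩ := h f hf g hg
    by_contra hne
    by_cases hfg : f = g
    · subst hfg
      rcases mem_or_mem_of_ray hx hx' (fun h => hne ⟨h, h⟩) with k | k
      · exact h1 k
      · exact h2 k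
    · rcases segments_meet hx hx' with k | k | k | k | k
      · exact h2 k
      · exact hfg (hv.edge g hg f (hN hf) k)
      · exact h1 k
      · exact hfg (hu.edge f hf g (hN' hg) k).symm
      · exact (h3.resolve_left hfg) k

end Plane

namespace BinInt

/-- Is the number zero? -/
def isZero (z : BinInt) : Bool := !z.pos && !(zero - z).pos

theorem isZero_iff (z : BinInt) : z.isZero = true ↔ z.toReal = 0 := by
  have h1 := pos_iff_toReal z
  have h2 := pos_iff_toReal (zero - z)
  rw [toReal_sub, toReal_zero, zero_sub, Left.neg_pos_iff] at h2
  unfold isZero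
  rw [Bool.and_eq_true, Bool.not_eq_true', Bool.not_eq_true', ← Bool.not_eq_true,
    ← Bool.not_eq_true, h1, h2, not_lt, not_lt]
  exact ⟨fun h => le_antisymm h.1 h.2, fun h => ⟨h.le, h.ge⟩⟩

end BinInt

namespace HPoint

open Homog BinInt Plane

/-- The determinant of the coordinates. -/
def det (p q r : HPoint) : BinInt := dot (cross p q) r

/-- The difference of the first coordinates, up to a positive factor. -/
def diffX (p q : HPoint) : BinInt := p.1 * q.2.2 - q.1 * p.2.2

/-- The difference of the second coordinates, up to a positive factor. -/
def diffY (p q : HPoint) : BinInt := p.2.1 * q.2.2 - q.2.1 * p.2.2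

/-- Are the points equal? -/
def eqPt (p q : HPoint) : Bool := (diffX p q).isZero && (diffY p q).isZero

/-- Is `x` on the segment `ab`? -/
def onSegment (a b x : HPoint) : Bool :=
  (det a b x).isZero && (!(diffX x a * diffX x b).pos && !(diffY x a * diffY x b).pos)

/-- Is `u` in the convex hull of `N`? -/
def inHull (N : List HPoint) (u : HPoint) : Bool :=
  (N.any fun f => N.any fun g => onSegment f g u) ||
    N.any fun f => N.any fun g => N.any fun h =>
      (det u g h).pos && ((det f u h).pos && (det f g u).pos)

/-- The conditions on a single mobile vertex. -/
def isStar (P N : List HPoint) (u : HPoint) : Bool :=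
  (P.all fun f => !eqPt u f) &&
    ((N.all fun f => P.all fun h => !onSegment u f h || eqPt h f) && inHull N u)

/-- Do the segments `uf` and `vg` cross properly? -/
def crosses (u f v g : HPoint) : Bool :=
  (zero - det u f v * det u f g).pos && (zero - det v g u * det v g f).pos

/-- The conditions on a pair of edges. -/
def edgesApart (u v f g : HPoint) : Bool :=
  (!onSegment u f v && !onSegment v g u) && (eqPt f g || !crosses u f v g)

/-- The conditions on a pair of mobile vertices. -/
def isApart (N N' : List HPoint) (u v : HPoint) : Bool :=
  N.all fun f => N'.all fun g => edgesApart u v f g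

variable {p q r : HPoint}

/-- For proper points the factor is positive, so integer determinants decide orientations without
division. -/
theorem toReal_det (hp : proper p = true) (hq : proper q = true) (hr : proper r = true) :
    (det p q r).toReal =
      p.2.2.toReal * q.2.2.toReal * r.2.2.toReal * orient (pt p) (pt q) (pt r) := by
  rw [det, toReal_dot, ← lineVal_pt _ hr, lineVal_cross hp hq]
  ring

theorem toReal_diffX (hp : proper p = true) (hq : proper q = true) :
    (diffX p q).toReal = p.2.2.toReal * q.2.2.toReal * ((pt p).1 - (pt q).1) := by
  rw [proper_iff] at hp hq
  simp only [diffX, toReal_sub, toReal_mul, pt, point, coords]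
  field_simp

theorem toReal_diffY (hp : proper p = true) (hq : proper q = true) :
    (diffY p q).toReal = p.2.2.toReal * q.2.2.toReal * ((pt p).2 - (pt q).2) := by
  rw [proper_iff] at hp hq
  simp only [diffY, toReal_sub, toReal_mul, pt, point, coords]
  field_simp

theorem eqPt_iff (hp : proper p = true) (hq : proper q = true) :
    eqPt p q = true ↔ pt p = pt q := by
  have h := mul_pos ((proper_iff _).1 hp) ((proper_iff _).1 hq)
  rw [eqPt, Bool.and_eq_true, isZero_iff, isZero_iff, toReal_diffX hp hq, toReal_diffY hp hq,
    mul_eq_zero_iff_left h.ne', mul_eq_zero_iff_left h.ne', sub_eq_zero, sub_eq_zero, Prod.ext_iff]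

theorem det_pos_iff (hp : proper p = true) (hq : proper q = true) (hr : proper r = true) :
    (det p q r).pos = true ↔ 0 < orient (pt p) (pt q) (pt r) := by
  have h := mul_pos (mul_pos ((proper_iff _).1 hp) ((proper_iff _).1 hq)) ((proper_iff _).1 hr)
  rw [pos_iff_toReal, toReal_det hp hq hr, mul_pos_iff_of_pos_left h]

theorem onSegment_iff (hp : proper p = true) (hq : proper q = true) (hr : proper r = true) :
    onSegment p q r = true ↔ pt r ∈ segment ℝ (pt p) (pt q) := by
  have kp := (proper_iff _).1 hp
  have kq := (proper_iff _).1 hq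
  have kr := (proper_iff _).1 hr
  have e : ∀ a b c x y : ℝ, a * b * x * (a * c * y) = a * b * (a * c) * (x * y) :=
    fun _ _ _ _ _ => by ring
  rw [mem_segment_iff, onSegment, Bool.and_eq_true, Bool.and_eq_true, isZero_iff, toReal_det hp hq hr,
    Bool.not_eq_true', Bool.not_eq_true', ← Bool.not_eq_true, ← Bool.not_eq_true, pos_iff_toReal,
    pos_iff_toReal, toReal_mul, toReal_mul, toReal_diffX hr hp, toReal_diffX hr hq,
    toReal_diffY hr hp, toReal_diffY hr hq, e, e,
    mul_pos_iff_of_pos_left (mul_pos (mul_pos kr kp) (mul_pos kr kq)),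
    mul_pos_iff_of_pos_left (mul_pos (mul_pos kr kp) (mul_pos kr kq)), not_lt, not_lt,
    mul_eq_zero_iff_left (mul_pos (mul_pos kp kq) kr).ne']

theorem inHull_iff {N : List HPoint} (hN : ∀ f ∈ N, proper f = true) (hp : proper p = true) :
    inHull N p = true ↔ pt p ∈ convexHull ℝ (pts N) := by
  rw [mem_convexHull_iff]
  simp only [inHull, Bool.or_eq_true, List.any_eq_true, Bool.and_eq_true]
  refine or_congr ⟨?_, ?_⟩ ⟨?_, ?_⟩
  · rintro ⟨f, hf, g, hg, h⟩
    exact ⟨_, ⟨f, hf, rfl⟩, _, ⟨g, hg, rfl⟩, (onSegment_iff (hN f hf) (hN g hg) hp).1 h⟩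
  · rintro ⟨_, ⟨f, hf, rfl⟩, _, ⟨g, hg, rfl⟩, h⟩
    exact ⟨f, hf, g, hg, (onSegment_iff (hN f hf) (hN g hg) hp).2 h⟩
  · rintro ⟨f, hf, g, hg, k, hk, h1, h2, h3⟩
    exact ⟨_, ⟨f, hf, rfl⟩, _, ⟨g, hg, rfl⟩, _, ⟨k, hk, rfl⟩,
      (det_pos_iff hp (hN g hg) (hN k hk)).1 h1, (det_pos_iff (hN f hf) hp (hN k hk)).1 h2,
      (det_pos_iff (hN f hf) (hN g hg) hp).1 h3⟩
  · rintro ⟨_, ⟨f, hf, rfl⟩, _, ⟨g, hg, rfl⟩, _, ⟨k, hk, rfl⟩, h1, h2, h3⟩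
    exact ⟨f, hf, g, hg, k, hk,
      (det_pos_iff hp (hN g hg) (hN k hk)).2 h1, (det_pos_iff (hN f hf) hp (hN k hk)).2 h2,
      (det_pos_iff (hN f hf) (hN g hg) hp).2 h3⟩

theorem isStar_iff {P N : List HPoint} (hP : ∀ f ∈ P, proper f = true) (hN : N ⊆ P)
    (hp : proper p = true) : isStar P N p = true ↔ IsStar (pts P) (pts N) (pt p) := by
  have hN' : ∀ f ∈ N, proper f = true := fun f hf => hP f (hN hf)
  simp only [isStar, Bool.and_eq_true, List.all_eq_true, Bool.not_eq_true', Bool.or_eq_true,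
    ← Bool.not_eq_true, inHull_iff hN' hp]
  constructor
  · rintro ⟨h1, h2, h3⟩
    refine ⟨?_, ?_, h3⟩
    · rintro ⟨f, hf, e⟩
      exact h1 f hf ((eqPt_iff hp (hP f hf)).2 e.symm)
    · rintro _ ⟨f, hf, rfl⟩ _ ⟨k, hk, rfl⟩ hm
      exact (eqPt_iff (hP k hk) (hN' f hf)).1 ((h2 f hf k hk).resolve_left
        (not_not.2 ((onSegment_iff hp (hN' f hf) (hP k hk)).2 hm)))
  · rintro ⟨h1, h2, h3⟩
    refine ⟨fun f hf e => h1 ⟨f, hf, ((eqPt_iff hp (hP f hf)).1 e).symm⟩, fun f hf k hk => ?_, h3⟩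
    rw [or_iff_not_imp_left, not_not, onSegment_iff hp (hN' f hf) (hP k hk),
      eqPt_iff (hP k hk) (hN' f hf)]
    exact h2 _ ⟨f, hf, rfl⟩ _ ⟨k, hk, rfl⟩

theorem neg_det_mul_det_iff {a b c d : HPoint} (ha : proper a = true) (hb : proper b = true)
    (hc : proper c = true) (hd : proper d = true) : (zero - det a b c * det a b d).pos = true ↔
      orient (pt a) (pt b) (pt c) * orient (pt a) (pt b) (pt d) < 0 := by
  have ka := (proper_iff _).1 ha
  have kb := (proper_iff _).1 hb
  have kc := (proper_iff _).1 hc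
  have kd := (proper_iff _).1 hd
  rw [pos_iff_toReal, toReal_sub, toReal_zero, toReal_mul, toReal_det ha hb hc, toReal_det ha hb hd,
    zero_sub, neg_pos, mul_mul_mul_comm, pos_mul_neg_iff (by positivity)]

theorem isApart_iff {P N N' : List HPoint} (hP : ∀ f ∈ P, proper f = true) (hN : N ⊆ P)
    (hN' : N' ⊆ P) (hp : proper p = true) (hq : proper q = true)
    (hsp : IsStar (pts P) (pts N) (pt p)) (hsq : IsStar (pts P) (pts N') (pt q)) :
    isApart N N' p q = true ↔ Apart (pts N) (pts N') (pt p) (pt q) := by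
  have sub : ∀ {N : List HPoint}, N ⊆ P → pts N ⊆ pts P := by
    rintro N h _ ⟨f, hf, rfl⟩
    exact ⟨f, h hf, rfl⟩
  rw [apart_iff (sub hN) (sub hN') hsp hsq]
  simp only [isApart, edgesApart, crosses, List.all_eq_true, Bool.and_eq_true, Bool.or_eq_true, Bool.not_eq_true',
    ← Bool.not_eq_true]
  have key : ∀ f ∈ N, ∀ g ∈ N', _ := fun f hf g hg =>
    and_congr (and_congr (not_congr (onSegment_iff hp (hP f (hN hf)) hq))
      (not_congr (onSegment_iff hq (hP g (hN' hg)) hp)))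
      (or_congr (eqPt_iff (hP f (hN hf)) (hP g (hN' hg)))
      (not_congr (and_congr (neg_det_mul_det_iff hp (hP f (hN hf)) hq (hP g (hN' hg)))
        (neg_det_mul_det_iff hq (hP g (hN' hg)) hp (hP f (hN hf))))))
  constructor
  · rintro h _ ⟨f, hf, rfl⟩ _ ⟨g, hg, rfl⟩
    exact (key f hf g hg).1 (h f hf g hg)
  · intro h f hf g hg
    exact (key f hf g hg).2 (h _ ⟨f, hf, rfl⟩ _ ⟨g, hg, rfl⟩)

end HPoint

/-! ### Geometric tests in polynomial time -/

namespace PolyTime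

variable {α : Type} [Data α]

@[fun_prop]
theorem binInt_isZero {f : α → BinInt} (hf : PolyTime f) : PolyTime (fun x => (f x).isZero) := by
  unfold BinInt.isZero; fun_prop

@[fun_prop]
theorem cross {f g : α → HPoint} (hf : PolyTime f) (hg : PolyTime g) :
    PolyTime (fun x => Homog.cross (f x) (g x)) := by
  unfold Homog.cross; fun_prop

@[fun_prop]
theorem det {f g h : α → HPoint} (hf : PolyTime f) (hg : PolyTime g) (hh : PolyTime h) :
    PolyTime (fun x => HPoint.det (f x) (g x) (h x)) := by
  have := hf.cross hg
  unfold HPoint.det Homog.dot; fun_prop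

@[fun_prop]
theorem diffX {f g : α → HPoint} (hf : PolyTime f) (hg : PolyTime g) :
    PolyTime (fun x => HPoint.diffX (f x) (g x)) := by
  unfold HPoint.diffX; fun_prop

@[fun_prop]
theorem diffY {f g : α → HPoint} (hf : PolyTime f) (hg : PolyTime g) :
    PolyTime (fun x => HPoint.diffY (f x) (g x)) := by
  unfold HPoint.diffY; fun_prop

@[fun_prop]
theorem eqPt {f g : α → HPoint} (hf : PolyTime f) (hg : PolyTime g) :
    PolyTime (fun x => HPoint.eqPt (f x) (g x)) := by
  unfold HPoint.eqPt; fun_prop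

@[fun_prop]
theorem onSegment {f g h : α → HPoint} (hf : PolyTime f) (hg : PolyTime g) (hh : PolyTime h) :
    PolyTime (fun x => HPoint.onSegment (f x) (g x) (h x)) := by
  unfold HPoint.onSegment; fun_prop

@[fun_prop]
theorem inHull {f : α → List HPoint} {g : α → HPoint} (hf : PolyTime f) (hg : PolyTime g) :
    PolyTime (fun x => HPoint.inHull (f x) (g x)) := by
  have : PolyTime (fun x : List HPoint × HPoint => HPoint.inHull x.1 x.2) := by
    unfold HPoint.inHull; fun_prop
  exact uncurry (f := HPoint.inHull) this hf hg

@[fun_prop]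
theorem isStar {f g : α → List HPoint} {h : α → HPoint} (hf : PolyTime f) (hg : PolyTime g)
    (hh : PolyTime h) : PolyTime (fun x => HPoint.isStar (f x) (g x) (h x)) := by
  have : PolyTime (fun x : (List HPoint × List HPoint) × HPoint =>
      HPoint.isStar x.1.1 x.1.2 x.2) := by
    unfold HPoint.isStar; fun_prop
  exact uncurry (f := fun x : List HPoint × List HPoint => HPoint.isStar x.1 x.2) this
    (hf.pair hg) hh

@[fun_prop]
theorem crosses {f g h k : α → HPoint} (hf : PolyTime f) (hg : PolyTime g)
    (hh : PolyTime h) (hk : PolyTime k) :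
    PolyTime (fun x => HPoint.crosses (f x) (g x) (h x) (k x)) := by
  unfold HPoint.crosses; fun_prop

@[fun_prop]
theorem edgesApart {f g h k : α → HPoint} (hf : PolyTime f) (hg : PolyTime g)
    (hh : PolyTime h) (hk : PolyTime k) :
    PolyTime (fun x => HPoint.edgesApart (f x) (g x) (h x) (k x)) := by
  unfold HPoint.edgesApart; fun_prop

theorem isApart {f g : α → List HPoint} {h k : α → HPoint} (hf : PolyTime f) (hg : PolyTime g)
    (hh : PolyTime h) (hk : PolyTime k) :
    PolyTime (fun x => HPoint.isApart (f x) (g x) (h x) (k x)) := by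
  have : PolyTime (fun x : (List HPoint × List HPoint) × (HPoint × HPoint) =>
      HPoint.isApart x.1.1 x.1.2 x.2.1 x.2.2) := by
    unfold HPoint.isApart; fun_prop
  have h' := (hf.pair hg).pair (hh.pair hk)
  exact this.comp h'

@[fun_prop]
theorem centroid {f g h : α → HPoint} (hf : PolyTime f) (hg : PolyTime g) (hh : PolyTime h) :
    PolyTime (fun x => HPoint.centroid (f x) (g x) (h x)) := by
  unfold HPoint.centroid; fun_prop

@[fun_prop]
theorem hpoint_norm {f : α → HPoint} (hf : PolyTime f) :
    PolyTime (fun x => HPoint.norm (f x)) := by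
  unfold HPoint.norm HPoint.proper; fun_prop

@[fun_prop]
theorem vertex {f g h k : α → HPoint} (hf : PolyTime f) (hg : PolyTime g) (hh : PolyTime h)
    (hk : PolyTime k) : PolyTime (fun x => HPoint.vertex (f x) (g x) (h x) (k x)) := by
  unfold HPoint.vertex; fun_prop

theorem ofVertexCode : PolyTime HPoint.ofVertexCode := by
  unfold HPoint.ofVertexCode; fun_prop

end PolyTime

/-! ### Numbers and points of an instance -/

/-- Is there no superfluous zero at the end? -/
def canonicalBits (l : List Bool) : Bool := l.isEmpty || l.reverse.headD false

theorem canonicalBits_cons (b : Bool) (l : List Bool) :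
    canonicalBits (b :: l) = bif l.isEmpty then b else canonicalBits l := by
  rw [canonicalBits, canonicalBits, List.reverse_cons]
  rcases l.eq_nil_or_concat with rfl | ⟨l, c, rfl⟩
  · simp
  · cases l <;> simp

/-- Canonical digit lists are those produced by `Nat.bits`. Hence a certificate with canonical
digits can be compared with the input letter by letter. -/
theorem bits_bitsVal {l : List Bool} (h : canonicalBits l = true) : (bitsVal l).bits = l := by
  induction l with
  | nil => simp [bitsVal]
  | cons b l ih =>
    rw [canonicalBits_cons] at h
    have e : bitsVal (b :: l) = Nat.bit b (bitsVal l) := by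
      rw [bitsVal, Nat.bit_val]; ring
    cases l with
    | nil =>
      obtain rfl : b = true := h
      simp [bitsVal]
    | cons c l =>
      have ih := ih h
      rw [e, Nat.bits_append_bit, ih]
      intro h0
      rw [h0] at ih
      simp at ih

theorem canonicalBits_bits (n : ℕ) : canonicalBits n.bits = true := by
  induction n using Nat.binaryRec' with
  | zero => simp [canonicalBits]
  | bit b n hn ih =>
    rw [Nat.bits_append_bit _ _ hn, canonicalBits_cons]
    by_cases h : n = 0
    · subst h; simp [hn]
    · have : n.bits ≠ [] := by
        intro e
        have := congrArg bitsVal e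
        cases n using Nat.binaryRec' with
        | zero => exact h rfl
        | bit c m hm => rw [Nat.bits_append_bit _ _ hm] at e; simp at e
      cases hb : n.bits with
      | nil => exact absurd hb this
      | cons c l => rw [hb] at ih; exact ih

theorem bitsVal_bits (n : ℕ) : bitsVal n.bits = n := by
  induction n using Nat.binaryRec' with
  | zero => simp [bitsVal]
  | bit b n hn ih => rw [Nat.bits_append_bit _ _ hn, bitsVal, ih, Nat.bit_val]; ring

/-- A fraction: sign, numerator and denominator. -/
abbrev Coord : Type := Bool × (List Bool × List Bool)

namespace Coord

/-- Is this a fraction in the form that is used in words? -/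
def valid (c : Coord) : Bool :=
  -- The last two conditions exclude a zero denominator and a negative zero.
  (canonicalBits c.2.1 && canonicalBits c.2.2) && (!c.2.2.isEmpty && (!c.1 || !c.2.1.isEmpty))

/-- The numerator. -/
def num (c : Coord) : BinInt := bif c.1 then .mk [] c.2.1 else .mk c.2.1 []

/-- The denominator. -/
def den (c : Coord) : BinInt := .mk c.2.2 []

/-- The fraction. -/
def toFrac (c : Coord) : Frac :=
  -- The default `0 / 1` does not occur for valid records.
  if h : 0 < bitsVal c.2.2 then ⟨c.num.toInt, bitsVal c.2.2, h⟩ else ⟨0, 1, one_pos⟩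

/-- The record of a fraction. -/
def ofFrac (q : Frac) : Coord := (decide (q.num < 0), q.num.natAbs.bits, q.den.bits)

theorem bitsVal_pos {l : List Bool} (h : canonicalBits l = true) (h' : l.isEmpty = false) :
    0 < bitsVal l := by
  rw [Nat.pos_iff_ne_zero]
  intro e
  have := bits_bitsVal h
  rw [e] at this
  simp [← this] at h'

theorem bits_ne_nil {n : ℕ} (h : n ≠ 0) : n.bits.isEmpty = false := by
  rw [List.isEmpty_eq_false_iff]
  intro e
  have := bitsVal_bits n
  rw [e] at this
  exact h this.symm

theorem valid_iff (c : Coord) : c.valid = true ↔ (canonicalBits c.2.1 = true ∧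
    canonicalBits c.2.2 = true) ∧ (c.2.2.isEmpty = false ∧ (c.1 = false ∨ c.2.1.isEmpty = false)) := by
  simp [valid]

theorem valid_ofFrac (q : Frac) : (ofFrac q).valid = true := by
  rw [valid_iff]
  refine ⟨⟨canonicalBits_bits _, canonicalBits_bits _⟩, bits_ne_nil q.den_pos.ne', ?_⟩
  rw [or_iff_not_imp_left, Bool.not_eq_false]
  intro h
  have : q.num < 0 := of_decide_eq_true h
  exact bits_ne_nil (by omega)

theorem den_pos {c : Coord} (h : c.valid = true) : 0 < bitsVal c.2.2 := by
  rw [valid_iff] at h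
  exact bitsVal_pos h.1.2 h.2.1

theorem toInt_num (c : Coord) :
    c.num.toInt = if c.1 = true then -(bitsVal c.2.1 : ℤ) else bitsVal c.2.1 := by
  unfold num
  cases c.1 <;> simp [BinInt.toInt_mk, bitsVal]

theorem toFrac_ofFrac (q : Frac) : (ofFrac q).toFrac = q := by
  obtain ⟨n, d, hd⟩ := q
  have : 0 < bitsVal (ofFrac ⟨n, d, hd⟩).2.2 := den_pos (valid_ofFrac _)
  rw [toFrac, dif_pos this]
  have h1 : (ofFrac ⟨n, d, hd⟩).num.toInt = n := by
    rw [toInt_num]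
    simp only [ofFrac, bitsVal_bits, decide_eq_true_eq]
    split_ifs <;> omega
  have h2 : bitsVal (ofFrac ⟨n, d, hd⟩).2.2 = d := bitsVal_bits d
  congr 1

/-- A binary number as a list of letters. -/
def natCodes (l : List Bool) : List (List Bool) := l.map fun b => [b]

/-- A fraction as a list of letters. -/
def codes (c : Coord) : List (List Bool) :=
  (bif c.1 then [[false, false]] else []) ++ (natCodes c.2.1 ++ [false, true] :: natCodes c.2.2)

theorem map_encodeNat (n : ℕ) : (Letter.encodeNat n).map Letter.bits = natCodes n.bits := by
  rw [Letter.encodeNat, List.map_map, natCodes]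
  rfl

theorem codes_eq {c : Coord} (h : c.valid = true) :
    (Letter.encodeFrac c.toFrac).map Letter.bits = c.codes := by
  have hd := den_pos h
  rw [valid_iff] at h
  obtain ⟨⟨h1, h2⟩, -, h3⟩ := h
  rw [toFrac, dif_pos hd, Letter.encodeFrac, List.map_append, List.map_cons, map_encodeNat,
    bits_bitsVal h2, codes, ← List.append_assoc]
  congr 1
  rw [toInt_num]
  obtain ⟨_ | _, n, d⟩ := c
  · simp only [Bool.false_eq_true, if_false, cond_false, List.nil_append, Letter.encodeInt]
    rw [if_neg (by omega), map_encodeNat, Int.natAbs_natCast, bits_bitsVal h1]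
  · have hn := bitsVal_pos h1 (by simpa using h3)
    simp only at hn
    have : -(bitsVal n : ℤ) < 0 := by omega
    simp [Letter.encodeInt, map_encodeNat, bits_bitsVal h1, Letter.bits, hn]

end Coord

/-- The position of a fixed vertex. -/
abbrev FixedCode : Type := Coord × Coord

namespace FixedCode

/-- Are both coordinates in the form that is used in words? -/
def valid (r : FixedCode) : Bool := r.1.valid && r.2.valid

/-- The position as a pair of real numbers. -/
noncomputable def pos (r : FixedCode) : ℝ × ℝ := (r.1.toFrac.toReal, r.2.toFrac.toReal)

/-- Homogeneous coordinates. -/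
def hpoint (r : FixedCode) : HPoint := (r.1.num * r.2.den, r.2.num * r.1.den, r.1.den * r.2.den)

/-- The position as a list of letters. -/
def codes (r : FixedCode) : List (List Bool) := r.1.codes ++ [true, false] :: r.2.codes

theorem codes_eq {r : FixedCode} (h : r.valid = true) :
    (Letter.encodePoint r.1.toFrac r.2.toFrac).map Letter.bits = r.codes := by
  rw [valid, Bool.and_eq_true] at h
  rw [Letter.encodePoint, List.map_append, List.map_cons, Coord.codes_eq h.1, Coord.codes_eq h.2]
  rfl

theorem toReal_den (c : Coord) : c.den.toReal = bitsVal c.2.2 := by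
  simp [Coord.den, BinInt.toReal, BinInt.toInt_mk, bitsVal]

theorem toReal_toFrac {c : Coord} (h : c.valid = true) :
    c.toFrac.toReal = c.num.toReal / c.den.toReal := by
  rw [Coord.toFrac, dif_pos (Coord.den_pos h), Frac.toReal, toReal_den]
  rfl

theorem hpoint_spec {r : FixedCode} (h : r.valid = true) :
    r.hpoint.proper = true ∧ r.hpoint.pt = r.pos := by
  rw [valid, Bool.and_eq_true] at h
  have h1 : 0 < r.1.den.toReal := by
    rw [toReal_den]; exact_mod_cast Coord.den_pos h.1
  have h2 : 0 < r.2.den.toReal := by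
    rw [toReal_den]; exact_mod_cast Coord.den_pos h.2
  constructor
  · rw [HPoint.proper_iff]
    simp only [hpoint, BinInt.toReal_mul]
    positivity
  · rw [pos, toReal_toFrac h.1, toReal_toFrac h.2]
    simp only [HPoint.pt, Homog.point, HPoint.coords, hpoint, BinInt.toReal_mul]
    refine Prod.ext ?_ ?_
    · simp only; field_simp
    · simp only; field_simp

end FixedCode

/-- A list of words, each one followed by a semicolon. -/
def blockCodes (bs : List (List (List Bool))) : List (List Bool) :=
  bs.flatMap fun b => b ++ [[true, true]]

/-- The word that describes an instance. -/
def instanceCodes (F : List FixedCode) (R : List (List Bool)) : List (List Bool) :=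
  blockCodes (F.map FixedCode.codes) ++ [] :: blockCodes (R.map Coord.natCodes)

theorem map_encodeBlocks (bs : List (List Letter)) :
    (Letter.encodeBlocks bs).map Letter.bits = blockCodes (bs.map (List.map Letter.bits)) := by
  induction bs with
  | nil => rfl
  | cons b bs ih =>
    rw [Letter.encodeBlocks, List.flatMap_cons, List.map_append, List.map_append,
      ← Letter.encodeBlocks, ih]
    rfl

/-- The instance with the given positions and adjacency matrix. -/
def mkInstance {k n : ℕ} (fix : Fin k → FixedCode) (row : Fin n → Fin k → Bool)
    (h : Function.Injective fun i => (fix i).pos) : FMInstance :=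
  ⟨k, n, row, fun i => (fix i).1.toFrac, fun i => (fix i).2.toFrac, h⟩

theorem map_encode_mkInstance {k n : ℕ} (fix : Fin k → FixedCode) (row : Fin n → Fin k → Bool)
    (h : Function.Injective fun i => (fix i).pos) (hv : ∀ i, (fix i).valid = true) :
    (mkInstance fix row h).encode.map Letter.bits =
      instanceCodes (List.ofFn fix) (List.ofFn fun u => List.ofFn (row u)) := by
  rw [FMInstance.encode, List.map_append, List.map_cons, map_encodeBlocks, map_encodeBlocks,
    List.map_ofFn, List.map_ofFn, instanceCodes, List.map_ofFn, List.map_ofFn]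
  congr 3
  · funext i
    exact FixedCode.codes_eq (hv i)
  · congr 1
    funext u
    simp only [Function.comp, Coord.natCodes, List.map_ofFn]
    rfl

theorem exists_eq_mkInstance (I : FMInstance) : ∃ (k n : ℕ) (fix : Fin k → FixedCode)
    (row : Fin n → Fin k → Bool) (h : Function.Injective fun i => (fix i).pos),
    (∀ i, (fix i).valid = true) ∧ I = mkInstance fix row h := by
  obtain ⟨k, n, row, x, y, h⟩ := I
  refine ⟨k, n, fun i => (.ofFrac (x i), .ofFrac (y i)), row, ?_, fun i => ?_, ?_⟩
  · simpa only [FixedCode.pos, Coord.toFrac_ofFrac] using h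
  · simp [FixedCode.valid, Coord.valid_ofFrac]
  · simp only [mkInstance, Coord.toFrac_ofFrac]

/-! ### The verifier -/

/-- A certificate: the positions of the fixed vertices, and for each mobile vertex the row of the
adjacency matrix and a position. -/
abbrev Certificate : Type := List FixedCode × List (List Bool × HPoint)

/-- The points that are marked by a row of the adjacency matrix. -/
def selectPoints (H : List HPoint) (r : List Bool) : List HPoint :=
  ((H.zip r).filter fun x => x.2).map fun x => x.1

/-- Are these the positions of the mobile vertices in a drawing? -/
def checkMobile (H : List HPoint) (M : List (List Bool × HPoint)) : Bool :=
  (M.all fun m => m.2.proper && HPoint.isStar H (selectPoints H m.1) m.2) &&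
    pairRel (fun m m' => HPoint.isApart (selectPoints H m.1) (selectPoints H m'.1) m.2 m'.2) M

/-- Does the certificate describe an instance and a drawing? -/
def checkForm (c : Certificate) : Bool :=
  -- With a constant relation, `listRel` compares lengths: a row has one entry for each fixed
  -- vertex.
  (c.1.all FixedCode.valid && c.2.all fun m => listRel (fun _ _ => true) m.1 c.1) &&
    (pairRel (fun p q => !HPoint.eqPt p q) (c.1.map FixedCode.hpoint) &&
      checkMobile (c.1.map FixedCode.hpoint) c.2)

/-- Does the certificate describe the given word and a drawing? -/
def checkCertificate (w : List (List Bool)) (c : Certificate) : Bool :=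
  -- The input word is never parsed; the instance is taken from the certificate, encoded and
  -- compared with it.
  sameWord w (instanceCodes c.1 (c.2.map fun m => m.1)) && checkForm c

/-- The verifier, for inputs in reverse order. -/
def verifier (s : List (List Bool)) : Bool :=
  checkCertificate (wordPart s) (Decode.dec (BinTree.parse (certPart s)))

/-! ### The verifier runs in polynomial time -/

namespace PolyTime

theorem selectPoints {α : Type} [Data α] {f : α → List HPoint} {g : α → List Bool} (hf : PolyTime f)
    (hg : PolyTime g) : PolyTime (fun x => selectPoints (f x) (g x)) :=
  .map (.filter (.zip hf hg) (by fun_prop)) (by fun_prop)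

theorem checkMobile : PolyTime fun x : List HPoint × List (List Bool × HPoint) =>
    checkMobile x.1 x.2 := by
  unfold _root_.checkMobile HPoint.proper
  refine .and (.all (by fun_prop) (.and (by fun_prop) ?_)) (.pairRel ?_ (by fun_prop))
  · exact .isStar (by fun_prop) (.selectPoints (by fun_prop) (by fun_prop)) (by fun_prop)
  · exact .isApart (.selectPoints (by fun_prop) (by fun_prop))
      (.selectPoints (by fun_prop) (by fun_prop)) (by fun_prop) (by fun_prop)

theorem coord_valid : PolyTime Coord.valid := by
  unfold Coord.valid canonicalBits; fun_prop

theorem fixedCode_valid : PolyTime FixedCode.valid :=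
  .and (coord_valid.comp (.fst .id)) (coord_valid.comp (.snd .id))

@[fun_prop]
theorem coord_num {α : Type} [Data α] {f : α → Coord} (hf : PolyTime f) :
    PolyTime fun x => (f x).num := by
  unfold Coord.num; fun_prop

@[fun_prop]
theorem coord_den {α : Type} [Data α] {f : α → Coord} (hf : PolyTime f) :
    PolyTime fun x => (f x).den := by
  unfold Coord.den; fun_prop

theorem hpoint : PolyTime FixedCode.hpoint := by
  unfold FixedCode.hpoint; fun_prop

theorem natCodes {α : Type} [Data α] {f : α → List Bool} (hf : PolyTime f) :
    PolyTime fun x => Coord.natCodes (f x) := by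
  unfold Coord.natCodes; fun_prop

theorem coord_codes {α : Type} [Data α] {f : α → Coord} (hf : PolyTime f) :
    PolyTime fun x => (f x).codes :=
  .append (.bcond (by fun_prop) (by fun_prop) (by fun_prop))
    (.append (.natCodes (by fun_prop)) (.list_cons (by fun_prop) (.natCodes (by fun_prop))))

theorem fixedCode_codes : PolyTime FixedCode.codes :=
  .append (.coord_codes (by fun_prop)) (.list_cons (by fun_prop) (.coord_codes (by fun_prop)))

theorem blockCodes {α : Type} [Data α] {f : α → List (List (List Bool))} (hf : PolyTime f) :
    PolyTime fun x => blockCodes (f x) := by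
  unfold _root_.blockCodes; fun_prop

theorem instanceCodes {α : Type} [Data α] {f : α → List FixedCode} {g : α → List (List Bool)}
    (hf : PolyTime f) (hg : PolyTime g) : PolyTime fun x => instanceCodes (f x) (g x) :=
  .append (.blockCodes (.map hf (fixedCode_codes.comp (.snd .id))))
    (.list_cons (by fun_prop) (.blockCodes (.map hg (.natCodes (by fun_prop)))))

theorem checkForm : PolyTime checkForm := by
  have h : PolyTime fun c : Certificate => c.1.map FixedCode.hpoint :=
    .map (.fst .id) (hpoint.comp (.snd .id))
  refine .and (.and (.all (by fun_prop) (fixedCode_valid.comp (.snd .id))) (.all (by fun_prop)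
    (.listRel (r := fun _ _ _ => true) (by fun_prop) (by fun_prop) (by fun_prop)))) (.and ?_ ?_)
  · exact .pairRel (r := fun _ p q => !HPoint.eqPt p q) (by fun_prop) h
  · exact checkMobile.comp (h.pair (by fun_prop))

theorem verifier : PolyTime verifier := by
  have h : PolyTime fun s => (Decode.dec (BinTree.parse (_root_.certPart s)) : Certificate) :=
    Decode.polyTime.comp (.parse .certPart)
  exact .and (.sameWord .wordPart (.instanceCodes h.fst (.map h.snd (by fun_prop))))
    (checkForm.comp h)

end PolyTime

theorem mem_selectPoints {k : ℕ} {H : Fin k → HPoint} {r : Fin k → Bool} {p : HPoint} :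
    p ∈ selectPoints (List.ofFn H) (List.ofFn r) ↔ ∃ i, r i = true ∧ H i = p := by
  have : (List.ofFn H).zip (List.ofFn r) = List.ofFn fun i => (H i, r i) := by
    apply List.ext_getElem
    · simp
    · intro i h1 h2; simp
  rw [selectPoints, this]
  simp only [List.mem_map, List.mem_filter, List.mem_ofFn]
  constructor
  · rintro ⟨_, ⟨⟨i, rfl⟩, hi⟩, rfl⟩
    exact ⟨i, hi, rfl⟩
  · rintro ⟨i, hi, rfl⟩
    exact ⟨_, ⟨⟨i, rfl⟩, hi⟩, rfl⟩

/-! ### What the verifier checks -/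

section spec

open HPoint

variable {k n : ℕ} {fix : Fin k → FixedCode} {row : Fin n → Fin k → Bool}

theorem pts_fixed (h : Function.Injective fun i => (fix i).pos) (hv : ∀ i, (fix i).valid = true) :
    pts (List.ofFn fun i => (fix i).hpoint) = (mkInstance fix row h).toFMBigraph.fixedPoints := by
  ext x
  simp only [pts, List.mem_ofFn, Set.mem_ofPred_eq, FMBigraph.fixedPoints, Set.mem_range]
  constructor
  · rintro ⟨_, ⟨i, rfl⟩, rfl⟩
    exact ⟨i, (FixedCode.hpoint_spec (hv i)).2.symm⟩
  · rintro ⟨i, rfl⟩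
    exact ⟨_, ⟨i, rfl⟩, (FixedCode.hpoint_spec (hv i)).2⟩

theorem pts_selectPoints (h : Function.Injective fun i => (fix i).pos)
    (hv : ∀ i, (fix i).valid = true) (u : Fin n) :
    pts (selectPoints (List.ofFn fun i => (fix i).hpoint) (List.ofFn (row u))) =
      (mkInstance fix row h).toFMBigraph.nbrs u := by
  ext x
  simp only [pts, mem_selectPoints, Set.mem_ofPred_eq, FMBigraph.nbrs, Set.mem_image]
  constructor
  · rintro ⟨_, ⟨i, hi, rfl⟩, rfl⟩
    exact ⟨i, hi, (FixedCode.hpoint_spec (hv i)).2.symm⟩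
  · rintro ⟨i, hi, rfl⟩
    exact ⟨_, ⟨i, hi, rfl⟩, (FixedCode.hpoint_spec (hv i)).2⟩

theorem checkMobile_iff (h : Function.Injective fun i => (fix i).pos)
    (hv : ∀ i, (fix i).valid = true) (m : Fin n → HPoint) :
    checkMobile (List.ofFn fun i => (fix i).hpoint)
        (List.ofFn fun u => (List.ofFn (row u), m u)) = true ↔
      (∀ u, (m u).proper = true) ∧
        (mkInstance fix row h).toFMBigraph.IsGood fun u => (m u).pt := by
  have hP : ∀ p ∈ List.ofFn fun i => (fix i).hpoint, proper p = true := by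
    simp only [List.mem_ofFn]
    rintro _ ⟨i, rfl⟩
    exact (FixedCode.hpoint_spec (hv i)).1
  have hN : ∀ u : Fin n, selectPoints (List.ofFn fun i => (fix i).hpoint) (List.ofFn (row u)) ⊆
      List.ofFn fun i => (fix i).hpoint := by
    intro u p hp
    obtain ⟨i, -, rfl⟩ := mem_selectPoints.1 hp
    exact List.mem_ofFn.2 ⟨i, rfl⟩
  have hstar : ∀ u, (m u).proper = true → _ := fun u hu => isStar_iff hP (hN u) hu
  rw [checkMobile, Bool.and_eq_true, List.all_eq_true, pairRel_iff, List.pairwise_ofFn]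
  simp only [List.mem_ofFn, forall_exists_index, forall_apply_eq_imp_iff, Bool.and_eq_true]
  constructor
  · rintro ⟨h1, h2⟩
    have hs : ∀ u : Fin n, Plane.IsStar (mkInstance fix row h).toFMBigraph.fixedPoints
        ((mkInstance fix row h).toFMBigraph.nbrs u) (m u).pt := fun u => by
      rw [← pts_fixed (row := row) h hv, ← pts_selectPoints h hv]
      exact (hstar u (h1 u).1).1 (h1 u).2
    refine ⟨fun u => (h1 u).1, ⟨hs, fun u v huv => ?_⟩⟩
    · have key : ∀ u v : Fin n, u < v → _ := fun u v huv =>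
        (isApart_iff hP (hN u) (hN v) (h1 u).1 (h1 v).1 ((hstar u (h1 u).1).1 (h1 u).2)
          ((hstar v (h1 v).1).1 (h1 v).2)).1 (h2 huv)
      simp only [pts_selectPoints h hv] at key
      -- Only pairs with `u < v` are tested; `Apart` is symmetric.
      rcases lt_or_gt_of_ne huv with hlt | hlt
      · exact key u v hlt
      · exact (key v u hlt).symm
  · rintro ⟨h1, h2, h3⟩
    have h2' : ∀ u, isStar _ _ (m u) = true := fun u => (hstar u (h1 u)).2 (by
      rw [pts_fixed (row := row) h hv, pts_selectPoints h hv]; exact h2 u)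
    refine ⟨fun u => ⟨h1 u, h2' u⟩, fun u v huv => ?_⟩
    refine (isApart_iff hP (hN u) (hN v) (h1 u) (h1 v) ((hstar u (h1 u)).1 (h2' u))
      ((hstar v (h1 v)).1 (h2' v))).2 ?_
    simp only [pts_selectPoints h hv]
    exact h3 u v huv.ne

theorem checkForm_iff (m : Fin n → HPoint) :
    checkForm (List.ofFn fix, List.ofFn fun u => (List.ofFn (row u), m u)) = true ↔
      (∀ i, (fix i).valid = true) ∧ ∃ h : Function.Injective fun i => (fix i).pos,
        (∀ u, (m u).proper = true) ∧
          (mkInstance fix row h).toFMBigraph.IsGood fun u => (m u).pt := by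
  simp only [checkForm, Bool.and_eq_true, List.all_eq_true, List.mem_ofFn, forall_exists_index,
    forall_apply_eq_imp_iff, pairRel_iff, List.map_ofFn, List.pairwise_ofFn, listRel_iff,
    Function.comp]
  constructor
  · rintro ⟨⟨hv, -⟩, h1, h2⟩
    have hinj : Function.Injective fun i => (fix i).pos := by
      have key : ∀ i j : Fin k, i < j → (fix i).pos ≠ (fix j).pos := by
        intro i j hij e
        have := h1 hij
        rw [Bool.not_eq_true', ← Bool.not_eq_true, eqPt_iff (FixedCode.hpoint_spec (hv i)).1
          (FixedCode.hpoint_spec (hv j)).1, (FixedCode.hpoint_spec (hv i)).2,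
          (FixedCode.hpoint_spec (hv j)).2] at this
        exact this e
      intro i j e
      by_contra hne
      rcases lt_or_gt_of_ne hne with hlt | hlt
      · exact key i j hlt e
      · exact key j i hlt e.symm
    exact ⟨hv, hinj, (checkMobile_iff hinj hv m).1 h2⟩
  · rintro ⟨hv, hinj, h2⟩
    refine ⟨⟨hv, fun u => ?_⟩, fun i j hij => ?_, (checkMobile_iff hinj hv m).2 h2⟩
    · rw [List.forall₂_iff_get]
      simp
    · rw [Bool.not_eq_true', ← Bool.not_eq_true, eqPt_iff (FixedCode.hpoint_spec (hv i)).1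
        (FixedCode.hpoint_spec (hv j)).1, (FixedCode.hpoint_spec (hv i)).2,
        (FixedCode.hpoint_spec (hv j)).2]
      exact fun e => hij.ne (hinj e)

/-- The length tests turn the list of rows into a matrix. -/
theorem exists_eq_ofFn {c : Certificate} (h : checkForm c = true) : ∃ (k n : ℕ)
    (fix : Fin k → FixedCode) (row : Fin n → Fin k → Bool) (m : Fin n → HPoint),
    c = (List.ofFn fix, List.ofFn fun u => (List.ofFn (row u), m u)) := by
  obtain ⟨F, M⟩ := c
  simp only [checkForm, Bool.and_eq_true, List.all_eq_true, listRel_iff] at h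
  have hlen : ∀ u : Fin M.length, M[u].1.length = F.length := fun u =>
    (h.1.2 M[u] (List.getElem_mem _)).length_eq
  refine ⟨F.length, M.length, fun i => F[i], fun u i => M[u].1[i]'(by rw [hlen]; exact i.2),
    fun u => M[u].2, Prod.ext ?_ ?_⟩
  · simp
  · apply List.ext_getElem
    · simp
    · intro i h1 h2
      simp only [List.getElem_ofFn]
      refine Prod.ext ?_ rfl
      apply List.ext_getElem
      · simpa using hlen ⟨i, h1⟩
      · intro j h3 h4
        simp

end spec

/-! ### The length of a certificate -/

theorem sz_bits_le (l : List Bool) : sz l ≤ 1 + 4 * l.length := by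
  induction l with
  | nil => simp
  | cons b l ih =>
    have := sz_bool_le b
    simp
    omega

/-- The slash is always present and absorbs the constant part of the size. -/
theorem Coord.sz_le (c : Coord) : sz c ≤ 7 * c.codes.length := by
  obtain ⟨s, a, b⟩ := c
  have h1 := sz_bits_le a
  have h2 := sz_bits_le b
  have h3 := sz_bool_le s
  have h4 : a.length + b.length + 1 ≤ (Coord.codes (s, a, b)).length := by
    simp [Coord.codes, Coord.natCodes]
    omega
  simp only [sz_prod]
  omega

theorem FixedCode.sz_le (r : FixedCode) : sz r ≤ 8 * r.codes.length := by
  have h1 := r.1.sz_le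
  have h2 := r.2.sz_le
  have h3 : r.codes.length = r.1.codes.length + (r.2.codes.length + 1) := by
    simp [FixedCode.codes]
  have : sz r = 1 + (sz r.1 + sz r.2) := rfl
  omega

theorem length_blockCodes_cons (b : List (List Bool)) (bs : List (List (List Bool))) :
    (blockCodes (b :: bs)).length = b.length + 1 + (blockCodes bs).length := by
  simp [blockCodes]
  omega

theorem sz_fixed_le (F : List FixedCode) :
    sz F ≤ 1 + 9 * (blockCodes (F.map FixedCode.codes)).length := by
  induction F with
  | nil => simp
  | cons r F ih =>
    have := r.sz_le
    rw [sz_cons, List.map_cons, length_blockCodes_cons]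
    omega

/-- Every row, even an empty one, ends with a semicolon, so the length of the word bounds the number
of positions. -/
theorem sz_mobile_le {B : ℕ} (M : List (List Bool × HPoint)) (h : ∀ m ∈ M, sz m.2 ≤ B) :
    sz M ≤ 1 + (4 + B) * (blockCodes ((M.map fun m => m.1).map Coord.natCodes)).length := by
  induction M with
  | nil => simp
  | cons m M ih =>
    have h1 := sz_bits_le m.1
    have h2 := h m (by simp)
    have h3 := ih fun m' hm => h m' (by simp [hm])
    rw [sz_cons, List.map_cons, List.map_cons, length_blockCodes_cons,
      show sz m = 1 + (sz m.1 + sz m.2) from rfl, Coord.natCodes, List.length_map]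
    have h4 : (4 + B) * (m.1.length + 1 + (blockCodes ((M.map fun m => m.1).map
        Coord.natCodes)).length) = 4 * m.1.length + 4 + B * m.1.length + B +
        (4 + B) * (blockCodes ((M.map fun m => m.1).map Coord.natCodes)).length := by ring
    rw [h4]
    have h5 : 0 ≤ B * m.1.length := Nat.zero_le _
    omega

/-- Twelve points and the eleven nodes that join them. -/
theorem HPoint.UsesOnly.sz_le {Q : List HPoint} {c : VertexCode} (h : UsesOnly Q c) :
    sz c ≤ 11 + 12 * sz Q := by
  obtain ⟨⟨a₁, a₂, a₃, a₄⟩, ⟨b₁, b₂, b₃, b₄⟩, ⟨c₁, c₂, c₃, c₄⟩⟩ := c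
  obtain ⟨⟨⟨h1, h2⟩, h3, h4⟩, ⟨⟨h5, h6⟩, h7, h8⟩, ⟨⟨h9, h10⟩, h11, h12⟩⟩ := h
  simp only [sz_prod (β := HPoint), sz_prod (α := HPoint),
    sz_prod (α := HPoint × HPoint × HPoint × HPoint)]
  have := sz_le_of_mem h1
  have := sz_le_of_mem h2
  have := sz_le_of_mem h3
  have := sz_le_of_mem h4
  have := sz_le_of_mem h5
  have := sz_le_of_mem h6
  have := sz_le_of_mem h7
  have := sz_le_of_mem h8
  have := sz_le_of_mem h9
  have := sz_le_of_mem h10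
  have := sz_le_of_mem h11
  have := sz_le_of_mem h12
  simp only at *
  omega

/-- Explicit estimates of bit lengths are avoided: each position is the value of a polynomial-time
function at a code of polynomial size, so `PolyTime.size_bound` applies. -/
theorem exists_size_bound : ∃ q : Polynomial ℕ, ∀ c : Certificate,
    (∀ m ∈ c.2, ∃ d, HPoint.UsesOnly (HPoint.withAxes (c.1.map FixedCode.hpoint)) d ∧
      m.2 = HPoint.ofVertexCode d) →
    sz c ≤ q.eval (instanceCodes c.1 (c.2.map fun m => m.1)).length := by
  have h1 : PolyTime fun F : List FixedCode => HPoint.withAxes (F.map FixedCode.hpoint) := by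
    unfold HPoint.withAxes
    have := PolyTime.map (l := fun F : List FixedCode => F) (g := fun _ r => r.hpoint) .id
      (PolyTime.hpoint.comp (.snd .id))
    fun_prop
  obtain ⟨Q₁, hQ₁⟩ := h1.size_bound
  obtain ⟨Q₂, hQ₂⟩ := PolyTime.ofVertexCode.size_bound
  refine ⟨3 + 9 * .X + (4 + Q₂.comp (11 + 12 * Q₁.comp (1 + 9 * .X))) * .X, fun ⟨F, M⟩ h => ?_⟩
  generalize hN : (instanceCodes F (M.map fun m => m.1)).length = N
  rw [instanceCodes, List.length_append, List.length_cons] at hN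
  have hF := sz_fixed_le F
  have hF' : sz F ≤ 1 + 9 * N := by omega
  have hM := sz_mobile_le (B := Q₂.eval (11 + 12 * Q₁.eval (1 + 9 * N))) M fun m hm => by
    obtain ⟨d, hd, e⟩ := h m hm
    rw [e]
    refine (hQ₂ d).trans (Q₂.eval_nat_mono (hd.sz_le.trans ?_))
    have := (hQ₁ F).trans (Q₁.eval_nat_mono hF')
    simp only at this ⊢
    omega
  have hM' := hM.trans (Nat.add_le_add_left (Nat.mul_le_mul_left _
    (show (blockCodes ((M.map fun m => m.1).map Coord.natCodes)).length ≤ N by omega)) 1)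
  rw [sz_prod]
  simp only [Polynomial.eval_add, Polynomial.eval_mul, Polynomial.eval_comp, Polynomial.eval_ofNat,
    Polynomial.eval_X, Polynomial.eval_one]
  omega

/-! ### Soundness and completeness of certificates -/

theorem mem_of_checkCertificate {w : List Letter} {c : Certificate}
    (h : checkCertificate (w.map Letter.bits) c = true) : w ∈ FMZeroBendConvexHull := by
  rw [checkCertificate, Bool.and_eq_true, sameWord_iff] at h
  obtain ⟨hw, hc⟩ := h
  obtain ⟨k, n, fix, row, m, rfl⟩ := exists_eq_ofFn hc
  obtain ⟨hv, hinj, -, hg⟩ := (checkForm_iff m).1 hc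
  refine ⟨mkInstance fix row hinj, ?_, _, hg.isPlanarConvexHullDrawing⟩
  apply List.map_injective_iff.2 Letter.bits_injective
  rw [map_encode_mkInstance _ _ _ hv, hw, List.map_ofFn]
  rfl

/-- Each mobile vertex of a given drawing is replaced by the centroid found in its cell, which
leaves a drawing by `FMBigraph.IsGood.of_sameCell`. -/
theorem exists_certificate {w : List Letter} (h : w ∈ FMZeroBendConvexHull) :
    ∃ c : Certificate, checkCertificate (w.map Letter.bits) c = true ∧
      ∀ m ∈ c.2, ∃ d, HPoint.UsesOnly (HPoint.withAxes (c.1.map FixedCode.hpoint)) d ∧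
        m.2 = HPoint.ofVertexCode d := by
  obtain ⟨I, rfl, p, hp⟩ := h
  obtain ⟨k, n, fix, row, hinj, hv, rfl⟩ := exists_eq_mkInstance I
  have hg := hp.isGood
  have hP : ∀ q ∈ List.ofFn fun i => (fix i).hpoint, q.proper = true := by
    simp only [List.mem_ofFn]
    rintro _ ⟨i, rfl⟩
    exact (FixedCode.hpoint_spec (hv i)).1
  have hpts := pts_fixed (row := row) hinj hv
  have key : ∀ u : Fin n, ∃ d, HPoint.UsesOnly (HPoint.withAxes (List.ofFn fun i => (fix i).hpoint)) d ∧
      (HPoint.ofVertexCode d).proper = true ∧ Plane.SameCell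
        (mkInstance fix row hinj).toFMBigraph.fixedPoints (p (.inr u)) (HPoint.ofVertexCode d).pt := by
    intro u
    rw [← hpts]
    refine HPoint.exists_code hP ?_
    rw [hpts]
    exact convexHull_mono (FMBigraph.nbrs_subset _ _) (hg.star u).hull
  choose d hd hproper hcell using key
  have hfix : (List.ofFn fix).map FixedCode.hpoint = List.ofFn fun i => (fix i).hpoint := by
    rw [List.map_ofFn]; rfl
  refine ⟨(List.ofFn fix, List.ofFn fun u => (List.ofFn (row u), HPoint.ofVertexCode (d u))), ?_, ?_⟩
  · rw [checkCertificate, Bool.and_eq_true, sameWord_iff, checkForm_iff,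
      map_encode_mkInstance _ _ _ hv, List.map_ofFn]
    exact ⟨rfl, hv, hinj, hproper, hg.of_sameCell hcell⟩
  · simp only [List.mem_ofFn, hfix]
    rintro _ ⟨u, rfl⟩
    exact ⟨d u, hd u, rfl⟩

theorem mainTheorem5 : InNP FMZeroBendConvexHull := by
  obtain ⟨q, hq⟩ := exists_size_bound
  refine ⟨q, _, PolyTime.verifier.toTuringMachine, fun w => ?_⟩
  simp only [verifier, wordPart_input, certPart_input]
  constructor
  · intro h
    obtain ⟨c, hc, hm⟩ := exists_certificate h
    refine ⟨(Data.code c).enc, ?_, ?_⟩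
    -- The bound is in terms of the encoding of the certificate's instance, which is the word
    -- itself.
    · have := hq c hm
      rw [checkCertificate, Bool.and_eq_true, sameWord_iff] at hc
      rw [← hc.1, List.length_map] at this
      rwa [BinTree.length_enc]
    · rwa [BinTree.parse_enc, Decode.dec_code]
  · rintro ⟨c, -, h⟩
    exact mem_of_checkCertificate h
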